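/- Let $1\le p<2$ and let $\Omega\subseteq\mathbb R^2$ be a bounded open set. Let $\{K_i\}_{i\in I}$ be the family of the connected components of the complement $\Omega^c=\mathbb R^2\setminus\Omega$, and assume that for every $i\in I$ there is a point $x_i\in K_i$ such that the set $E:=\{x_i : i\in I\}$ satisfies $\mathcal H^{2-p}(E)=0$, where $\mathcal H^{2-p}$ is the $(2-p)$-dimensional Hausdorff measure (that is, $\Omega$ belongs to the class $\mathcal A_p(\mathbb R^2)$ of admissible domains). For $1\le q<\infty$ let $W^{1,q}(\Omega)$ be the space of the real functions $u\in L^q(\Omega)$ whose distributional gradient $\nabla u$ belongs to $L^q(\Omega,\mathbb R^2)$, with the norm $(\|u\|_q^q+\|\nabla u\|_q^q)^{1/q}$. Then $W^{1,2}(\Omega)\subseteq W^{1,p}(\Omega)$, and $W^{1,2}(\Omega)$ is dense in $W^{1,p}(\Omega)$ with respect to the norm of $W^{1,p}(\Omega)$. -/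

import Mathlib

open MeasureTheory Set
open scoped ENNReal ContDiff

noncomputable section

/-- The Euclidean plane. -/
abbrev Plane : Type := EuclideanSpace ℝ (Fin 2)

/-- The family of the connected components of the complement of `Ω`. -/
def complComponents (Ω : Set Plane) : Set (Set Plane) :=
  {K | ∃ x ∈ Ωᶜ, K = connectedComponentIn Ωᶜ x}

/-- The class `𝒜_p(ℝ²)`: bounded open sets `Ω` for which one can select a point `x K ∈ K` in every
connected component `K` of the complement so that the set of the selected points has
`(2 - p)`-dimensional Hausdorff measure zero. -/
structure IsAdmissibleDomain (p : ℝ) (Ω : Set Plane) : Prop where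
  isOpen : IsOpen Ω
  isBounded : Bornology.IsBounded Ω
  exists_selection : ∃ x : complComponents Ω → Plane,
    (∀ K : complComponents Ω, x K ∈ (K : Set Plane)) ∧
      Measure.hausdorffMeasure (2 - p) (range x) = 0

/-- For `u` and `g` that are integrable on the compact subsets of the open set `Ω`: the gradient of
`u` in the sense of distributions on `Ω` is `g`. It is used below only for `u` and `g` in
`L^p(Ω)` with `p ≥ 1`. -/
def IsWeakGradient (Ω : Set Plane) (u : Plane → ℝ) (g : Plane → Plane) : Prop :=
  ∀ φ : Plane → ℝ, ContDiff ℝ ∞ φ → HasCompactSupport φ → tsupport φ ⊆ Ω → ∀ i : Fin 2,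
    ∫ x in Ω, u x * fderiv ℝ φ x (EuclideanSpace.single i 1) = - ∫ x in Ω, g x i * φ x

theorem integrable_mul_of_locallyIntegrable {μ : Measure Plane} {f φ : Plane → ℝ}
    (hf : LocallyIntegrable f μ) (hφ : Continuous φ) (hc : HasCompactSupport φ) :
    Integrable (fun x => f x * φ x) μ := by
  simpa [mul_comm] using hf.integrable_smul_left_of_hasCompactSupport hφ hc

theorem integrable_mul_partial {μ : Measure Plane} {f φ : Plane → ℝ} (hf : LocallyIntegrable f μ)
    (hφ : ContDiff ℝ ∞ φ) (hc : HasCompactSupport φ) (v : Plane) :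
    Integrable (fun x => f x * fderiv ℝ φ x v) μ :=
  integrable_mul_of_locallyIntegrable hf
    ((hφ.continuous_fderiv (by simp)).clm_apply continuous_const) (hc.fderiv_apply (𝕜 := ℝ) v)

theorem locallyIntegrable_coord {μ : Measure Plane} {g : Plane → Plane}
    (hg : LocallyIntegrable g μ) (i : Fin 2) : LocallyIntegrable (fun x => g x i) μ := fun x =>
  let ⟨s, hs, h⟩ := hg x
  ⟨s, hs, (EuclideanSpace.proj (𝕜 := ℝ) i).integrable_comp h⟩

/-- The Sobolev space `W^{1,p}(Ω)`, realised as the space of the pairs `(u, ∇u)` with `u` in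
`L^p(Ω)` and distributional gradient `∇u` in `L^p(Ω, ℝ²)`. For `p < ∞` the norm that it inherits is
`(‖u‖_p ^ p + ‖∇u‖_p ^ p) ^ (1 / p)`. -/
def SobolevSpace (p : ℝ≥0∞) [Fact (1 ≤ p)] (Ω : Set Plane) :
    Submodule ℝ
      (WithLp p (Lp ℝ p (volume.restrict Ω) × Lp Plane p (volume.restrict Ω))) where
  carrier := {w | IsWeakGradient Ω w.fst w.snd}
  zero_mem' := by
    intro φ _ _ _ i
    have h1 := Lp.coeFn_zero ℝ p (volume.restrict Ω)
    have h2 := Lp.coeFn_zero Plane p (volume.restrict Ω)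
    rw [integral_eq_zero_of_ae, integral_eq_zero_of_ae, neg_zero]
    · filter_upwards [h2] with x hx
      rw [WithLp.zero_snd, hx]
      simp
    · filter_upwards [h1] with x hx
      rw [WithLp.zero_fst, hx]
      simp
  add_mem' := by
    intro a b ha hb φ hφ hc hs i
    have hp : (1 : ℝ≥0∞) ≤ p := Fact.out
    have L1 := fun f : Lp ℝ p (volume.restrict Ω) => (Lp.memLp f).locallyIntegrable hp
    have L2 := fun f : Lp Plane p (volume.restrict Ω) =>
      locallyIntegrable_coord ((Lp.memLp f).locallyIntegrable hp) i
    have e1 : ∫ x in Ω, (a + b).fst x * fderiv ℝ φ x (EuclideanSpace.single i 1) =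
        ∫ x in Ω, (a.fst x * fderiv ℝ φ x (EuclideanSpace.single i 1) +
          b.fst x * fderiv ℝ φ x (EuclideanSpace.single i 1)) := by
      refine integral_congr_ae ?_
      filter_upwards [Lp.coeFn_add a.fst b.fst] with x hx
      rw [WithLp.add_fst, hx, Pi.add_apply, add_mul]
    have e2 : ∫ x in Ω, (a + b).snd x i * φ x =
        ∫ x in Ω, (a.snd x i * φ x + b.snd x i * φ x) := by
      refine integral_congr_ae ?_
      filter_upwards [Lp.coeFn_add a.snd b.snd] with x hx
      rw [WithLp.add_snd, hx, Pi.add_apply, PiLp.add_apply, add_mul]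
    rw [e1, e2, integral_add (integrable_mul_partial (L1 _) hφ hc _)
      (integrable_mul_partial (L1 _) hφ hc _),
      integral_add (integrable_mul_of_locallyIntegrable (L2 _) hφ.continuous hc)
      (integrable_mul_of_locallyIntegrable (L2 _) hφ.continuous hc), ha φ hφ hc hs i,
      hb φ hφ hc hs i]
    ring
  smul_mem' := by
    intro c a ha φ hφ hc hs i
    have e1 : ∫ x in Ω, (c • a).fst x * fderiv ℝ φ x (EuclideanSpace.single i 1) =
        ∫ x in Ω, c * (a.fst x * fderiv ℝ φ x (EuclideanSpace.single i 1)) := by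
      refine integral_congr_ae ?_
      filter_upwards [Lp.coeFn_smul c a.fst] with x hx
      rw [WithLp.smul_fst, hx, Pi.smul_apply, smul_eq_mul, mul_assoc]
    have e2 : ∫ x in Ω, (c • a).snd x i * φ x = ∫ x in Ω, c * (a.snd x i * φ x) := by
      refine integral_congr_ae ?_
      filter_upwards [Lp.coeFn_smul c a.snd] with x hx
      rw [WithLp.smul_snd, hx, Pi.smul_apply, PiLp.smul_apply, smul_eq_mul, mul_assoc]
    rw [e1, e2, integral_const_mul, integral_const_mul, ha φ hφ hc hs i]
    ring

/-- The function `u` (an element of `L^p(Ω)`) underlying an element of `W^{1,p}(Ω)`. -/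
def sobolevFun {p : ℝ≥0∞} [Fact (1 ≤ p)] {Ω : Set Plane} (w : SobolevSpace p Ω) :
    Lp ℝ p (volume.restrict Ω) :=
  (w : WithLp p (Lp ℝ p (volume.restrict Ω) × Lp Plane p (volume.restrict Ω))).fst

end

/-!
The inclusion `W^{1,2}(Ω) ⊆ W^{1,p}(Ω)` is Hölder's inequality on a set of finite measure. The
density is reduced to a statement about fields, which is proved by duality.

*Reduction to fields.* A field is a weak gradient exactly when it is orthogonal to the divergence
free test fields (`IsWeakGradient.orthSolenoidal`, `exists_potential`), and the potential is
controlled in `L¹` on compact sets by the `L¹` norm of the field. Hence, if the gradient of `u ∈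
W^{1,p}(Ω)` is the `L^p` limit of square integrable fields orthogonal to the divergence free test
fields, then `u` is the limit almost everywhere of functions `U n` whose gradients are square
integrable and converge in `L^p`. The `U n` need not be integrable up to the boundary of `Ω`; for
this reason `u` is first replaced by a bounded truncation `f ∘ u`, and the `f ∘ U n ∈ W^{1,2}(Ω)`
approximate it, by the chain rule (`mem_closure_of_truncation`).

*Duality.* Suppose that `∇u` is not such a limit (`OrthSolenoidal.exists_tendsto`). The
Hahn-Banach theorem gives a functional on `L^p` that does not vanish at `∇u`, but vanishes on the
square integrable fields orthogonal to the divergence free test fields. It is represented by a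
field `Φ ∈ L^q`, where `1/p + 1/q = 1`, and `Φ` is a limit of divergence free test fields `Ψ n` in
`L²` (`exists_representation`). It remains to show that `Φ` is orthogonal to `∇u`
(`OrthSolenoidal.integral_eq_zero_of_tendsto`), which would be obvious if the `Ψ n` converged in
`L^q`.

*Where admissibility enters.* The rotated fields `Ψ n` are gradients of test functions on the
plane that are locally constant off `Ω` (`exists_stream_function`). These converge to a function
whose gradient is the rotated `Φ`, and as `q > 2`, that function has a continuous representative
`V` (`exists_continuous_rep`), by Morrey's inequality (if `p = 1`, it is Lipschitz). Convergence
everywhere on almost all the lines parallel to the axes shows that `V` is constant on each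
component of the complement of `Ω` (`continuous_rep_eq_of_isPreconnected`), so that `V` maps the
complement of `Ω` onto the image of the set of the selected points. Morrey's inequality and a
Besicovitch covering also show that `V` maps sets of zero `(2 - p)`-dimensional Hausdorff measure
to null sets (`volume_image_eq_zero_of_morrey`), so the values of `V` off `Ω` form a null set.
Composing `V` with primitives of cut-off functions that vanish near this null set
(`exists_cutoff`) exhibits `∇V` as a limit of gradients with compact support in `Ω`. Mollified and
rotated, these are divergence free test fields, so `Φ` is orthogonal to `∇u`
(`OrthSolenoidal.integral_eq_zero_of_null`).
-/

open MeasureTheory Set Filter Topology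
open scoped ENNReal ContDiff NNReal Pointwise

noncomputable section

/-! ### Test functions and integrals along lines -/

/-- The partial derivative `∂_i φ` of a function on the plane. -/
def pd (i : Fin 2) (φ : Plane → ℝ) (x : Plane) : ℝ :=
  fderiv ℝ φ x (EuclideanSpace.single i 1)

/-- `φ` is a test function on `Ω`: smooth, with compact support contained in `Ω`. -/
structure IsTestOn (Ω : Set Plane) (φ : Plane → ℝ) : Prop where
  smooth : ContDiff ℝ ∞ φ
  compact : HasCompactSupport φ
  subset : tsupport φ ⊆ Ω

namespace IsTestOn

variable {Ω Ω' : Set Plane} {φ ψ : Plane → ℝ}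

theorem continuous (h : IsTestOn Ω φ) : Continuous φ := h.smooth.continuous

theorem differentiable (h : IsTestOn Ω φ) : Differentiable ℝ φ :=
  h.smooth.differentiable (by simp)

theorem mono (h : IsTestOn Ω φ) (hs : Ω ⊆ Ω') : IsTestOn Ω' φ :=
  ⟨h.smooth, h.compact, h.subset.trans hs⟩

theorem pd (h : IsTestOn Ω φ) (i : Fin 2) : IsTestOn Ω (pd i φ) :=
  ⟨(h.smooth.fderiv_right (m := ∞) (by simp)).clm_apply contDiff_const,
    h.compact.fderiv_apply (𝕜 := ℝ) _,
    (tsupport_fderiv_apply_subset ℝ _).trans h.subset⟩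

theorem zero : IsTestOn Ω (fun _ => 0) :=
  ⟨contDiff_const, HasCompactSupport.zero, by simp [tsupport, Function.support]⟩

theorem mul_left (h : IsTestOn Ω φ) (hψ : ContDiff ℝ ∞ ψ) : IsTestOn Ω (fun x => ψ x * φ x) :=
  ⟨hψ.mul h.smooth, h.compact.mul_left, (tsupport_mul_subset_right).trans h.subset⟩

theorem const_mul (h : IsTestOn Ω φ) (c : ℝ) : IsTestOn Ω (fun x => c * φ x) :=
  h.mul_left contDiff_const

theorem neg (h : IsTestOn Ω φ) : IsTestOn Ω (fun x => -φ x) := by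
  simpa using h.const_mul (-1)

theorem add (h : IsTestOn Ω φ) (h' : IsTestOn Ω ψ) : IsTestOn Ω (fun x => φ x + ψ x) :=
  ⟨h.smooth.add h'.smooth, h.compact.add h'.compact,
    (tsupport_add φ ψ).trans (union_subset h.subset h'.subset)⟩

theorem sub (h : IsTestOn Ω φ) (h' : IsTestOn Ω ψ) : IsTestOn Ω (fun x => φ x - ψ x) := by
  simpa [sub_eq_add_neg] using h.add h'.neg

theorem eq_zero (h : IsTestOn Ω φ) {x : Plane} (hx : x ∉ Ω) : φ x = 0 :=
  image_eq_zero_of_notMem_tsupport fun hx' => hx (h.subset hx')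

theorem integrable (h : IsTestOn Ω φ) (μ : Measure Plane) [IsFiniteMeasureOnCompacts μ] :
    Integrable φ μ := h.continuous.integrable_of_hasCompactSupport h.compact

theorem exists_bound (h : IsTestOn Ω φ) : ∃ C, ∀ x, |φ x| ≤ C :=
  h.compact.exists_bound_of_continuous h.continuous

/-- A smooth function that vanishes off a compact subset of `Ω` is a test function on `Ω`. -/
theorem of_compact {K : Set Plane} (hφ : ContDiff ℝ ∞ φ) (hK : IsCompact K) (hKΩ : K ⊆ Ω)
    (h0 : ∀ x, x ∉ K → φ x = 0) : IsTestOn Ω φ :=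
  ⟨hφ, HasCompactSupport.intro hK h0,
    (closure_minimal (fun x hx => by by_contra hxK; exact hx (h0 x hxK)) hK.isClosed).trans hKΩ⟩

end IsTestOn

theorem pd_add {φ ψ : Plane → ℝ} (hφ : Differentiable ℝ φ) (hψ : Differentiable ℝ ψ) (i : Fin 2)
    (x : Plane) : pd i (fun x => φ x + ψ x) x = pd i φ x + pd i ψ x := by
  simp only [pd]
  rw [fderiv_fun_add (hφ x) (hψ x)]; rfl

theorem pd_sub {φ ψ : Plane → ℝ} (hφ : Differentiable ℝ φ) (hψ : Differentiable ℝ ψ) (i : Fin 2)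
    (x : Plane) : pd i (fun x => φ x - ψ x) x = pd i φ x - pd i ψ x := by
  simp only [pd]
  rw [fderiv_fun_sub (hφ x) (hψ x)]; rfl

theorem pd_const_mul {φ : Plane → ℝ} (hφ : Differentiable ℝ φ) (c : ℝ) (i : Fin 2)
    (x : Plane) : pd i (fun x => c * φ x) x = c * pd i φ x := by
  simp only [pd]
  rw [fderiv_const_mul (hφ x)]; rfl

theorem pd_neg (φ : Plane → ℝ) (i : Fin 2)
    (x : Plane) : pd i (fun x => -φ x) x = -pd i φ x := by
  simp only [pd]
  rw [fderiv_fun_neg]; rfl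

theorem pd_comm {φ : Plane → ℝ} (hφ : ContDiff ℝ ∞ φ) (i j : Fin 2) (x : Plane) :
    pd i (pd j φ) x = pd j (pd i φ) x := by
  have h2 : IsSymmSndFDerivAt ℝ φ x := (hφ.contDiffAt).isSymmSndFDerivAt (by
    rw [minSmoothness_of_isRCLikeNormedField]; exact WithTop.coe_le_coe.2 (le_top : (2 : ℕ∞) ≤ ⊤))
  have hd : DifferentiableAt ℝ (fderiv ℝ φ) x :=
    ((hφ.fderiv_right (m := ∞) (by simp)).differentiable (by simp)) x
  have key : ∀ i j : Fin 2, pd i (pd j φ) x =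
      fderiv ℝ (fderiv ℝ φ) x (EuclideanSpace.single i 1) (EuclideanSpace.single j 1) := by
    intro i j
    have : pd j φ = fun y => fderiv ℝ φ y (EuclideanSpace.single j 1) := rfl
    rw [this, pd, fderiv_clm_apply hd (differentiableAt_const _)]
    simp
  rw [key, key]
  exact h2 _ _

/-- The convolution `x ↦ ∫ f(t) ψ(x - t) dμ(t)` of the density `f` with `ψ`. The measure need not be
translation invariant, so that integrals along lines are covered. -/
def conv (μ : Measure Plane) (f ψ : Plane → ℝ) (x : Plane) : ℝ := ∫ t, f t * ψ (x - t) ∂μ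

section conv

variable {μ : Measure Plane} {f ψ : Plane → ℝ}

theorem contDiff_conv (hf : LocallyIntegrable f μ) (hψ : ContDiff ℝ ∞ ψ)
    (hc : HasCompactSupport ψ) : ContDiff ℝ ∞ (conv μ f ψ) :=
  hc.contDiff_convolution_right (n := ⊤) (ContinuousLinearMap.mul ℝ ℝ) hf hψ

theorem integrable_conv_integrand (hf : LocallyIntegrable f μ) (hψ : Continuous ψ)
    (hc : HasCompactSupport ψ) (x : Plane) : Integrable (fun t => f t * ψ (x - t)) μ := by
  refine integrable_mul_of_locallyIntegrable hf (by fun_prop) ?_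
  exact hc.comp_homeomorph (Homeomorph.subLeft x)

/-- The derivative of a convolution falls on the smooth factor. -/
theorem pd_conv (hf : LocallyIntegrable f μ) (hψ : ContDiff ℝ ∞ ψ)
    (hc : HasCompactSupport ψ) (i : Fin 2) (x : Plane) :
    pd i (conv μ f ψ) x = conv μ f (pd i ψ) x := by
  have hcf : Continuous (fderiv ℝ ψ) := hψ.continuous_fderiv (by simp)
  obtain ⟨C, hC⟩ := (hc.fderiv (𝕜 := ℝ)).exists_bound_of_continuous hcf
  let K' : Set Plane := -tsupport (fderiv ℝ ψ) + Metric.closedBall x 1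
  have hK' : IsCompact K' := (hc.fderiv ℝ).isCompact.neg.add (isCompact_closedBall x 1)
  have hC0 : 0 ≤ C := (norm_nonneg _).trans (hC 0)
  have hd : HasFDerivAt (conv μ f ψ) (∫ t, f t • fderiv ℝ ψ (x - t) ∂μ) x := by
    refine hasFDerivAt_integral_of_dominated_of_fderiv_le
      (F := fun x t => f t * ψ (x - t)) (F' := fun x t => f t • fderiv ℝ ψ (x - t))
      (bound := K'.indicator fun t => ‖f t‖ * C)
      (Metric.ball_mem_nhds x one_pos) ?_ (integrable_conv_integrand hf hψ.continuous hc x)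
      ?_ ?_ ?_ ?_
    · exact Eventually.of_forall fun y => (integrable_conv_integrand hf hψ.continuous hc y).1
    · exact hf.aestronglyMeasurable.smul (by fun_prop)
    · refine Eventually.of_forall fun t y hy => ?_
      by_cases ht : t ∈ K'
      · rw [indicator_of_mem ht, norm_smul]
        exact mul_le_mul_of_nonneg_left (hC _) (norm_nonneg _)
      · rw [indicator_of_notMem ht]
        have : fderiv ℝ ψ (y - t) = 0 := by
          refine image_eq_zero_of_notMem_tsupport fun h => ht ?_
          refine ⟨-(y - t), by simpa using h, y, Metric.ball_subset_closedBall hy, by simp⟩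
        simp [this]
    · rw [integrable_indicator_iff hK'.measurableSet]
      exact (hf.integrableOn_isCompact hK').norm.mul_const _
    · refine Eventually.of_forall fun t y _ => ?_
      have h1 : HasFDerivAt (fun y => ψ (y - t)) (fderiv ℝ ψ (y - t)) y := by
        have := (hψ.differentiable (by simp) (y - t)).hasFDerivAt.comp y
          ((hasFDerivAt_id y).sub_const t)
        simpa using! this
      exact h1.const_mul (f t)
  have hint : Integrable (fun t => f t • fderiv ℝ ψ (x - t)) μ := by
    have := hf.integrable_smul_right_of_hasCompactSupport (g := fun t => fderiv ℝ ψ (x - t))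
      (by fun_prop) ((hc.fderiv ℝ).comp_homeomorph (Homeomorph.subLeft x))
    exact this
  rw [pd, hd.fderiv, ContinuousLinearMap.integral_apply hint]
  rfl

end conv

/-- The integral of `ψ` over the points `x - s e_i`, `s ∈ J`, of the line through `x` in the
direction of the `i`-th axis. -/
def lineInt (J : Set ℝ) (i : Fin 2) (ψ : Plane → ℝ) (x : Plane) : ℝ :=
  ∫ s in J, ψ (x - s • EuclideanSpace.single i 1)

/-- The length measure on the piece `J` of the `i`-th axis. -/
def lineMeasure (J : Set ℝ) (i : Fin 2) : Measure Plane :=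
  (volume.restrict J).map fun s : ℝ => s • (EuclideanSpace.single i 1 : Plane)

theorem continuous_smul_single (i : Fin 2) :
    Continuous fun s : ℝ => s • (EuclideanSpace.single i 1 : Plane) := by fun_prop

instance (J : Set ℝ) (i : Fin 2) : IsLocallyFiniteMeasure (lineMeasure J i) := by
  refine ⟨fun x => ⟨Metric.ball x 1, Metric.ball_mem_nhds x one_pos, ?_⟩⟩
  rw [lineMeasure, Measure.map_apply (continuous_smul_single i).measurable measurableSet_ball]
  refine lt_of_le_of_lt (measure_mono (t := Icc (x i - 1) (x i + 1)) ?_)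
    ((Measure.restrict_apply_le _ _).trans_lt (by simp))
  intro s hs
  have h1 : ‖(s • (EuclideanSpace.single i 1 : Plane) - x) i‖ < 1 :=
    (PiLp.norm_apply_le _ i).trans_lt (by simpa [dist_eq_norm] using hs)
  simp [abs_lt] at h1
  exact ⟨by linarith, by linarith⟩

theorem lineInt_eq_conv (J : Set ℝ) (i : Fin 2) {ψ : Plane → ℝ} (hψ : Continuous ψ) :
    lineInt J i ψ = conv (lineMeasure J i) (fun _ => 1) ψ := by
  ext x
  rw [conv, lineMeasure, integral_map (continuous_smul_single i).aemeasurable]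
  · simp [lineInt]
  · exact Continuous.aestronglyMeasurable (by fun_prop)

section lineInt

variable {Ω : Set Plane} {ψ : Plane → ℝ}

theorem contDiff_lineInt (hψ : IsTestOn Ω ψ) (J : Set ℝ) (i : Fin 2) :
    ContDiff ℝ ∞ (lineInt J i ψ) := by
  rw [lineInt_eq_conv J i hψ.continuous]
  exact contDiff_conv (locallyIntegrable_const _) hψ.smooth hψ.compact

theorem pd_lineInt (hψ : IsTestOn Ω ψ) (J : Set ℝ) (i j : Fin 2) (x : Plane) :
    pd j (lineInt J i ψ) x = lineInt J i (pd j ψ) x := by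
  rw [lineInt_eq_conv J i hψ.continuous, lineInt_eq_conv J i (hψ.pd j).continuous]
  exact pd_conv (locallyIntegrable_const _) hψ.smooth hψ.compact j x

/-- The restriction of a test function to a line has compact support. -/
theorem hasCompactSupport_line (hψ : IsTestOn Ω ψ) (i : Fin 2) (x : Plane) :
    HasCompactSupport fun s : ℝ => ψ (x - s • EuclideanSpace.single i 1) := by
  have h := hψ.compact.isCompact.isBounded
  obtain ⟨R, hR⟩ := h.subset_closedBall 0
  refine HasCompactSupport.intro (isCompact_Icc (a := x i - R) (b := x i + R)) fun s hs => ?_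
  refine image_eq_zero_of_notMem_tsupport fun hx => hs ?_
  have h1 : ‖(x - s • (EuclideanSpace.single i 1 : Plane)) i‖ ≤ R :=
    (PiLp.norm_apply_le _ i).trans (by simpa using hR hx)
  simp [abs_le] at h1
  exact ⟨by linarith, by linarith⟩

theorem integrable_line (hψ : IsTestOn Ω ψ) (i : Fin 2) (x : Plane) :
    Integrable fun s : ℝ => ψ (x - s • EuclideanSpace.single i 1) :=
  Continuous.integrable_of_hasCompactSupport (by have := hψ.continuous; fun_prop)
    (hasCompactSupport_line hψ i x)

theorem hasDerivAt_line (hψ : IsTestOn Ω ψ) (i : Fin 2) (x : Plane) (s : ℝ) :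
    HasDerivAt (fun s : ℝ => -ψ (x - s • EuclideanSpace.single i 1))
      (pd i ψ (x - s • EuclideanSpace.single i 1)) s := by
  have h1 : HasDerivAt (fun s : ℝ => x - s • (EuclideanSpace.single i 1 : Plane))
      (-(EuclideanSpace.single i 1 : Plane)) s := by
    simpa using ((hasDerivAt_id s).smul_const (EuclideanSpace.single i 1 : Plane)).const_sub x
  have h2 := ((hψ.differentiable _).hasFDerivAt.comp_hasDerivAt s h1).neg
  simpa [pd] using! h2

/-- The minus sign makes this a statement about the function of `hasDerivAt_line`. -/
theorem tendsto_line_cocompact (hψ : IsTestOn Ω ψ) (i : Fin 2) (x : Plane) :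
    Tendsto (fun s : ℝ => -ψ (x - s • EuclideanSpace.single i 1)) (cocompact ℝ) (𝓝 0) := by
  simpa using ((hasCompactSupport_line hψ i x).is_zero_at_infty).neg

theorem lineInt_Ioi_pd (hψ : IsTestOn Ω ψ) (i : Fin 2) (x : Plane) :
    lineInt (Ioi 0) i (pd i ψ) x = ψ x := by
  have := integral_Ioi_of_hasDerivAt_of_tendsto' (a := 0) (m := 0)
    (f := fun s : ℝ => -ψ (x - s • EuclideanSpace.single i 1))
    (fun s _ => hasDerivAt_line hψ i x s) (integrable_line (hψ.pd i) i x).integrableOn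
    ((tendsto_line_cocompact hψ i x).mono_left atTop_le_cocompact)
  simpa [lineInt] using this

theorem lineInt_univ_pd (hψ : IsTestOn Ω ψ) (i : Fin 2) (x : Plane) :
    lineInt univ i (pd i ψ) x = 0 := by
  have := integral_of_hasDerivAt_of_tendsto (m := 0) (n := 0)
    (f := fun s : ℝ => -ψ (x - s • EuclideanSpace.single i 1))
    (fun s => hasDerivAt_line hψ i x s) (integrable_line (hψ.pd i) i x)
    ((tendsto_line_cocompact hψ i x).mono_left atBot_le_cocompact)
    ((tendsto_line_cocompact hψ i x).mono_left atTop_le_cocompact)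
  simpa [lineInt] using this

theorem pd_lineInt_Ioi (hψ : IsTestOn Ω ψ) (i : Fin 2) (x : Plane) :
    pd i (lineInt (Ioi 0) i ψ) x = ψ x := by
  rw [pd_lineInt hψ, lineInt_Ioi_pd hψ]

end lineInt

section translates

variable {ν : Measure Plane} [IsFiniteMeasure ν] {g ψ : Plane → ℝ}

theorem measurePreserving_shear (ν : Measure Plane) [IsFiniteMeasure ν] :
    MeasurePreserving (fun p : Plane × Plane => (p.1, p.2 + p.1)) (ν.prod volume)
      (ν.prod volume) :=
  (MeasurePreserving.id ν).skew_product (g := fun t x => x + t) (by fun_prop)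
    (Eventually.of_forall fun t => map_add_right_eq_self volume t)

theorem integrable_translate_prod (hg : Integrable g) :
    Integrable (fun p : Plane × Plane => g (p.2 + p.1)) (ν.prod volume) :=
  (measurePreserving_shear ν).integrable_comp_of_integrable (g := fun p : Plane × Plane => g p.2)
    (hg.comp_snd ν)

theorem integrable_integral_translate (hg : Integrable g) :
    Integrable fun x => ∫ t, g (x + t) ∂ν :=
  (integrable_translate_prod hg).integral_prod_right

theorem integral_abs_integral_translate_le (hg : Integrable g) :
    ∫ x, |∫ t, g (x + t) ∂ν| ≤ ν.real univ * ∫ x, |g x| := by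
  have h1 := integrable_translate_prod (ν := ν) hg.abs
  calc ∫ x, |∫ t, g (x + t) ∂ν| ≤ ∫ x, ∫ t, |g (x + t)| ∂ν :=
        integral_mono (integrable_integral_translate hg).abs h1.integral_prod_right
          fun x => abs_integral_le_integral_abs
    _ = ∫ t, (∫ x, |g (x + t)|) ∂ν := (integral_integral_swap h1).symm
    _ = ∫ t, (∫ x, |g x|) ∂ν := by
        congr 1; ext t; exact integral_add_right_eq_self (fun x => |g x|) t
    _ = ν.real univ * ∫ x, |g x| := by simp

/-- Averaging over translates by `-t` is adjoint to averaging over translates by `t`. -/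
theorem integral_mul_translate (hg : Integrable g) (hψ : Continuous ψ) {C : ℝ}
    (hC : ∀ x, |ψ x| ≤ C) :
    ∫ x, g x * ∫ t, ψ (x - t) ∂ν = ∫ x, (∫ t, g (x + t) ∂ν) * ψ x := by
  have h1 : Integrable (fun p : Plane × Plane => g (p.2 + p.1) * ψ p.2) (ν.prod volume) :=
    (integrable_translate_prod hg).mul_bdd (c := C) (by fun_prop)
      (Eventually.of_forall fun p => hC _)
  have h2 : Integrable (fun p : Plane × Plane => g p.2 * ψ (p.2 - p.1)) (ν.prod volume) :=
    (hg.comp_snd ν).mul_bdd (c := C) (by fun_prop) (Eventually.of_forall fun p => hC _)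
  calc ∫ x, g x * ∫ t, ψ (x - t) ∂ν = ∫ x, ∫ t, g x * ψ (x - t) ∂ν := by
        congr 1; ext x; rw [integral_const_mul]
    _ = ∫ t, (∫ x, g x * ψ (x - t)) ∂ν := (integral_integral_swap h2).symm
    _ = ∫ t, (∫ x, g (x + t) * ψ x) ∂ν := by
        congr 1; ext t
        rw [← integral_add_right_eq_self (fun x => g x * ψ (x - t)) t]
        simp
    _ = ∫ x, ∫ t, g (x + t) * ψ x ∂ν := integral_integral_swap h1
    _ = _ := by congr 1; ext x; rw [integral_mul_const]

end translates

/-! ### Squares and supports -/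

/-- The open square with center `c` and half side `r`. -/
def box (c : Plane) (r : ℝ) : Set Plane := {x | ∀ i, |x i - c i| < r}

/-- The closed square with center `c` and half side `r`. -/
def closedBox (c : Plane) (r : ℝ) : Set Plane := {x | ∀ i, |x i - c i| ≤ r}

theorem isOpen_box (c : Plane) (r : ℝ) : IsOpen (box c r) := by
  simp only [box, ofPred_forall]
  exact isOpen_iInter_of_finite fun i => isOpen_lt (by fun_prop) continuous_const

theorem isClosed_closedBox (c : Plane) (r : ℝ) : IsClosed (closedBox c r) := by
  simp only [closedBox, ofPred_forall]
  exact isClosed_iInter fun i => isClosed_le (by fun_prop) continuous_const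

theorem closedBox_subset_closedBall (c : Plane) (r : ℝ) :
    closedBox c r ⊆ Metric.closedBall c (r + r) := by
  intro x hx
  have h0 := hx 0
  have h1 := hx 1
  have hr : 0 ≤ r := (abs_nonneg _).trans h0
  rw [mem_closedBall_iff_norm, EuclideanSpace.norm_eq]
  refine Real.sqrt_le_iff.2 ⟨by positivity, ?_⟩
  simp only [Fin.sum_univ_two, PiLp.sub_apply, Real.norm_eq_abs]
  nlinarith [abs_nonneg (x 0 - c 0), abs_nonneg (x 1 - c 1)]

theorem isCompact_closedBox (c : Plane) (r : ℝ) : IsCompact (closedBox c r) :=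
  (isCompact_closedBall c (r + r)).of_isClosed_subset (isClosed_closedBox c r)
    (closedBox_subset_closedBall c r)

theorem closedBox_subset_box {c : Plane} {r r' : ℝ} (h : r' < r) : closedBox c r' ⊆ box c r :=
  fun _ hx i => (hx i).trans_lt h

theorem box_subset_closedBox {c : Plane} {r : ℝ} : box c r ⊆ closedBox c r :=
  fun _ hx i => (hx i).le

theorem mem_box_self (c : Plane) {r : ℝ} (hr : 0 < r) : c ∈ box c r := fun i => by simpa

theorem volume_box_lt_top (c : Plane) (r : ℝ) : volume (box c r) < ⊤ :=
  (measure_mono box_subset_closedBox).trans_lt (isCompact_closedBox c r).measure_lt_top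

theorem exists_box_subset {Ω : Set Plane} (hΩ : IsOpen Ω) {x : Plane} (hx : x ∈ Ω) :
    ∃ r > 0, box x r ⊆ Ω := by
  obtain ⟨ε, hε, h⟩ := Metric.isOpen_iff.1 hΩ x hx
  refine ⟨ε / 4, by positivity, ?_⟩
  refine (box_subset_closedBox.trans (closedBox_subset_closedBall _ _)).trans
    ((Metric.closedBall_subset_ball (by linarith)).trans h)

theorem IsCompact.exists_closedBox {c : Plane} {r : ℝ} {K : Set Plane} (hK : IsCompact K)
    (hKr : K ⊆ box c r) : ∃ r' < r, K ⊆ closedBox c r' := by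
  rcases K.eq_empty_or_nonempty with rfl | hne
  · exact ⟨r - 1, by linarith, empty_subset _⟩
  obtain ⟨x, hx, hmax⟩ := hK.exists_isMaxOn hne
    (f := fun x : Plane => max |x 0 - c 0| |x 1 - c 1|) (by fun_prop)
  refine ⟨max |x 0 - c 0| |x 1 - c 1|, max_lt (hKr hx 0) (hKr hx 1), fun y hy i => ?_⟩
  have h := isMaxOn_iff.1 hmax y hy
  fin_cases i
  · exact (le_max_left _ _).trans h
  · exact (le_max_right _ _).trans h

@[simp] theorem sub_smul_single_apply_self (x : Plane) (s : ℝ) (i : Fin 2) :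
    (x - s • (EuclideanSpace.single i 1 : Plane)) i = x i - s := by simp

theorem sub_smul_single_apply_of_ne (x : Plane) (s : ℝ) {i j : Fin 2} (h : j ≠ i) :
    (x - s • (EuclideanSpace.single i 1 : Plane)) j = x j := by
  simp [h]

section support

variable {ψ : Plane → ℝ} {c : Plane} {r : ℝ}

theorem lineInt_Ioi_eq (h0 : ∀ x, x ∉ closedBox c r → ψ x = 0) (i : Fin 2) {x : Plane}
    (hx : x i ≤ c i + r) :
    lineInt (Ioi 0) i ψ x = lineInt (Ioc 0 (2 * r)) i ψ x := by
  refine setIntegral_eq_of_subset_of_forall_sdiff_eq_zero measurableSet_Ioi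
    Ioc_subset_Ioi_self fun s hs => h0 _ fun hm => hs.2 ⟨hs.1, ?_⟩
  have := (abs_le.1 (hm i)).1
  rw [sub_smul_single_apply_self] at this
  linarith

theorem lineInt_univ_eq (h0 : ∀ x, x ∉ closedBox c r → ψ x = 0) (i : Fin 2) {x : Plane}
    (hx : |x i - c i| ≤ r) :
    lineInt univ i ψ x = lineInt (Icc (-(2 * r)) (2 * r)) i ψ x := by
  refine setIntegral_eq_of_subset_of_forall_sdiff_eq_zero MeasurableSet.univ
    (subset_univ _) fun s hs => h0 _ fun hm => hs.2 ?_
  have := abs_le.1 (hm i)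
  rw [sub_smul_single_apply_self] at this
  have := abs_le.1 hx
  exact ⟨by linarith, by linarith⟩

theorem lineInt_eq_zero_of_ne (h0 : ∀ x, x ∉ closedBox c r → ψ x = 0) (J : Set ℝ) {i j : Fin 2}
    (hij : j ≠ i) {x : Plane} (hx : r < |x j - c j|) : lineInt J i ψ x = 0 := by
  refine integral_eq_zero_of_ae (Eventually.of_forall fun s => h0 _ fun hm => ?_)
  have := hm j
  rw [sub_smul_single_apply_of_ne x s hij] at this
  linarith

theorem lineInt_Ioi_eq_zero (h0 : ∀ x, x ∉ closedBox c r → ψ x = 0) (i : Fin 2) {x : Plane}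
    (hx : x i < c i - r) : lineInt (Ioi 0) i ψ x = 0 := by
  refine setIntegral_eq_zero_of_forall_eq_zero fun s hs => h0 _ fun hm => ?_
  have := (abs_le.1 (hm i)).1
  rw [sub_smul_single_apply_self] at this
  have := mem_Ioi.1 hs
  linarith

theorem lineInt_Ioi_eq_univ (h0 : ∀ x, x ∉ closedBox c r → ψ x = 0) (i : Fin 2) {x : Plane}
    (hx : c i + r < x i) : lineInt (Ioi 0) i ψ x = lineInt univ i ψ x := by
  refine (setIntegral_eq_of_subset_of_forall_sdiff_eq_zero MeasurableSet.univ
    (subset_univ _) fun s hs => h0 _ fun hm => hs.2 ?_).symm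
  have := (abs_le.1 (hm i)).2
  rw [sub_smul_single_apply_self] at this
  exact mem_Ioi.2 (by linarith)

theorem lineInt_univ_add (i : Fin 2) (x : Plane) (t : ℝ) :
    lineInt univ i ψ (x - t • EuclideanSpace.single i 1) = lineInt univ i ψ x := by
  simp only [lineInt, Measure.restrict_univ]
  rw [← integral_add_left_eq_self
    (fun s : ℝ => ψ (x - s • (EuclideanSpace.single i 1 : Plane))) t]
  congr 1; ext s
  rw [add_smul, sub_sub]

theorem fin_two_ne_cases (i : Fin 2) : ∃ j : Fin 2, j ≠ i ∧ ∀ k, k = i ∨ k = j := by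
  fin_cases i
  · exact ⟨1, by decide, by decide⟩
  · exact ⟨0, by decide, by decide⟩

/-- A function supported in a square whose integrals over the lines in the direction of the `i`-th
axis vanish has a primitive in that direction that is supported in the same square. -/
theorem lineInt_Ioi_eq_zero_of_notMem (h0 : ∀ x, x ∉ closedBox c r → ψ x = 0) (i : Fin 2)
    (hl : ∀ x, lineInt univ i ψ x = 0) {x : Plane} (hx : x ∉ closedBox c r) :
    lineInt (Ioi 0) i ψ x = 0 := by
  obtain ⟨j, hji, hij⟩ := fin_two_ne_cases i
  by_cases hj : r < |x j - c j|
  · exact lineInt_eq_zero_of_ne h0 _ hji hj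
  have hi : r < |x i - c i| := by
    by_contra hi
    refine hx fun k => ?_
    rcases hij k with rfl | rfl
    · exact not_lt.1 hi
    · exact not_lt.1 hj
  rcases lt_abs.1 hi with h | h
  · rw [lineInt_Ioi_eq_univ h0 i (by linarith), hl]
  · exact lineInt_Ioi_eq_zero h0 i (by linarith)

end support

/-- Integration along the horizontal and then along the vertical lines is integration over the
plane. -/
theorem lineInt_fubini {ψ : Plane → ℝ} {Ω : Set Plane} (hψ : IsTestOn Ω ψ) (x : Plane) :
    lineInt univ 1 (lineInt univ 0 ψ) x = ∫ y, ψ y := by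
  have e1 : ∫ y, ψ y = ∫ z : ℝ × ℝ, ψ (!₂[z.1, z.2]) := by
    rw [← (PiLp.volume_preserving_toLp (Fin 2)).integral_comp
      (MeasurableEquiv.toLp 2 (Fin 2 → ℝ)).measurableEmbedding,
      ← (volume_preserving_finTwoArrow ℝ).symm.integral_comp
      (MeasurableEquiv.finTwoArrow (α := ℝ)).symm.measurableEmbedding]
    rfl
  have hc : HasCompactSupport fun z : ℝ × ℝ => ψ (!₂[z.1, z.2]) := by
    let e : Plane ≃ₜ ℝ × ℝ := (EuclideanSpace.equiv (Fin 2) ℝ).toHomeomorph.trans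
      (Homeomorph.finTwoArrow)
    exact hψ.compact.comp_homeomorph e.symm
  have hcont : Continuous fun z : ℝ × ℝ => ψ (!₂[z.1, z.2]) := by
    refine hψ.continuous.comp ?_
    refine (PiLp.continuous_toLp 2 _).comp (continuous_pi fun i => ?_)
    fin_cases i
    · exact continuous_fst
    · exact continuous_snd
  have hint := hcont.integrable_of_hasCompactSupport (μ := volume) hc
  rw [e1, Measure.volume_eq_prod, integral_prod_symm _ hint]
  simp only [lineInt, Measure.restrict_univ]
  rw [← integral_sub_left_eq_self _ volume (x 1)]
  congr 1; ext s
  rw [← integral_sub_left_eq_self _ volume (x 0)]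
  congr 1; ext t
  congr 1
  ext i
  fin_cases i <;> simp

/-- There is a bounded smooth function on the line, of integral one, that vanishes off
`[-r / 2, r / 2]`. -/
theorem exists_bump {r : ℝ} (hr : 0 < r) : ∃ b : ℝ → ℝ, ContDiff ℝ ∞ b ∧
    (∀ s, r / 2 < |s| → b s = 0) ∧ ∫ s, b s = 1 ∧ ∃ B, ∀ s, |b s| ≤ B := by
  let f : ContDiffBump (0 : ℝ) := ⟨r / 4, r / 2, by positivity, by linarith⟩
  refine ⟨f.normed volume, f.contDiff_normed, fun s hs => ?_, f.integral_normed, ?_⟩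
  · have : s ∉ Function.support (f.normed volume) := by
      rw [f.support_normed_eq]
      simpa using hs.le
    simpa using this
  · exact f.hasCompactSupport_normed.exists_bound_of_continuous f.continuous_normed

/-! ### Test functions on a square as divergences -/

/-- Integration along a piece of finite length of the lines in an axis direction has an adjoint
that is bounded on `L¹`. -/
theorem exists_adjoint_lineInt {J : Set ℝ} (hJ : volume J < ⊤) (i : Fin 2) {g : Plane → ℝ}
    (hg : Integrable g) : ∃ h : Plane → ℝ, Integrable h ∧
      ∫ x, |h x| ≤ volume.real J * ∫ x, |g x| ∧
      ∀ Ω ψ, IsTestOn Ω ψ → ∫ x, g x * lineInt J i ψ x = ∫ x, h x * ψ x := by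
  have hm : lineMeasure J i univ = volume J := by
    rw [lineMeasure, Measure.map_apply (continuous_smul_single i).measurable MeasurableSet.univ]
    simp
  have : IsFiniteMeasure (lineMeasure J i) := ⟨by rwa [hm]⟩
  refine ⟨_, integrable_integral_translate (ν := lineMeasure J i) hg, ?_, fun Ω ψ hψ => ?_⟩
  · refine (integral_abs_integral_translate_le hg).trans_eq ?_
    rw [measureReal_def, measureReal_def, hm]
  · obtain ⟨C, hC⟩ := hψ.exists_bound
    rw [← integral_mul_translate hg hψ.continuous hC, lineInt_eq_conv J i hψ.continuous]
    simp [conv]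

theorem lineInt_mul_of_const {χ ψ : Plane → ℝ} {J : Set ℝ} {i : Fin 2} {x : Plane}
    (h : ∀ s : ℝ, ψ (x - s • EuclideanSpace.single i 1) = ψ x) :
    lineInt J i (fun x => χ x * ψ x) x = lineInt J i χ x * ψ x := by
  simp only [lineInt, h]
  rw [integral_mul_const]

theorem lineInt_coord_eq_integral {b : ℝ → ℝ} {i : Fin 2} (c : Plane) (x : Plane) :
    lineInt univ i (fun x => b (x i - c i)) x = ∫ s, b s := by
  simp only [lineInt, sub_smul_single_apply_self, Measure.restrict_univ]
  rw [← integral_sub_left_eq_self b volume (x i - c i)]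
  congr 1; ext s; congr 1; ring

theorem contDiff_coord {b : ℝ → ℝ} (hb : ContDiff ℝ ∞ b) (i : Fin 2) (a : ℝ) :
    ContDiff ℝ ∞ fun x : Plane => b (x i - a) :=
  hb.comp (((EuclideanSpace.proj (𝕜 := ℝ) i).contDiff).sub contDiff_const)

/-- A test function `ψ` on a square is the divergence of a test field up to a multiple of a fixed
test function `η`. The field is built from `ψ` by integration along lines, so pairing it with an
integrable field `g` amounts to pairing `ψ` with a function `w` whose `L¹` norm is controlled by
that of `g`. -/
theorem exists_box_decomposition (c : Plane) {r : ℝ} (hr : 0 < r) :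
    ∃ (η : Plane → ℝ) (C : ℝ), IsTestOn (box c r) η ∧ 0 ≤ C ∧
      ∀ g₀ g₁ : Plane → ℝ, IntegrableOn g₀ (box c r) → IntegrableOn g₁ (box c r) →
      ∃ w : Plane → ℝ, IntegrableOn w (box c r) ∧
        ∫ x in box c r, |w x| ≤ C * (∫ x in box c r, |g₀ x|) + C * ∫ x in box c r, |g₁ x| ∧
        ∀ ψ, IsTestOn (box c r) ψ → ∃ Ψ₀ Ψ₁ : Plane → ℝ,
          IsTestOn (box c r) Ψ₀ ∧ IsTestOn (box c r) Ψ₁ ∧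
          (∀ x, ψ x = pd 0 Ψ₀ x + pd 1 Ψ₁ x + (∫ y, ψ y) * η x) ∧
          (∫ x in box c r, g₀ x * Ψ₀ x) + ∫ x in box c r, g₁ x * Ψ₁ x =
            ∫ x in box c r, w x * ψ x := by
  obtain ⟨b, hb, hb0, hb1, B, hB⟩ := exists_bump hr
  set Q := box c r with hQ
  have hQm : MeasurableSet Q := (isOpen_box c r).measurableSet
  have hB0 : 0 ≤ B := (abs_nonneg _).trans (hB 0)
  let χ : Fin 2 → Plane → ℝ := fun i x => b (x i - c i)
  have hχ : ∀ i, ContDiff ℝ ∞ (χ i) := fun i => contDiff_coord hb i (c i)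
  have hχB : ∀ i x, |χ i x| ≤ B := fun i x => hB _
  have hχ0 : ∀ i x, r / 2 < |x i - c i| → χ i x = 0 := fun i x h => hb0 _ h
  have hχc : ∀ {i j : Fin 2}, j ≠ i → ∀ (x : Plane) (s : ℝ),
      χ j (x - s • EuclideanSpace.single i 1) = χ j x := fun {i j} h x s => by
    simp only [χ, sub_smul_single_apply_of_ne x s h]
  have hη : IsTestOn Q fun x => χ 0 x * χ 1 x := by
    refine IsTestOn.of_compact ((hχ 0).mul (hχ 1)) (isCompact_closedBox c (r / 2))
      (closedBox_subset_box (by linarith)) fun x hx => ?_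
    simp only [closedBox, mem_ofPred_eq, not_forall, not_le] at hx
    obtain ⟨i, hi⟩ := hx
    fin_cases i
    · simp [hχ0 0 x hi]
    · simp [hχ0 1 x hi]
  -- On the square, lines may be replaced by segments of bounded length, so that the adjoints of the
  -- integrations along them are bounded on `L¹`.
  obtain ⟨J₁, hJ₁⟩ : ∃ J₁, J₁ = Ioc 0 (2 * r) := ⟨_, rfl⟩
  obtain ⟨J₂, hJ₂⟩ : ∃ J₂, J₂ = Icc (-(2 * r)) (2 * r) := ⟨_, rfl⟩
  have hv₁ : volume.real J₁ = 2 * r := by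
    rw [hJ₁, Real.volume_real_Ioc_of_le (by linarith)]; ring
  have hv₂ : volume.real J₂ = 4 * r := by
    rw [hJ₂, Real.volume_real_Icc_of_le (by linarith)]; ring
  have hf₁ : volume J₁ < ⊤ := by rw [hJ₁]; exact measure_Ioc_lt_top
  have hf₂ : volume J₂ < ⊤ := by rw [hJ₂]; exact measure_Icc_lt_top
  set V := volume.real Q
  have hV : 0 ≤ V := measureReal_nonneg
  refine ⟨fun x => χ 0 x * χ 1 x, 2 * r + 4 * r * (B * (2 * r)) + V * (B * B * (2 * r)),
    hη, by positivity, fun g₀ g₁ hg₀ hg₁ => ?_⟩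
  have hG₀ : Integrable (Q.indicator g₀) := (integrable_indicator_iff hQm).2 hg₀
  have hG₁ : Integrable (Q.indicator g₁) := (integrable_indicator_iff hQm).2 hg₁
  have hGn : ∀ g : Plane → ℝ, ∫ x, |Q.indicator g x| = ∫ x in Q, |g x| := fun g => by
    rw [← integral_indicator hQm]
    congr 1; ext x
    by_cases hx : x ∈ Q <;> simp [hx]
  obtain ⟨h₀, ih₀, bh₀, ah₀⟩ := exists_adjoint_lineInt hf₁ 0 hG₀
  obtain ⟨h₁, ih₁, bh₁, ah₁⟩ := exists_adjoint_lineInt hf₁ 1 hG₁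
  have hmul : ∀ h : Plane → ℝ, Integrable h → Integrable (fun x => h x * χ 0 x) ∧
      ∫ x, |h x * χ 0 x| ≤ B * ∫ x, |h x| := fun h ih => by
    have i1 : Integrable (fun x => h x * χ 0 x) :=
      ih.mul_bdd (c := B) (hχ 0).continuous.aestronglyMeasurable (Eventually.of_forall (hχB 0))
    refine ⟨i1, ?_⟩
    rw [← integral_const_mul]
    refine integral_mono i1.abs (ih.abs.const_mul _) fun x => ?_
    simp only [abs_mul]
    rw [mul_comm]
    exact mul_le_mul_of_nonneg_right (hχB 0 x) (abs_nonneg _)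
  obtain ⟨k₀, ik₀, bk₀, ak₀⟩ := exists_adjoint_lineInt hf₂ 0 (hmul h₀ ih₀).1
  obtain ⟨k₁, ik₁, bk₁, ak₁⟩ := exists_adjoint_lineInt hf₂ 0 (hmul h₁ ih₁).1
  rw [hv₁, hGn] at bh₀ bh₁
  rw [hv₂] at bk₀ bk₁
  have bk₀' := bk₀.trans (mul_le_mul_of_nonneg_left (hmul h₀ ih₀).2 (by positivity))
  have bk₁' := bk₁.trans (mul_le_mul_of_nonneg_left (hmul h₁ ih₁).2 (by positivity))
  set c₁ := ∫ x, h₁ x * (χ 0 x * χ 1 x) with hc₁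
  have bc₁ : |c₁| ≤ B * B * ∫ x, |h₁ x| := by
    refine abs_integral_le_integral_abs.trans ?_
    rw [← integral_const_mul]
    refine integral_mono_of_nonneg (Eventually.of_forall fun x => abs_nonneg _)
      (ih₁.abs.const_mul _) (Eventually.of_forall fun x => ?_)
    simp only [abs_mul]
    rw [mul_comm]
    exact mul_le_mul_of_nonneg_right (mul_le_mul (hχB 0 x) (hχB 1 x) (abs_nonneg _) hB0)
      (abs_nonneg _)
  set n₀ := ∫ x in Q, |g₀ x|
  set n₁ := ∫ x in Q, |g₁ x|
  have hn₀ : 0 ≤ n₀ := integral_nonneg fun x => abs_nonneg _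
  have hn₁ : 0 ≤ n₁ := integral_nonneg fun x => abs_nonneg _
  have icQ : IntegrableOn (fun _ : Plane => c₁) Q :=
    integrableOn_const (volume_box_lt_top c r).ne
  -- The terms come from `ψ`, from `χ₀ F` in `θ` and in `θ'`, and from the multiple of `χ₀ χ₁`,
  -- where `F`, `θ`, `θ'` are the functions introduced below for the test function `ψ`.
  refine ⟨fun x => h₀ x - k₀ x + k₁ x - c₁, ?_, ?_, fun ψ hψ => ?_⟩
  · exact (((ih₀.sub ik₀).add ik₁).integrableOn).sub icQ
  · have hle : ∀ f : Plane → ℝ, Integrable f → ∫ x in Q, |f x| ≤ ∫ x, |f x| := fun f hf =>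
      setIntegral_le_integral hf.abs (Eventually.of_forall fun x => abs_nonneg _)
    calc ∫ x in Q, |h₀ x - k₀ x + k₁ x - c₁|
        ≤ ∫ x in Q, (|h₀ x| + |k₀ x| + |k₁ x| + |c₁|) := by
          refine integral_mono_of_nonneg (Eventually.of_forall fun x => abs_nonneg _)
            ((((ih₀.abs.add ik₀.abs).add ik₁.abs).integrableOn).add icQ.abs)
            (Eventually.of_forall fun x => ?_)
          have e1 := abs_sub (h₀ x - k₀ x + k₁ x) c₁
          have e2 := abs_add_le (h₀ x - k₀ x) (k₁ x)
          have e3 := abs_sub (h₀ x) (k₀ x)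
          simp only
          linarith
      _ = (∫ x in Q, |h₀ x|) + (∫ x in Q, |k₀ x|) + (∫ x in Q, |k₁ x|) + V * |c₁| := by
          have i1 : IntegrableOn (fun x => |h₀ x| + |k₀ x|) Q := (ih₀.abs.add ik₀.abs).integrableOn
          have i2 : IntegrableOn (fun x => |h₀ x| + |k₀ x| + |k₁ x|) Q :=
            i1.add ik₁.abs.integrableOn
          rw [integral_add i2 icQ.abs, integral_add i1 ik₁.abs.integrableOn,
            integral_add ih₀.abs.integrableOn ik₀.abs.integrableOn]
          simp [V]
      _ ≤ 2 * r * n₀ + 4 * r * (B * (2 * r * n₀)) + 4 * r * (B * (2 * r * n₁)) +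
          V * (B * B * (2 * r * n₁)) := by
          have := hle h₀ ih₀
          have := hle k₀ ik₀
          have := hle k₁ ik₁
          have e1 : 4 * r * (B * ∫ x, |h₀ x|) ≤ 4 * r * (B * (2 * r * n₀)) := by gcongr
          have e2 : 4 * r * (B * ∫ x, |h₁ x|) ≤ 4 * r * (B * (2 * r * n₁)) := by gcongr
          have e3 : V * |c₁| ≤ V * (B * B * (2 * r * n₁)) :=
            mul_le_mul_of_nonneg_left (bc₁.trans (by gcongr)) hV
          linarith
      _ ≤ _ := by
          have e1 : 0 ≤ V * (B * B * (2 * r)) * n₀ := by positivity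
          have e2 : 0 ≤ 2 * r * n₁ := by positivity
          nlinarith
  · obtain ⟨r₀, hr₀, hK⟩ := IsCompact.exists_closedBox hψ.compact.isCompact hψ.subset
    obtain ⟨r', hr'⟩ : ∃ r', r' = max r₀ (r / 2) := ⟨_, rfl⟩
    have hr'r : r' < r := by rw [hr']; exact max_lt hr₀ (by linarith)
    have hr'2 : r / 2 ≤ r' := by rw [hr']; exact le_max_right _ _
    have h0ψ : ∀ x, x ∉ closedBox c r' → ψ x = 0 := fun x hx =>
      image_eq_zero_of_notMem_tsupport fun h => hx fun i =>
        (hK h i).trans (by rw [hr']; exact le_max_left _ _)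
    have h0ψr : ∀ x, x ∉ closedBox c r → ψ x = 0 := fun x hx =>
      hψ.eq_zero fun h => hx (box_subset_closedBox h)
    have hcomp : ∀ {f : Plane → ℝ}, ContDiff ℝ ∞ f → (∀ x, x ∉ closedBox c r' → f x = 0) →
        IsTestOn Q f := fun hf h0 =>
      IsTestOn.of_compact hf (isCompact_closedBox c r') (closedBox_subset_box hr'r) h0
    have h0r : ∀ {f : Plane → ℝ}, IsTestOn Q f → ∀ x, x ∉ closedBox c r → f x = 0 :=
      fun hf x hx => hf.eq_zero fun h => hx (box_subset_closedBox h)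
    set F := lineInt univ 0 ψ with hF
    have hFs : ContDiff ℝ ∞ F := contDiff_lineInt hψ univ 0
    have hFc : ∀ (x : Plane) (s : ℝ), F (x - s • EuclideanSpace.single 0 1) = F x :=
      fun x s => lineInt_univ_add 0 x s
    have hFn : ∀ x, χ 0 x * F x = χ 0 x * lineInt J₂ 0 ψ x := fun x => by
      by_cases hx : r / 2 < |x 0 - c 0|
      · simp [hχ0 0 x hx]
      · rw [hF, lineInt_univ_eq h0ψr 0 (by linarith [not_lt.1 hx]), hJ₂]
    have hχF0 : ∀ x, x ∉ closedBox c r' → χ 0 x * F x = 0 := fun x hx => by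
      simp only [closedBox, mem_ofPred_eq, not_forall, not_le] at hx
      obtain ⟨i, hi⟩ := hx
      fin_cases i
      · rw [hχ0 0 x (by simpa using hr'2.trans_lt hi), zero_mul]
      · rw [hF, lineInt_eq_zero_of_ne h0ψ univ (by decide : (1 : Fin 2) ≠ 0) (by simpa using hi),
          mul_zero]
    have hχF : IsTestOn Q fun x => χ 0 x * F x := hcomp ((hχ 0).mul hFs) hχF0
    -- `ψ = θ + θ' + m χ₀ χ₁`, where `θ` has zero integrals over the horizontal lines and `θ'` over
    -- the vertical lines, so that their primitives along these lines have compact support in the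
    -- square.
    set θ : Plane → ℝ := fun x => ψ x - χ 0 x * F x with hθ
    have hθt : IsTestOn Q θ := hψ.sub hχF
    have hθ0 : ∀ x, x ∉ closedBox c r' → θ x = 0 := fun x hx => by
      simp only [hθ]; rw [h0ψ x hx, hχF0 x hx, sub_zero]
    have hθl : ∀ x, lineInt univ 0 θ x = 0 := fun x => by
      have e : lineInt univ 0 θ x = F x - lineInt univ 0 (fun x => χ 0 x * F x) x := by
        simp only [lineInt, hF, hθ]
        exact integral_sub (integrable_line hψ 0 x).integrableOn
          (integrable_line hχF 0 x).integrableOn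
      rw [e, lineInt_mul_of_const (hFc x), lineInt_coord_eq_integral, hb1]
      ring
    set m := ∫ y, ψ y with hm
    set θ' : Plane → ℝ := fun x => χ 0 x * F x - m * (χ 0 x * χ 1 x) with hθ'
    have hθ't : IsTestOn Q θ' := hχF.sub (hη.const_mul m)
    have hθ'0 : ∀ x, x ∉ closedBox c r' → θ' x = 0 := fun x hx => by
      have : χ 0 x * χ 1 x = 0 := by
        simp only [closedBox, mem_ofPred_eq, not_forall, not_le] at hx
        obtain ⟨i, hi⟩ := hx
        fin_cases i
        · rw [hχ0 0 x (by simpa using hr'2.trans_lt hi), zero_mul]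
        · rw [hχ0 1 x (by simpa using hr'2.trans_lt hi), mul_zero]
      simp only [hθ']; rw [hχF0 x hx, this]; ring
    have hθ'l : ∀ x, lineInt univ 1 θ' x = 0 := fun x => by
      have hc0 : ∀ s : ℝ, χ 0 (x - s • EuclideanSpace.single 1 1) = χ 0 x :=
        hχc (by decide) x
      have e : lineInt univ 1 θ' x = lineInt univ 1 (fun x => χ 0 x * F x) x -
          m * lineInt univ 1 (fun x => χ 0 x * χ 1 x) x := by
        simp only [lineInt, hθ']
        rw [integral_sub (integrable_line hχF 1 x).integrableOn
          ((integrable_line hη 1 x).integrableOn.const_mul m), integral_const_mul]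
      have e1 : lineInt univ 1 (fun x => χ 0 x * F x) x = χ 0 x * m := by
        have : (fun x => χ 0 x * F x) = fun x => F x * χ 0 x := by ext; ring
        rw [this, lineInt_mul_of_const hc0, hF, lineInt_fubini hψ]
        ring
      have e2 : lineInt univ 1 (fun x => χ 0 x * χ 1 x) x = χ 0 x := by
        have : (fun x => χ 0 x * χ 1 x) = fun x => χ 1 x * χ 0 x := by ext; ring
        rw [this, lineInt_mul_of_const hc0, lineInt_coord_eq_integral, hb1, one_mul]
      rw [e, e1, e2]; ring
    have hΨ₀ : IsTestOn Q (lineInt (Ioi 0) 0 θ) := hcomp (contDiff_lineInt hθt _ _)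
      fun x hx => lineInt_Ioi_eq_zero_of_notMem hθ0 0 hθl hx
    have hΨ₁ : IsTestOn Q (lineInt (Ioi 0) 1 θ') := hcomp (contDiff_lineInt hθ't _ _)
      fun x hx => lineInt_Ioi_eq_zero_of_notMem hθ'0 1 hθ'l hx
    refine ⟨_, _, hΨ₀, hΨ₁, fun x => ?_, ?_⟩
    · rw [pd_lineInt_Ioi hθt, pd_lineInt_Ioi hθ't]
      simp only [hθ, hθ']
      ring
    · have hind : ∀ (g f : Plane → ℝ) (i : Fin 2), IsTestOn Q f →
          ∫ x in Q, g x * lineInt (Ioi 0) i f x =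
            ∫ x, Q.indicator g x * lineInt J₁ i f x := fun g f i hf => by
        rw [← integral_indicator hQm]
        congr 1; ext x
        by_cases hx : x ∈ Q
        · simp only [indicator_of_mem hx]
          rw [lineInt_Ioi_eq (h0r hf) i (by linarith [(abs_lt.1 (hx i)).2]), hJ₁]
        · simp [hx]
      rw [hind g₀ θ 0 hθt, hind g₁ θ' 1 hθ't, ah₀ Q θ hθt, ah₁ Q θ' hθ't]
      have it : ∀ {h f : Plane → ℝ}, Integrable h → IsTestOn Q f →
          Integrable (fun x => h x * f x) := fun ih hf =>
        integrable_mul_of_locallyIntegrable ih.locallyIntegrable hf.continuous hf.compact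
      have kF : ∀ {h k : Plane → ℝ}, Integrable h →
          (∀ Ω ψ, IsTestOn Ω ψ → ∫ x, h x * χ 0 x * lineInt J₂ 0 ψ x = ∫ x, k x * ψ x) →
          ∫ x, h x * (χ 0 x * F x) = ∫ x, k x * ψ x := fun ih ak => by
        rw [← ak Q ψ hψ]
        congr 1; ext x
        rw [hFn x, mul_assoc]
      have s1 : ∫ x, h₀ x * θ x = (∫ x, h₀ x * ψ x) - ∫ x, k₀ x * ψ x := by
        rw [← kF ih₀ ak₀, ← integral_sub (it ih₀ hψ) (it ih₀ hχF)]
        congr 1; ext x; simp only [hθ]; ring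
      have s2 : ∫ x, h₁ x * θ' x = (∫ x, k₁ x * ψ x) - c₁ * m := by
        have : c₁ * m = ∫ x, h₁ x * (m * (χ 0 x * χ 1 x)) := by
          rw [hc₁, ← integral_mul_const]
          congr 1; ext x; ring
        rw [this, ← kF ih₁ ak₁, ← integral_sub (it ih₁ hχF) (it ih₁ (hη.const_mul m))]
        congr 1; ext x; simp only [hθ']; ring
      have s3 : ∫ x in Q, (h₀ x - k₀ x + k₁ x - c₁) * ψ x =
          ∫ x, (h₀ x - k₀ x + k₁ x - c₁) * ψ x :=
        setIntegral_eq_integral_of_forall_compl_eq_zero fun x hx => by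
          rw [hψ.eq_zero hx, mul_zero]
      have s4 : ∫ x, (h₀ x - k₀ x + k₁ x - c₁) * ψ x =
          (∫ x, h₀ x * ψ x) - (∫ x, k₀ x * ψ x) + (∫ x, k₁ x * ψ x) - c₁ * m := by
        rw [← integral_sub (it ih₀ hψ) (it ik₀ hψ), ← integral_add _ (it ik₁ hψ), hm,
          ← integral_const_mul, ← integral_sub]
        · congr 1; ext x; ring
        · exact ((it ih₀ hψ).sub (it ik₀ hψ)).add (it ik₁ hψ)
        · exact (hψ.integrable volume).const_mul _
        · exact (it ih₀ hψ).sub (it ik₀ hψ)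
      rw [s1, s2, s3, s4]
      ring

/-! ### Potentials of fields orthogonal to the divergence free test fields -/

/-- The field `g` on `Ω` is orthogonal to all the divergence free test fields on `Ω`. -/
def OrthSolenoidal (Ω : Set Plane) (g : Plane → Plane) : Prop :=
  ∀ Ψ₀ Ψ₁ : Plane → ℝ, IsTestOn Ω Ψ₀ → IsTestOn Ω Ψ₁ → (∀ x, pd 0 Ψ₀ x + pd 1 Ψ₁ x = 0) →
    (∫ x in Ω, g x 0 * Ψ₀ x) + ∫ x in Ω, g x 1 * Ψ₁ x = 0

theorem isWeakGradient_iff {Ω : Set Plane} {u : Plane → ℝ} {g : Plane → Plane} :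
    IsWeakGradient Ω u g ↔ ∀ φ, IsTestOn Ω φ → ∀ i : Fin 2,
      ∫ x in Ω, u x * pd i φ x = -∫ x in Ω, g x i * φ x :=
  ⟨fun h φ hφ => h φ hφ.smooth hφ.compact hφ.subset, fun h φ h1 h2 h3 => h φ ⟨h1, h2, h3⟩⟩

theorem integrableOn_mul_of_isTestOn {Ω : Set Plane} {u φ : Plane → ℝ}
    (hu : LocallyIntegrableOn u Ω) (hφ : IsTestOn Ω φ) :
    IntegrableOn (fun x => u x * φ x) Ω := by
  have hK := hu.integrableOn_compact_subset hφ.subset hφ.compact.isCompact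
  obtain ⟨C, hC⟩ := hφ.exists_bound
  have h1 : IntegrableOn (fun x => u x * φ x) (tsupport φ) :=
    hK.mul_bdd (c := C) hφ.continuous.aestronglyMeasurable (Eventually.of_forall hC)
  refine (h1.of_forall_sdiff_eq_zero (t := univ) MeasurableSet.univ fun x hx => ?_).mono_set
    (subset_univ _)
  rw [image_eq_zero_of_notMem_tsupport hx.2, mul_zero]

theorem IntegrableOn.coord {Ω : Set Plane} {g : Plane → Plane} (hg : IntegrableOn g Ω)
    (i : Fin 2) : IntegrableOn (fun x => g x i) Ω :=
  (EuclideanSpace.proj (𝕜 := ℝ) i).integrable_comp hg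

theorem integral_abs_coord_le {Ω : Set Plane} {g : Plane → Plane} (hg : IntegrableOn g Ω)
    (i : Fin 2) : ∫ x in Ω, |g x i| ≤ ∫ x in Ω, ‖g x‖ :=
  integral_mono (IntegrableOn.coord hg i).abs hg.norm fun x => PiLp.norm_apply_le (g x) i

/-- Weak gradients are orthogonal to the divergence free test fields. -/
theorem IsWeakGradient.orthSolenoidal {Ω : Set Plane} {u : Plane → ℝ} {g : Plane → Plane}
    (hu : LocallyIntegrableOn u Ω) (h : IsWeakGradient Ω u g) : OrthSolenoidal Ω g := by
  intro Ψ₀ Ψ₁ h₀ h₁ hdiv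
  rw [isWeakGradient_iff] at h
  have e0 := h Ψ₀ h₀ 0
  have e1 := h Ψ₁ h₁ 1
  have : (∫ x in Ω, u x * pd 0 Ψ₀ x) + ∫ x in Ω, u x * pd 1 Ψ₁ x = 0 := by
    rw [← integral_add (integrableOn_mul_of_isTestOn hu (h₀.pd 0))
      (integrableOn_mul_of_isTestOn hu (h₁.pd 1))]
    refine integral_eq_zero_of_ae (Eventually.of_forall fun x => ?_)
    simp only [← mul_add, hdiv x, mul_zero, Pi.zero_apply]
  linarith

/-- A test function is a finite sum of test functions on the members of an open cover. -/
theorem IsTestOn.exists_partition {ι : Type*} {Ω : Set Plane} {φ : Plane → ℝ}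
    (hφ : IsTestOn Ω φ) {U : ι → Set Plane} (hU : ∀ k, IsOpen (U k)) (hc : Ω ⊆ ⋃ k, U k) :
    ∃ (s : Finset ι) (f : ι → Plane → ℝ), (∀ k, IsTestOn (U k) (f k)) ∧
      φ = fun x => ∑ k ∈ s, f k x := by
  obtain ⟨ρ, hρ⟩ := SmoothPartitionOfUnity.exists_isSubordinate (modelWithCornersSelf ℝ Plane)
    (isClosed_tsupport φ) U hU (hφ.subset.trans hc)
  have hfin := ρ.locallyFinite.finite_nonempty_inter_compact hφ.compact.isCompact
  refine ⟨hfin.toFinset, fun k x => φ x * ρ k x, fun k => ?_, ?_⟩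
  · have hs : ContDiff ℝ ∞ (ρ k) := (ρ k).contMDiff.contDiff
    exact ⟨hφ.smooth.mul hs, hφ.compact.mul_right, tsupport_mul_subset_right.trans (hρ k)⟩
  · ext x
    rw [← Finset.mul_sum]
    by_cases hx : x ∈ tsupport φ
    · have h1 := ρ.sum_eq_one hx
      rw [finsum_eq_sum_of_support_subset (s := hfin.toFinset)] at h1
      · rw [h1, mul_one]
      · intro k hk
        simp only [Finite.coe_toFinset, mem_ofPred_eq]
        exact ⟨x, hk, hx⟩
    · rw [image_eq_zero_of_notMem_tsupport hx, zero_mul]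

theorem pd_sum {ι : Type*} (s : Finset ι) {f : ι → Plane → ℝ} (hf : ∀ k, Differentiable ℝ (f k))
    (i : Fin 2) (x : Plane) : pd i (fun x => ∑ k ∈ s, f k x) x = ∑ k ∈ s, pd i (f k) x := by
  simp only [pd]
  rw [fderiv_fun_sum fun k _ => hf k x]
  simp

/-- A weak gradient can be checked on the members of an open cover. -/
theorem isWeakGradient_of_cover {ι : Type*} {Ω : Set Plane} {u : Plane → ℝ} {g : Plane → Plane}
    (hu : LocallyIntegrableOn u Ω) (hg : ∀ i, LocallyIntegrableOn (fun x => g x i) Ω)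
    {U : ι → Set Plane} (hU : ∀ k, IsOpen (U k)) (hc : Ω = ⋃ k, U k)
    (h : ∀ k φ, IsTestOn (U k) φ → ∀ i : Fin 2,
      ∫ x in Ω, u x * pd i φ x = -∫ x in Ω, g x i * φ x) : IsWeakGradient Ω u g := by
  rw [isWeakGradient_iff]
  intro φ hφ i
  obtain ⟨s, f, hf, rfl⟩ := hφ.exists_partition hU hc.subset
  have hUΩ : ∀ k, U k ⊆ Ω := fun k => hc ▸ subset_iUnion U k
  simp only [pd_sum s (fun k => (hf k).differentiable), Finset.mul_sum]
  rw [integral_finsetSum s fun k _ =>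
      integrableOn_mul_of_isTestOn hu (((hf k).pd i).mono (hUΩ k)),
    integral_finsetSum s fun k _ => integrableOn_mul_of_isTestOn (hg i) ((hf k).mono (hUΩ k)),
    ← Finset.sum_neg_distrib]
  exact Finset.sum_congr rfl fun k _ => h k _ (hf k) i

theorem exists_countable_box_cover {Ω : Set Plane} (hΩ : IsOpen Ω) (hne : Ω.Nonempty) :
    ∃ (c : ℕ → Plane) (r : ℕ → ℝ), (∀ k, 0 < r k) ∧ Ω = ⋃ k, box (c k) (r k) := by
  choose! r hr hrΩ using fun x (hx : x ∈ Ω) => exists_box_subset hΩ hx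
  obtain ⟨T, hTc, hT⟩ := TopologicalSpace.isOpen_iUnion_countable
    (fun x : Ω => box (x : Plane) (r x)) (fun x => isOpen_box _ _)
  have hΩ' : Ω = ⋃ x : Ω, box (x : Plane) (r x) := by
    refine Subset.antisymm (fun x hx => mem_iUnion.2 ⟨⟨x, hx⟩, mem_box_self x (hr x hx)⟩) ?_
    exact iUnion_subset fun x => hrΩ x x.2
  have hTne : T.Nonempty := by
    by_contra h
    rw [not_nonempty_iff_eq_empty.1 h] at hT
    simp only [mem_empty_iff_false, iUnion_of_empty, iUnion_empty] at hT
    rw [← hΩ'] at hT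
    exact hne.ne_empty hT.symm
  obtain ⟨e, rfl⟩ := hTc.exists_eq_range hTne
  refine ⟨fun k => e k, fun k => r (e k), fun k => hr _ (e k).2, ?_⟩
  refine hΩ'.trans (hT.symm.trans ?_)
  simp

/-- The divergences of the test fields on `Ω`. -/
def testDivergences (Ω : Set Plane) : Submodule ℝ (Plane → ℝ) where
  carrier := {f | ∃ Ψ₀ Ψ₁ : Plane → ℝ, IsTestOn Ω Ψ₀ ∧ IsTestOn Ω Ψ₁ ∧
    f = fun x => pd 0 Ψ₀ x + pd 1 Ψ₁ x}
  zero_mem' := ⟨_, _, IsTestOn.zero, IsTestOn.zero, by ext x; simp [pd]⟩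
  add_mem' := by
    rintro _ _ ⟨Ψ₀, Ψ₁, h₀, h₁, rfl⟩ ⟨Θ₀, Θ₁, k₀, k₁, rfl⟩
    refine ⟨_, _, h₀.add k₀, h₁.add k₁, ?_⟩
    ext x
    simp only [pd_add h₀.differentiable k₀.differentiable,
      pd_add h₁.differentiable k₁.differentiable, Pi.add_apply]
    ring
  smul_mem' := by
    rintro a _ ⟨Ψ₀, Ψ₁, h₀, h₁, rfl⟩
    refine ⟨_, _, h₀.const_mul a, h₁.const_mul a, ?_⟩
    ext x
    simp only [pd_const_mul h₀.differentiable, pd_const_mul h₁.differentiable, Pi.smul_apply,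
      smul_eq_mul]
    ring

/-- The fundamental lemma of the calculus of variations. -/
theorem ae_eq_of_forall_test {Ω : Set Plane} (hΩ : IsOpen Ω) {f f' : Plane → ℝ}
    (hf : LocallyIntegrableOn f Ω) (hf' : LocallyIntegrableOn f' Ω)
    (h : ∀ ψ, IsTestOn Ω ψ → ∫ x in Ω, f x * ψ x = ∫ x in Ω, f' x * ψ x) :
    ∀ᵐ x, x ∈ Ω → f x = f' x := by
  have := hΩ.ae_eq_zero_of_integral_contDiff_smul_eq_zero (μ := volume) (hf.sub hf')
    fun ψ h1 h2 h3 => ?_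
  · filter_upwards [this] with x hx hxΩ
    exact sub_eq_zero.1 (hx hxΩ)
  · have ht : IsTestOn Ω ψ := ⟨h1, h2, h3⟩
    rw [← setIntegral_eq_integral_of_forall_compl_eq_zero (s := Ω) fun x hx => by
      rw [ht.eq_zero hx, zero_smul]]
    have e : ∀ x, ψ x • (f - f') x = f x * ψ x - f' x * ψ x := fun x => by
      simp only [Pi.sub_apply, smul_eq_mul]; ring
    simp only [e]
    rw [integral_sub (integrableOn_mul_of_isTestOn hf ht) (integrableOn_mul_of_isTestOn hf' ht),
      h ψ ht, sub_self]

/-- A quantitative form of de Rham's theorem: a field `g` on `Ω` that is orthogonal to the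
divergence free test fields has a potential `w`, and `w` can be normalized so that its `L¹` norm on
each member of a fixed countable cover is controlled by the `L¹` norm of `g` on `Ω`. With an
algebraic projection of the test functions onto the divergences, `w` is the function that represents
the functional `ψ ↦ -∫ g · Ψ`, where `div Ψ` is the projection of `ψ`. In this way no constants of
integration have to be matched along chains of squares. -/
theorem exists_potential {Ω : Set Plane} (hΩ : IsOpen Ω) :
    ∃ (Q : ℕ → Set Plane) (C : ℕ → ℝ), (∀ k, IsOpen (Q k)) ∧ Ω = ⋃ k, Q k ∧
      ∀ g : Plane → Plane, IntegrableOn g Ω → OrthSolenoidal Ω g →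
        ∃ w : Plane → ℝ, IsWeakGradient Ω w g ∧ LocallyIntegrableOn w Ω ∧
          ∀ k, IntegrableOn w (Q k) ∧ ∫ x in Q k, |w x| ≤ C k * ∫ x in Ω, ‖g x‖ := by
  rcases Ω.eq_empty_or_nonempty with rfl | hne
  · refine ⟨fun _ => ∅, fun _ => 0, fun _ => isOpen_empty, by simp, fun g _ _ => ⟨0, ?_, ?_, ?_⟩⟩
    · rw [isWeakGradient_iff]; simp
    · exact fun x hx => hx.elim
    · simp
  obtain ⟨c, r, hr, hcov⟩ := exists_countable_box_cover hΩ hne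
  have hQΩ : ∀ k, box (c k) (r k) ⊆ Ω := fun k => hcov ▸ subset_iUnion (fun k => box (c k) (r k)) k
  choose η C hη hC hdec using fun k => exists_box_decomposition (c k) (hr k)
  obtain ⟨P, hP⟩ := LinearMap.exists_leftInverse_of_injective (testDivergences Ω).subtype
    (by simp)
  have hPN : ∀ f (hf : f ∈ testDivergences Ω), (P f : Plane → ℝ) = f := fun f hf => by
    have := LinearMap.congr_fun hP ⟨f, hf⟩
    simpa using congrArg Subtype.val this
  -- `P` is the identity on the divergences, so a decomposition `ψ = div Ψ + m η` gives
  -- `P ψ = div (Ψ + m H)`, where `P η = div H`.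
  choose H₀ H₁ hH₀ hH₁ hH using fun k => (P (η k)).2
  choose D₀ hD₀ using fun k => (hH₀ k).exists_bound
  choose D₁ hD₁ using fun k => (hH₁ k).exists_bound
  refine ⟨fun k => box (c k) (r k),
    fun k => 2 * C k + volume.real (box (c k) (r k)) * (D₀ k + D₁ k),
    fun k => isOpen_box _ _, hcov, fun g hg horth => ?_⟩
  have hgc := fun i => IntegrableOn.coord hg i
  have hloc : ∀ i, LocallyIntegrableOn (fun x => g x i) Ω := fun i =>
    (hgc i).locallyIntegrableOn
  -- the functional `ψ ↦ -∫ g · Ψ`, where `div Ψ = P ψ`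
  have hL : ∀ ψ : Plane → ℝ, ∃ l : ℝ, ∀ Ψ₀ Ψ₁, IsTestOn Ω Ψ₀ → IsTestOn Ω Ψ₁ →
      ((P ψ : Plane → ℝ) = fun x => pd 0 Ψ₀ x + pd 1 Ψ₁ x) →
      l = -((∫ x in Ω, g x 0 * Ψ₀ x) + ∫ x in Ω, g x 1 * Ψ₁ x) := fun ψ => by
    obtain ⟨Θ₀, Θ₁, k₀, k₁, hΘ⟩ := (P ψ).2
    refine ⟨-((∫ x in Ω, g x 0 * Θ₀ x) + ∫ x in Ω, g x 1 * Θ₁ x), fun Ψ₀ Ψ₁ h₀ h₁ hΨ => ?_⟩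
    have := horth _ _ (h₀.sub k₀) (h₁.sub k₁) fun x => by
      rw [pd_sub h₀.differentiable k₀.differentiable, pd_sub h₁.differentiable k₁.differentiable]
      have := congrFun (hΘ.symm.trans hΨ) x
      linarith
    simp only [mul_sub] at this
    rw [integral_sub (integrableOn_mul_of_isTestOn (hloc 0) h₀)
        (integrableOn_mul_of_isTestOn (hloc 0) k₀),
      integral_sub (integrableOn_mul_of_isTestOn (hloc 1) h₁)
        (integrableOn_mul_of_isTestOn (hloc 1) k₁)] at this
    linarith
  choose L hL using hL
  have hLpd : ∀ φ, IsTestOn Ω φ → ∀ i : Fin 2, L (pd i φ) = -∫ x in Ω, g x i * φ x := by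
    intro φ hφ i
    fin_cases i
    · have hrep : pd 0 φ = fun x => pd 0 φ x + pd 1 (fun _ => (0 : ℝ)) x := by
        ext x; simp [pd]
      have := hL (pd 0 φ) φ (fun _ => 0) hφ IsTestOn.zero
        ((hPN _ ⟨_, _, hφ, IsTestOn.zero, hrep⟩).trans hrep)
      simpa using this
    · have hrep : pd 1 φ = fun x => pd 0 (fun _ => (0 : ℝ)) x + pd 1 φ x := by
        ext x; simp [pd]
      have := hL (pd 1 φ) (fun _ => 0) φ IsTestOn.zero hφ
        ((hPN _ ⟨_, _, IsTestOn.zero, hφ, hrep⟩).trans hrep)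
      simpa using this
  choose w hwi hwb hw using fun k => hdec k (fun x => g x 0) (fun x => g x 1)
    ((hgc 0).mono_set (hQΩ k)) ((hgc 1).mono_set (hQΩ k))
  let a : ℕ → ℝ := fun k => (∫ x in Ω, g x 0 * H₀ k x) + ∫ x in Ω, g x 1 * H₁ k x
  have hvol : ∀ k, volume (box (c k) (r k)) ≠ ⊤ := fun k => (volume_box_lt_top _ _).ne
  let v : ℕ → Plane → ℝ := fun k x => -w k x - a k
  have hvi : ∀ k, IntegrableOn (v k) (box (c k) (r k)) := fun k =>
    (hwi k).neg.sub (integrableOn_const (hvol k))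
  have hLv : ∀ k ψ, IsTestOn (box (c k) (r k)) ψ →
      L ψ = ∫ x in box (c k) (r k), v k x * ψ x := by
    intro k ψ hψ
    obtain ⟨Ψ₀, Ψ₁, h₀, h₁, hΨ, hpair⟩ := hw k ψ hψ
    set m := ∫ y, ψ y with hm
    have h₀' := h₀.mono (hQΩ k)
    have h₁' := h₁.mono (hQΩ k)
    have hψe : ψ = (fun x => pd 0 Ψ₀ x + pd 1 Ψ₁ x) + m • η k := by
      ext x; simp [hΨ x]
    have hPψ : (P ψ : Plane → ℝ) = fun x => pd 0 (fun x => Ψ₀ x + m * H₀ k x) x +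
        pd 1 (fun x => Ψ₁ x + m * H₁ k x) x := by
      rw [hψe, map_add, map_smul, Submodule.coe_add, Submodule.coe_smul, hH k,
        hPN _ ⟨_, _, h₀', h₁', rfl⟩]
      ext x
      rw [pd_add h₀.differentiable ((hH₀ k).const_mul m).differentiable,
        pd_add h₁.differentiable ((hH₁ k).const_mul m).differentiable,
        pd_const_mul (hH₀ k).differentiable, pd_const_mul (hH₁ k).differentiable]
      simp only [Pi.add_apply, Pi.smul_apply, smul_eq_mul]
      ring
    rw [hL ψ _ _ (h₀'.add ((hH₀ k).const_mul m)) (h₁'.add ((hH₁ k).const_mul m)) hPψ]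
    have hsplit : ∀ (i : Fin 2) (Ψ H : Plane → ℝ), IsTestOn (box (c k) (r k)) Ψ →
        IsTestOn Ω H → ∫ x in Ω, g x i * (Ψ x + m * H x) =
          (∫ x in box (c k) (r k), g x i * Ψ x) + m * ∫ x in Ω, g x i * H x := by
      intro i Ψ H hΨ hH
      rw [← integral_const_mul, ← setIntegral_eq_of_subset_of_forall_sdiff_eq_zero
        hΩ.measurableSet (hQΩ k) (f := fun x => g x i * Ψ x)]
      · rw [← integral_add (integrableOn_mul_of_isTestOn (hloc i) (hΨ.mono (hQΩ k)))
          ((integrableOn_mul_of_isTestOn (hloc i) hH).const_mul m)]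
        congr 1; ext x; ring
      · intro x hx
        rw [hΨ.eq_zero hx.2, mul_zero]
    have i1 : IntegrableOn (fun x => w k x * ψ x) (box (c k) (r k)) :=
      integrableOn_mul_of_isTestOn (hwi k).locallyIntegrableOn hψ
    have e : ∫ x in box (c k) (r k), v k x * ψ x =
        -(∫ x in box (c k) (r k), w k x * ψ x) - a k * m := by
      have e1 : ∀ x, v k x * ψ x = -(w k x * ψ x) - a k * ψ x := fun x => by
        simp only [v]; ring
      simp only [e1]
      rw [integral_sub (f := fun x => -(w k x * ψ x)) i1.neg
        (((hψ.integrable volume).integrableOn).const_mul _), integral_neg, integral_const_mul,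
        setIntegral_eq_integral_of_forall_compl_eq_zero fun x hx => hψ.eq_zero hx]
    rw [hsplit 0 Ψ₀ _ h₀ (hH₀ k), hsplit 1 Ψ₁ _ h₁ (hH₁ k), e, ← hpair]
    simp only [a]
    ring
  -- The functional `L` does not depend on the square, so the functions that represent it on two
  -- squares agree on their intersection, and they can be glued without additive constants.
  have hov : ∀ j k, ∀ᵐ x, x ∈ box (c j) (r j) ∩ box (c k) (r k) → v j x = v k x := by
    intro j k
    refine ae_eq_of_forall_test ((isOpen_box _ _).inter (isOpen_box _ _))
      ((hvi j).mono_set inter_subset_left).locallyIntegrableOn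
      ((hvi k).mono_set inter_subset_right).locallyIntegrableOn fun ψ hψ => ?_
    have e1 := hLv j ψ (hψ.mono inter_subset_left)
    have e2 := hLv k ψ (hψ.mono inter_subset_right)
    rw [setIntegral_eq_of_subset_of_forall_sdiff_eq_zero (isOpen_box _ _).measurableSet
      (inter_subset_left (s := box (c j) (r j)) (t := box (c k) (r k)))
      fun x hx => by rw [hψ.eq_zero hx.2, mul_zero]] at e1
    rw [setIntegral_eq_of_subset_of_forall_sdiff_eq_zero (isOpen_box _ _).measurableSet
      (inter_subset_right (s := box (c j) (r j)) (t := box (c k) (r k)))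
      fun x hx => by rw [hψ.eq_zero hx.2, mul_zero]] at e2
    rw [← e1, ← e2]
  have hmem : ∀ x, x ∈ Ω → ∃ k, x ∈ box (c k) (r k) := fun x hx => by
    rw [hcov] at hx; exact mem_iUnion.1 hx
  choose! κ hκ using hmem
  let W : Plane → ℝ := fun x => v (κ x) x
  have hWv : ∀ k, ∀ᵐ x, x ∈ box (c k) (r k) → W x = v k x := fun k => by
    have := ae_all_iff.2 fun j => hov j k
    filter_upwards [this] with x hx hxk
    exact hx (κ x) ⟨hκ x (hQΩ k hxk), hxk⟩
  have hWv' : ∀ k, W =ᵐ[volume.restrict (box (c k) (r k))] v k := fun k =>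
    (ae_restrict_iff' (isOpen_box _ _).measurableSet).2 (hWv k)
  have hWi : ∀ k, IntegrableOn W (box (c k) (r k)) := fun k => (hvi k).congr (hWv' k).symm
  have hWloc : LocallyIntegrableOn W Ω := fun x hx =>
    ⟨box (c (κ x)) (r (κ x)),
      mem_nhdsWithin_of_mem_nhds ((isOpen_box _ _).mem_nhds (hκ x hx)), hWi _⟩
  refine ⟨W, ?_, hWloc, fun k => ⟨hWi k, ?_⟩⟩
  · refine isWeakGradient_of_cover hWloc hloc (fun k => isOpen_box (c k) (r k)) hcov
      fun k φ hφ i => ?_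
    rw [← hLpd φ (hφ.mono (hQΩ k)) i, hLv k _ (hφ.pd i),
      setIntegral_eq_of_subset_of_forall_sdiff_eq_zero hΩ.measurableSet (hQΩ k)
      fun x hx => by rw [(hφ.pd i).eq_zero hx.2, mul_zero]]
    refine integral_congr_ae ?_
    filter_upwards [hWv' k] with x hx
    rw [hx]
  · set G := ∫ x in Ω, ‖g x‖ with hG
    have hgQ : ∀ i, ∫ x in box (c k) (r k), |g x i| ≤ G := fun i =>
      (setIntegral_mono_set (hgc i).abs (Eventually.of_forall fun x => abs_nonneg _)
        (hQΩ k).eventuallyLE).trans (integral_abs_coord_le hg i)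
    have hpairH : ∀ (i : Fin 2) (H : Plane → ℝ) (D : ℝ), (∀ x, |H x| ≤ D) →
        |∫ x in Ω, g x i * H x| ≤ D * G := by
      intro i H D hD
      refine abs_integral_le_integral_abs.trans ((integral_mono_of_nonneg
        (Eventually.of_forall fun x => abs_nonneg _) ((hgc i).abs.mul_const D)
        (Eventually.of_forall fun x => ?_)).trans ?_)
      · simp only [abs_mul]
        exact mul_le_mul_of_nonneg_left (hD x) (abs_nonneg _)
      · rw [integral_mul_const, mul_comm]
        exact mul_le_mul_of_nonneg_left (integral_abs_coord_le hg i)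
          ((abs_nonneg _).trans (hD 0))
    have ha : |a k| ≤ (D₀ k + D₁ k) * G := by
      refine (abs_add_le _ _).trans ?_
      rw [add_mul]
      exact add_le_add (hpairH 0 _ _ (hD₀ k)) (hpairH 1 _ _ (hD₁ k))
    calc ∫ x in box (c k) (r k), |W x| = ∫ x in box (c k) (r k), |v k x| :=
          integral_congr_ae ((hWv' k).fun_comp abs)
      _ ≤ ∫ x in box (c k) (r k), (|w k x| + |a k|) := by
          refine integral_mono (hvi k).abs ((hwi k).abs.add (integrableOn_const (hvol k)))
            fun x => ?_
          simp only [v]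
          refine (abs_sub _ _).trans_eq (by rw [abs_neg])
      _ = (∫ x in box (c k) (r k), |w k x|) + volume.real (box (c k) (r k)) * |a k| := by
          rw [integral_add (hwi k).abs (integrableOn_const (hvol k))]
          simp
      _ ≤ C k * G + C k * G + volume.real (box (c k) (r k)) * ((D₀ k + D₁ k) * G) := by
          refine add_le_add ((hwb k).trans (add_le_add ?_ ?_)) ?_
          · exact mul_le_mul_of_nonneg_left (hgQ 0) (hC k)
          · exact mul_le_mul_of_nonneg_left (hgQ 1) (hC k)
          · exact mul_le_mul_of_nonneg_left ha measureReal_nonneg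
      _ = _ := by ring

/-! ### Mollification -/

/-- The radius of the support of the `n`-th mollifier. -/
def molRadius (n : ℕ) : ℝ := 1 / ((n : ℝ) + 1)

theorem molRadius_pos (n : ℕ) : 0 < molRadius n := Nat.one_div_pos_of_nat

theorem tendsto_molRadius : Tendsto molRadius atTop (𝓝 0) :=
  tendsto_one_div_add_atTop_nhds_zero_nat

/-- A sequence of bump functions at the origin with supports shrinking to it. -/
def bumpSeq (n : ℕ) : ContDiffBump (0 : Plane) where
  rIn := molRadius n / 2
  rOut := molRadius n
  rIn_pos := half_pos (molRadius_pos n)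
  rIn_lt_rOut := half_lt_self (molRadius_pos n)

/-- The `n`-th mollifier. -/
def molKernel (n : ℕ) : Plane → ℝ := (bumpSeq n).normed volume

theorem molKernel_nonneg (n : ℕ) (x : Plane) : 0 ≤ molKernel n x := (bumpSeq n).nonneg_normed x

theorem integrable_molKernel (n : ℕ) : Integrable (molKernel n) := (bumpSeq n).integrable_normed

theorem integral_molKernel (n : ℕ) : ∫ x, molKernel n x = 1 := (bumpSeq n).integral_normed

/-- The mollification `f * ρ_n`. -/
def moll (n : ℕ) (f : Plane → ℝ) : Plane → ℝ := conv volume f (molKernel n)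

/-- The probability measure with density the `n`-th mollifier. -/
def molMeasure (n : ℕ) : Measure Plane :=
  volume.withDensity fun t => ENNReal.ofReal (molKernel n t)

theorem isTestOn_molKernel (n : ℕ) : IsTestOn univ (molKernel n) :=
  ⟨(bumpSeq n).contDiff_normed (n := ⊤), (bumpSeq n).hasCompactSupport_normed, subset_univ _⟩

theorem tsupport_molKernel (n : ℕ) : tsupport (molKernel n) = Metric.closedBall 0 (molRadius n) :=
  (bumpSeq n).tsupport_normed_eq

theorem molKernel_eq_zero {n : ℕ} {x : Plane} (hx : molRadius n < ‖x‖) : molKernel n x = 0 := by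
  refine image_eq_zero_of_notMem_tsupport ?_
  rw [tsupport_molKernel]
  simpa using hx

instance (n : ℕ) : IsProbabilityMeasure (molMeasure n) := by
  refine ⟨?_⟩
  rw [molMeasure, withDensity_apply _ MeasurableSet.univ, Measure.restrict_univ,
    ← ofReal_integral_eq_lintegral_ofReal (integrable_molKernel n)
      (Eventually.of_forall (molKernel_nonneg n)), integral_molKernel, ENNReal.ofReal_one]

theorem ae_molMeasure_norm_le (n : ℕ) :
    ∀ᵐ t ∂molMeasure n, ‖t‖ ≤ molRadius n := by
  have hm : Measurable fun t => ENNReal.ofReal (molKernel n t) :=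
    (isTestOn_molKernel n).continuous.measurable.ennreal_ofReal
  rw [molMeasure, ae_withDensity_iff hm]
  refine Eventually.of_forall fun t ht => ?_
  by_contra h
  exact ht (by rw [molKernel_eq_zero (not_le.1 h), ENNReal.ofReal_zero])

theorem moll_eq_integral_kernel (n : ℕ) (f : Plane → ℝ) (x : Plane) :
    moll n f x = ∫ t, molKernel n t * f (x - t) := by
  rw [moll, conv, ← integral_sub_left_eq_self _ volume x]
  simp [mul_comm]

/-- The mollification is an average of translates of `f`. -/
theorem moll_eq_integral_measure (n : ℕ) (f : Plane → ℝ) (x : Plane) :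
    moll n f x = ∫ t, f (x - t) ∂molMeasure n := by
  have hm : Measurable fun t => (molKernel n t).toNNReal :=
    (isTestOn_molKernel n).continuous.measurable.real_toNNReal
  rw [moll_eq_integral_kernel, molMeasure]
  have : (fun t => ENNReal.ofReal (molKernel n t)) =
    fun t => (((molKernel n t).toNNReal : ℝ≥0) : ℝ≥0∞) := rfl
  rw [this, integral_withDensity_eq_integral_smul hm]
  congr 1; ext t
  rw [NNReal.smul_def, Real.coe_toNNReal _ (molKernel_nonneg n t), smul_eq_mul]

theorem contDiff_moll (n : ℕ) {f : Plane → ℝ} (hf : LocallyIntegrable f) :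
    ContDiff ℝ ∞ (moll n f) :=
  contDiff_conv hf (isTestOn_molKernel n).smooth (isTestOn_molKernel n).compact

theorem moll_congr {n : ℕ} {f f' : Plane → ℝ} {x : Plane}
    (h : ∀ y ∈ Metric.closedBall x (molRadius n), f y = f' y) : moll n f x = moll n f' x := by
  refine integral_congr_ae (Eventually.of_forall fun t => ?_)
  by_cases ht : t ∈ Metric.closedBall x (molRadius n)
  · simp only [h t ht]
  · have : molKernel n (x - t) = 0 := molKernel_eq_zero (by
      simpa [dist_eq_norm, norm_sub_rev] using ht)
    simp [this]

theorem moll_eq_zero {n : ℕ} {f : Plane → ℝ} {x : Plane}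
    (h : ∀ y ∈ Metric.closedBall x (molRadius n), f y = 0) : moll n f x = 0 := by
  rw [moll_congr (f' := fun _ => 0) h]
  simp [moll, conv]

theorem ae_tendsto_moll {f : Plane → ℝ} (hf : LocallyIntegrable f) :
    ∀ᵐ x, Tendsto (fun n => moll n f x) atTop (𝓝 (f x)) := by
  have := ContDiffBump.ae_convolution_tendsto_right_of_locallyIntegrable (μ := volume)
    (φ := bumpSeq) (l := atTop) (K := 2) (g := f) tendsto_molRadius
    (Eventually.of_forall fun n => by simp [bumpSeq]; linarith) hf
  filter_upwards [this] with x hx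
  refine hx.congr fun n => ?_
  rw [moll_eq_integral_kernel]
  rfl

/-- Mollification commutes with weak derivatives, at the points whose distance from the complement
of `Ω` exceeds the radius of the mollifier. Only the values near `x` matter, so `u` and `g` may be
replaced by functions `u'` and `h'` that are defined on the whole plane. -/
theorem pd_moll {Ω : Set Plane} {u u' h' : Plane → ℝ} {g : Plane → Plane}
    (hw : IsWeakGradient Ω u g) (hu' : LocallyIntegrable u') {n : ℕ} {x : Plane} {i : Fin 2}
    (hx : Metric.closedBall x (molRadius n) ⊆ Ω)
    (hu : ∀ y ∈ Metric.closedBall x (molRadius n), u' y = u y)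
    (hg : ∀ y ∈ Metric.closedBall x (molRadius n), h' y = g y i) :
    pd i (moll n u') x = moll n h' x := by
  have hk := isTestOn_molKernel n
  rw [moll, pd_conv hu' hk.smooth hk.compact]
  have hts : tsupport (fun t => molKernel n (x - t)) ⊆ Metric.closedBall x (molRadius n) := by
    refine closure_minimal (fun t ht => ?_) Metric.isClosed_closedBall
    by_contra h
    refine ht (molKernel_eq_zero ?_)
    simpa [dist_eq_norm, norm_sub_rev] using h
  have hφ : IsTestOn Ω fun t => molKernel n (x - t) :=
    ⟨hk.smooth.comp (contDiff_const.sub contDiff_id),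
      hk.compact.comp_homeomorph (Homeomorph.subLeft x), hts.trans hx⟩
  have hpd : ∀ t, pd i (fun t => molKernel n (x - t)) t = -pd i (molKernel n) (x - t) := by
    intro t
    have h1 : HasFDerivAt (fun t : Plane => x - t) (-ContinuousLinearMap.id ℝ Plane) t :=
      (hasFDerivAt_id t).const_sub x
    have := ((hk.differentiable (x - t)).hasFDerivAt.comp t h1).fderiv
    simp only [pd]
    rw [show (fun t => molKernel n (x - t)) = molKernel n ∘ fun t => x - t from rfl, this]
    simp
  have hout : ∀ t, t ∉ Ω → pd i (fun t => molKernel n (x - t)) t = 0 := fun t ht =>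
    (hφ.pd i).eq_zero ht
  have key := isWeakGradient_iff.1 hw _ hφ i
  have e1 : conv volume u' (pd i (molKernel n)) x =
      -∫ t in Ω, u t * pd i (fun t => molKernel n (x - t)) t := by
    rw [conv, ← integral_neg, setIntegral_eq_integral_of_forall_compl_eq_zero
      fun t ht => by rw [hout t ht, mul_zero, neg_zero]]
    congr 1; ext t
    by_cases ht : t ∈ Metric.closedBall x (molRadius n)
    · rw [hpd, hu t ht]; ring
    · have h0 : pd i (fun t => molKernel n (x - t)) t = 0 :=
        image_eq_zero_of_notMem_tsupport fun h => ht
          (hts (tsupport_fderiv_apply_subset ℝ _ h))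
      rw [h0, mul_zero, neg_zero]
      rw [hpd, neg_eq_zero] at h0
      rw [h0, mul_zero]
  rw [e1, key, neg_neg, moll, conv, setIntegral_eq_integral_of_forall_compl_eq_zero
    fun t ht => by rw [hφ.eq_zero ht, mul_zero]]
  congr 1; ext t
  by_cases ht : t ∈ Metric.closedBall x (molRadius n)
  · rw [hg t ht]
  · have : molKernel n (x - t) = 0 := molKernel_eq_zero (by
      simpa [dist_eq_norm, norm_sub_rev] using ht)
    rw [this]; ring

/-- Translation is continuous in `L^p`, `p < ∞`. -/
theorem tendsto_eLpNorm_translate_sub {f : Plane → ℝ} {p : ℝ≥0∞} (hp : 1 ≤ p) (hp' : p ≠ ⊤)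
    (hf : MemLp f p) :
    Tendsto (fun t => eLpNorm (fun x => f (x - t) - f x) p) (𝓝 0) (𝓝 0) := by
  have : Fact (1 ≤ p) := ⟨hp⟩
  let T : C(Plane, C(Plane, Plane)) :=
    ContinuousMap.curry ⟨fun q : Plane × Plane => q.2 - q.1, by fun_prop⟩
  have hT : ∀ t, MeasurePreserving (T t) volume volume := fun t =>
    measurePreserving_sub_right volume t
  have h1 : Continuous fun t => Lp.compMeasurePreserving (T t) (hT t) (hf.toLp f) :=
    continuous_const.compMeasurePreservingLp T.continuous hT hp'
  have h2 := (tendsto_iff_edist_tendsto_0.1 (h1.tendsto 0))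
  refine h2.congr fun t => ?_
  rw [Lp.edist_def]
  refine eLpNorm_congr_ae ?_
  have e1 : ∀ t, Lp.compMeasurePreserving (T t) (hT t) (hf.toLp f) =ᵐ[volume]
      fun x => f (x - t) := fun t =>
    (Lp.coeFn_compMeasurePreserving _ (hT t)).trans
      ((hT t).quasiMeasurePreserving.ae_eq_comp hf.coeFn_toLp)
  filter_upwards [e1 t, e1 0] with x h3 h4
  simp only [Pi.sub_apply]
  rw [h3, h4, sub_zero]

/-- Jensen's inequality for a power and a probability measure. -/
theorem lintegral_pow_le_lintegral_pow {ν : Measure Plane} [IsProbabilityMeasure ν] {r : ℝ}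
    (hr : 1 ≤ r) {F : Plane → ℝ≥0∞} (hF : AEMeasurable F ν) :
    (∫⁻ t, F t ∂ν) ^ r ≤ ∫⁻ t, F t ^ r ∂ν := by
  have := eLpNorm'_le_eLpNorm'_of_exponent_le (f := F) one_pos hr ν hF.aestronglyMeasurable
  simp only [eLpNorm', enorm_eq_self, ENNReal.rpow_one, div_one] at this
  calc (∫⁻ t, F t ∂ν) ^ r ≤ ((∫⁻ t, F t ^ r ∂ν) ^ (1 / r)) ^ r :=
        ENNReal.rpow_le_rpow this (by linarith)
    _ = _ := by
        rw [← ENNReal.rpow_mul, one_div_mul_cancel (by linarith), ENNReal.rpow_one]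

/-- Mollification converges in `L^p`. -/
theorem tendsto_eLpNorm_moll_sub {f : Plane → ℝ} {p : ℝ≥0∞} (hp : 1 ≤ p) (hp' : p ≠ ⊤)
    (hf : MemLp f p) : Tendsto (fun n => eLpNorm (moll n f - f) p) atTop (𝓝 0) := by
  have hp0 : p ≠ 0 := (one_pos.trans_le hp).ne'
  have hr : 1 ≤ p.toReal := by
    rw [← ENNReal.toReal_one]; exact ENNReal.toReal_mono hp' hp
  have hloc := hf.locallyIntegrable hp
  have htr := tendsto_eLpNorm_translate_sub hp hp' hf
  rw [ENNReal.tendsto_nhds_zero] at htr ⊢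
  intro ε hε
  obtain ⟨δ, hδ, hb⟩ := Metric.eventually_nhds_iff.1 (htr ε hε)
  filter_upwards [tendsto_molRadius.eventually (gt_mem_nhds hδ)] with n hn
  set ν := molMeasure n
  have hmeas : AEMeasurable (fun q : Plane × Plane => ‖f (q.1 - q.2) - f q.1‖ₑ ^ p.toReal)
      (volume.prod ν) := by
    have h1 : AEStronglyMeasurable (fun q : Plane × Plane => f (q.1 - q.2)) (volume.prod ν) :=
      hf.1.comp_quasiMeasurePreserving (quasiMeasurePreserving_sub_of_right_invariant volume ν)
    exact ((h1.sub hf.1.comp_fst).enorm).pow_const _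
  have hpt : ∀ x, ‖(moll n f - f) x‖ₑ ≤ ∫⁻ t, ‖f (x - t) - f x‖ₑ ∂ν := by
    intro x
    have hint : Integrable (fun t => f (x - t)) ν := by
      have h1 := integrable_conv_integrand hloc (isTestOn_molKernel n).continuous
        (isTestOn_molKernel n).compact x
      have h2 := h1.comp_sub_left x
      have hm : Measurable fun t => (molKernel n t).toNNReal :=
        (isTestOn_molKernel n).continuous.measurable.real_toNNReal
      refine (integrable_withDensity_iff_integrable_smul hm).2 (h2.congr ?_)
      refine Eventually.of_forall fun t => ?_
      simp only [sub_sub_cancel]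
      rw [NNReal.smul_def, Real.coe_toNNReal _ (molKernel_nonneg n t), smul_eq_mul,
        mul_comm]
    have : (moll n f - f) x = ∫ t, (f (x - t) - f x) ∂ν := by
      rw [integral_sub hint (integrable_const _), Pi.sub_apply, moll_eq_integral_measure]
      simp [ν]
    rw [this]
    exact enorm_integral_le_lintegral_enorm _
  have hmx : ∀ᵐ x, AEMeasurable (fun t => ‖f (x - t) - f x‖ₑ) ν := by
    have h1 : AEStronglyMeasurable (fun q : Plane × Plane => f (q.1 - q.2)) (volume.prod ν) :=
      hf.1.comp_quasiMeasurePreserving (quasiMeasurePreserving_sub_of_right_invariant volume ν)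
    filter_upwards [(h1.sub hf.1.comp_fst).prodMk_left] with x hx
    exact hx.enorm
  have hpow : eLpNorm (moll n f - f) p ^ p.toReal ≤ ε ^ p.toReal := by
    rw [eLpNorm_eq_lintegral_rpow_enorm_toReal hp0 hp', ← ENNReal.rpow_mul,
      one_div_mul_cancel (by linarith), ENNReal.rpow_one]
    calc ∫⁻ x, ‖(moll n f - f) x‖ₑ ^ p.toReal
        ≤ ∫⁻ x, (∫⁻ t, ‖f (x - t) - f x‖ₑ ^ p.toReal ∂ν) := by
          refine lintegral_mono_ae ?_
          filter_upwards [hmx] with x hx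
          exact (ENNReal.rpow_le_rpow (hpt x) (by linarith)).trans
            (lintegral_pow_le_lintegral_pow hr hx)
      _ = ∫⁻ t, (∫⁻ x, ‖f (x - t) - f x‖ₑ ^ p.toReal) ∂ν := lintegral_lintegral_swap hmeas
      _ ≤ ∫⁻ _, ε ^ p.toReal ∂ν := by
          refine lintegral_mono_ae ?_
          filter_upwards [ae_molMeasure_norm_le n] with t ht
          have := hb (y := t) (by simpa using ht.trans_lt hn)
          rw [eLpNorm_eq_lintegral_rpow_enorm_toReal hp0 hp', one_div] at this
          exact (ENNReal.rpow_inv_le_iff (by linarith)).1 this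
      _ = ε ^ p.toReal := by simp
  exact (ENNReal.rpow_le_rpow_iff (by linarith)).1 hpow

/-! ### The chain rule for weak gradients -/

theorem integrable_moll (n : ℕ) {f : Plane → ℝ} (hf : Integrable f) : Integrable (moll n f) :=
  hf.integrable_convolution (ContinuousLinearMap.mul ℝ ℝ) (integrable_molKernel n)

theorem tendsto_integral_abs_moll_sub {f : Plane → ℝ} (hf : Integrable f) :
    Tendsto (fun n => ∫ x, |moll n f x - f x|) atTop (𝓝 0) := by
  have h := tendsto_eLpNorm_moll_sub le_rfl (by simp) (memLp_one_iff_integrable.2 hf)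
  have h2 := (ENNReal.tendsto_toReal (by simp)).comp h
  refine h2.congr fun n => ?_
  have := integral_norm_eq_lintegral_enorm ((integrable_moll n hf).sub hf).1
  simp only [Function.comp, eLpNorm_one_eq_lintegral_enorm]
  exact this.symm

/-- If `F_n` is bounded uniformly, with `F_n → F` almost everywhere, and `h_n → h` in `L¹`, then
`∫ F_n h_n → ∫ F h`. -/
theorem tendsto_integral_mul_of_tendsto_L1 {μ : Measure Plane} {F : ℕ → Plane → ℝ}
    {F' h' : Plane → ℝ} {h : ℕ → Plane → ℝ} {C : ℝ} (hF : ∀ n x, |F n x| ≤ C)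
    (hFm : ∀ n, AEStronglyMeasurable (F n) μ)
    (hlim : ∀ᵐ x ∂μ, Tendsto (fun n => F n x) atTop (𝓝 (F' x)))
    (hh : ∀ n, Integrable (h n) μ) (hh' : Integrable h' μ)
    (hL1 : Tendsto (fun n => ∫ x, |h n x - h' x| ∂μ) atTop (𝓝 0)) :
    Tendsto (fun n => ∫ x, F n x * h n x ∂μ) atTop (𝓝 (∫ x, F' x * h' x ∂μ)) := by
  have i1 : ∀ n, Integrable (fun x => F n x * (h n x - h' x)) μ := fun n =>
    ((hh n).sub hh').bdd_mul (c := C) (hFm n) (Eventually.of_forall (hF n))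
  have i2 : ∀ n, Integrable (fun x => F n x * h' x) μ := fun n =>
    hh'.bdd_mul (c := C) (hFm n) (Eventually.of_forall (hF n))
  have t1 : Tendsto (fun n => ∫ x, F n x * (h n x - h' x) ∂μ) atTop (𝓝 0) := by
    refine squeeze_zero_norm (a := fun n => C * ∫ x, |h n x - h' x| ∂μ) (fun n => ?_) ?_
    · rw [Real.norm_eq_abs, ← integral_const_mul]
      refine abs_integral_le_integral_abs.trans (integral_mono (i1 n).abs
        (((hh n).sub hh').abs.const_mul C) fun x => ?_)
      simp only [abs_mul]
      exact mul_le_mul_of_nonneg_right (hF n x) (abs_nonneg _)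
    · simpa using hL1.const_mul C
  have t2 : Tendsto (fun n => ∫ x, F n x * h' x ∂μ) atTop (𝓝 (∫ x, F' x * h' x ∂μ)) := by
    refine tendsto_integral_of_dominated_convergence (fun x => C * |h' x|)
      (fun n => (i2 n).1) (hh'.abs.const_mul C) (fun n => Eventually.of_forall fun x => ?_) ?_
    · rw [Real.norm_eq_abs, abs_mul]
      exact mul_le_mul_of_nonneg_right (hF n x) (abs_nonneg _)
    · filter_upwards [hlim] with x hx
      exact hx.mul_const _
  have := t1.add t2
  rw [zero_add] at this
  refine this.congr fun n => ?_
  rw [← integral_add (i1 n) (i2 n)]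
  congr 1; ext x; ring

/-- Integration by parts for a function that is differentiable on the whole plane. -/
theorem integral_mul_pd {Ω : Set Plane} {v φ : Plane → ℝ} (hv : ContDiff ℝ 1 v)
    (hφ : IsTestOn Ω φ) (i : Fin 2) : ∫ x, v x * pd i φ x = -∫ x, pd i v x * φ x := by
  have hpv : Continuous (pd i v) := (hv.continuous_fderiv (by simp)).clm_apply continuous_const
  have int : ∀ {a b : Plane → ℝ}, Continuous a → IsTestOn Ω b → Integrable fun x => a x * b x :=
    fun ha hb => integrable_mul_of_locallyIntegrable ha.locallyIntegrable hb.continuous hb.compact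
  exact integral_mul_fderiv_eq_neg_fderiv_mul_of_integrable (int hpv hφ)
    (int hv.continuous (hφ.pd i)) (int hv.continuous hφ)
    (fun x _ => hv.differentiable (by simp) x) fun x _ => hφ.differentiable x

theorem HasDerivAt.pd_comp {f : ℝ → ℝ} {f' : ℝ} {v : Plane → ℝ} {x : Plane}
    (hf : HasDerivAt f f' (v x)) (hv : DifferentiableAt ℝ v x) (i : Fin 2) :
    pd i (fun x => f (v x)) x = f' * pd i v x := by
  have h := (hf.comp_hasFDerivAt x hv.hasFDerivAt).fderiv
  simp only [pd]
  rw [show (fun x => f (v x)) = f ∘ v from rfl, h]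
  simp

/-- The chain rule for weak gradients. -/
theorem IsWeakGradient.comp_deriv {Ω : Set Plane} (hΩ : IsOpen Ω) {u : Plane → ℝ}
    {g : Plane → Plane} (hw : IsWeakGradient Ω u g) (hu : LocallyIntegrableOn u Ω)
    (hg : ∀ i, LocallyIntegrableOn (fun x => g x i) Ω) {f f' : ℝ → ℝ} {C : ℝ}
    (hf : ∀ t, HasDerivAt f (f' t) t) (hf' : Continuous f') (hC : ∀ t, |f' t| ≤ C) :
    IsWeakGradient Ω (fun x => f (u x)) (fun x => f' (u x) • g x) := by
  rw [isWeakGradient_iff]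
  intro φ hφ i
  have hK := hφ.compact.isCompact
  obtain ⟨δ, hδ, hδΩ⟩ := hK.exists_cthickening_subset_open hΩ hφ.subset
  set K := Metric.cthickening δ (tsupport φ) with hKd
  have hKc : IsCompact K := hK.cthickening
  have hKK : tsupport φ ⊆ K := Metric.self_subset_cthickening _
  set u' := K.indicator u with hu'
  set h' : Plane → ℝ := K.indicator (fun x => g x i) with hh'
  have iu : Integrable u' := (integrable_indicator_iff hKc.measurableSet).2
    (hu.integrableOn_compact_subset hδΩ hKc)
  have ih : Integrable h' := (integrable_indicator_iff hKc.measurableSet).2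
    ((hg i).integrableOn_compact_subset hδΩ hKc)
  have hcf : Continuous f := continuous_iff_continuousAt.2 fun t => (hf t).continuousAt
  have hf1 : ContDiff ℝ 1 f := by
    rw [contDiff_one_iff_deriv]
    refine ⟨fun t => (hf t).differentiableAt, ?_⟩
    rwa [show deriv f = f' from funext fun t => (hf t).deriv]
  have hLip : ∀ s t, |f s - f t| ≤ C * |s - t| := fun s t => by
    have := Convex.norm_image_sub_le_of_norm_hasDerivWithin_le (s := univ)
      (fun t _ => (hf t).hasDerivWithinAt) (fun t _ => hC t) convex_univ (mem_univ t) (mem_univ s)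
    simpa using this
  obtain ⟨D, hD⟩ := hφ.exists_bound
  obtain ⟨D', hD'⟩ := (hφ.pd i).exists_bound
  have hD0 : 0 ≤ D := (abs_nonneg _).trans (hD 0)
  have hD'0 : 0 ≤ D' := (abs_nonneg _).trans (hD' 0)
  have hC0 : 0 ≤ C := (abs_nonneg _).trans (hC 0)
  -- the identity for the mollified functions
  have key : ∀ᶠ n in atTop, ∫ x, f (moll n u' x) * pd i φ x =
      -∫ x, (f' (moll n u' x) * φ x) * moll n h' x := by
    filter_upwards [tendsto_molRadius.eventually (gt_mem_nhds hδ)] with n hn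
    have hs : ContDiff ℝ 1 (moll n u') :=
      (contDiff_moll n iu.locallyIntegrable).of_le (by exact_mod_cast le_top)
    rw [integral_mul_pd (v := fun x => f (moll n u' x)) (hf1.comp hs) hφ i]
    congr 2; ext x
    by_cases hx : x ∈ tsupport φ
    · have hb : Metric.closedBall x (molRadius n) ⊆ K :=
        (Metric.closedBall_subset_closedBall hn.le).trans
          (Metric.closedBall_subset_cthickening hx δ)
      have e1 : pd i (moll n u') x = moll n h' x :=
        pd_moll hw iu.locallyIntegrable (hb.trans hδΩ)
          (fun y hy => indicator_of_mem (hb hy) u)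
          (fun y hy => indicator_of_mem (hb hy) (fun x => g x i))
      have e2 := HasDerivAt.pd_comp (hf (moll n u' x)) (hs.differentiable (by simp) x) i
      rw [e2, e1]
      ring
    · rw [image_eq_zero_of_notMem_tsupport hx]; ring
  have t1 : Tendsto (fun n => ∫ x, f (moll n u' x) * pd i φ x) atTop
      (𝓝 (∫ x, f (u' x) * pd i φ x)) := by
    have hint : ∀ n, Integrable fun x => f (moll n u' x) * pd i φ x := fun n =>
      integrable_mul_of_locallyIntegrable (hcf.comp
        (contDiff_moll n iu.locallyIntegrable).continuous).locallyIntegrable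
        (hφ.pd i).continuous (hφ.pd i).compact
    have hint' : Integrable fun x => f (u' x) * pd i φ x := by
      have e1 : Integrable fun x => (f (u' x) - f 0) * pd i φ x := by
        have : Integrable fun x => f (u' x) - f 0 := by
          refine (iu.abs.const_mul C).mono
            ((hcf.comp_aestronglyMeasurable iu.1).sub aestronglyMeasurable_const)
            (Eventually.of_forall fun x => ?_)
          have := hLip (u' x) 0
          rw [sub_zero] at this
          simpa [abs_mul, abs_of_nonneg hC0] using this
        exact this.mul_bdd (c := D') (hφ.pd i).continuous.aestronglyMeasurable
          (Eventually.of_forall hD')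
      have e2 := ((hφ.pd i).integrable volume).const_mul (f 0)
      refine (e1.add e2).congr (Eventually.of_forall fun x => ?_)
      simp only [Pi.add_apply]; ring
    rw [tendsto_iff_norm_sub_tendsto_zero]
    refine squeeze_zero (g := fun n => C * D' * ∫ x, |moll n u' x - u' x|)
      (fun n => norm_nonneg _) (fun n => ?_)
      (by simpa using (tendsto_integral_abs_moll_sub iu).const_mul (C * D'))
    rw [← integral_sub (hint n) hint', Real.norm_eq_abs, ← integral_const_mul]
    refine abs_integral_le_integral_abs.trans (integral_mono ((hint n).sub hint').abs
      (((integrable_moll n iu).sub iu).abs.const_mul _) fun x => ?_)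
    simp only [← sub_mul, abs_mul]
    calc |f (moll n u' x) - f (u' x)| * |pd i φ x| ≤ C * |moll n u' x - u' x| * D' :=
          mul_le_mul (hLip _ _) (hD' x) (abs_nonneg _) (by positivity)
      _ = _ := by ring
  have t2 : Tendsto (fun n => ∫ x, (f' (moll n u' x) * φ x) * moll n h' x) atTop
      (𝓝 (∫ x, (f' (u' x) * φ x) * h' x)) := by
    have hb : ∀ s x, |f' s * φ x| ≤ C * D := fun s x => by
      rw [abs_mul]; exact mul_le_mul (hC _) (hD _) (abs_nonneg _) hC0
    refine tendsto_integral_mul_of_tendsto_L1 (C := C * D) (fun n x => hb _ _) (fun n => ?_)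
      ?_ (fun n => integrable_moll n ih) ih
      (tendsto_integral_abs_moll_sub ih)
    · exact ((hf'.comp (contDiff_moll n iu.locallyIntegrable).continuous).mul
        hφ.continuous).aestronglyMeasurable
    · filter_upwards [ae_tendsto_moll iu.locallyIntegrable] with x hx
      exact ((hf'.tendsto _).comp hx).mul_const _
  have hfin := tendsto_nhds_unique (t1.congr' key) t2.neg
  rw [setIntegral_eq_integral_of_forall_compl_eq_zero
      fun x hx => by rw [(hφ.pd i).eq_zero hx, mul_zero],
    setIntegral_eq_integral_of_forall_compl_eq_zero
      fun x hx => by rw [hφ.eq_zero hx, mul_zero]]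
  have hout : ∀ x, x ∉ K → φ x = 0 := fun x hx =>
    image_eq_zero_of_notMem_tsupport fun h => hx (hKK h)
  have hout' : ∀ x, x ∉ K → pd i φ x = 0 := fun x hx =>
    image_eq_zero_of_notMem_tsupport fun h => hx
      (hKK ((tsupport_fderiv_apply_subset ℝ _) h))
  calc ∫ x, f (u x) * pd i φ x = ∫ x, f (u' x) * pd i φ x := by
        congr 1; ext x
        by_cases hx : x ∈ K
        · rw [hu', indicator_of_mem hx]
        · rw [hout' x hx, mul_zero, mul_zero]
    _ = -∫ x, (f' (u' x) * φ x) * h' x := hfin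
    _ = -∫ x, (f' (u x) • g x) i * φ x := by
        congr 2; ext x
        by_cases hx : x ∈ K
        · rw [hu', hh', indicator_of_mem hx, indicator_of_mem hx]
          simp only [PiLp.smul_apply, smul_eq_mul]
          ring
        · rw [hout x hx]; ring

/-! ### Stream functions and their limits -/

theorem pd_eq_zero_of_notMem {φ : Plane → ℝ} {R : ℝ} (h0 : ∀ x, x ∉ closedBox 0 R → φ x = 0)
    (i : Fin 2) {x : Plane} (hx : x ∉ closedBox 0 R) : pd i φ x = 0 := by
  have h : tsupport φ ⊆ closedBox 0 R := closure_minimal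
    (fun y hy => by by_contra h; exact hy (h0 y h)) (isClosed_closedBox 0 R)
  exact image_eq_zero_of_notMem_tsupport fun h' =>
    hx (h ((tsupport_fderiv_apply_subset ℝ _) h'))

/-- A divergence free test field is the rotated gradient of a test function on the plane. -/
theorem exists_stream_function {Ω : Set Plane} {R : ℝ} (hR : Ω ⊆ closedBox 0 R)
    {Ψ₀ Ψ₁ : Plane → ℝ} (h₀ : IsTestOn Ω Ψ₀) (h₁ : IsTestOn Ω Ψ₁)
    (hdiv : ∀ x, pd 0 Ψ₀ x + pd 1 Ψ₁ x = 0) :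
    ∃ φ : Plane → ℝ, IsTestOn univ φ ∧ (∀ x, x ∉ closedBox 0 R → φ x = 0) ∧
      (∀ x, pd 0 φ x = -Ψ₁ x) ∧ ∀ x, pd 1 φ x = Ψ₀ x := by
  set φ : Plane → ℝ := fun x => -lineInt (Ioi 0) 0 Ψ₁ x with hφd
  have hs : ContDiff ℝ ∞ φ := (contDiff_lineInt h₁ _ _).neg
  have hΨ₁0 : ∀ x, x ∉ closedBox 0 R → Ψ₁ x = 0 := fun x hx => h₁.eq_zero fun h => hx (hR h)
  have hΨ₀0 : ∀ x, x ∉ closedBox 0 R → Ψ₀ x = 0 := fun x hx => h₀.eq_zero fun h => hx (hR h)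
  have hp0 : ∀ x, pd 0 φ x = -Ψ₁ x := fun x => by rw [hφd, pd_neg, pd_lineInt_Ioi h₁]
  have hp1 : ∀ x, pd 1 φ x = Ψ₀ x := fun x => by
    have e : pd 1 Ψ₁ = fun x => -pd 0 Ψ₀ x := by ext y; linarith [hdiv y]
    rw [hφd, pd_neg, pd_lineInt h₁, e, ← lineInt_Ioi_pd h₀ 0 x]
    simp only [lineInt]
    rw [integral_neg, neg_neg]
  -- the integrals of `Ψ₁` over the horizontal lines are constant, hence zero
  have hlc : ∀ x : Plane, lineInt univ 0 Ψ₁ x = 0 := by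
    intro x
    have hd : ∀ x, fderiv ℝ (lineInt univ 0 Ψ₁) x (EuclideanSpace.single 1 1) = 0 := fun x => by
      have e : pd 1 Ψ₁ = fun x => -pd 0 Ψ₀ x := by ext y; linarith [hdiv y]
      have e2 := pd_lineInt h₁ univ 0 1 x
      have e3 := lineInt_univ_pd h₀ 0 x
      rw [e] at e2
      simp only [lineInt] at e2 e3
      rw [integral_neg, e3, neg_zero] at e2
      exact e2
    have hdiff : Differentiable ℝ (lineInt univ 0 Ψ₁) :=
      (contDiff_lineInt h₁ univ 0).differentiable (by simp)
    have hder : ∀ s : ℝ, HasDerivAt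
        (fun s : ℝ => lineInt univ 0 Ψ₁ (x + s • EuclideanSpace.single 1 1)) 0 s := fun s => by
      have h1 : HasDerivAt (fun s : ℝ => x + s • (EuclideanSpace.single 1 1 : Plane))
          (EuclideanSpace.single 1 1 : Plane) s := by
        simpa using ((hasDerivAt_id s).smul_const (EuclideanSpace.single 1 1 : Plane)).const_add x
      have h2 := (hdiff (x + s • EuclideanSpace.single 1 1)).hasFDerivAt.comp_hasDerivAt s h1
      rw [hd] at h2
      exact h2
    have hconst := is_const_of_deriv_eq_zero (fun s => (hder s).differentiableAt)
      (fun s => (hder s).deriv) 0 (|x 1| + |R| + 1)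
    simp only [zero_smul, add_zero] at hconst
    rw [hconst]
    refine lineInt_eq_zero_of_ne hΨ₁0 univ (by decide : (1 : Fin 2) ≠ 0) ?_
    simp only [PiLp.add_apply, PiLp.smul_apply, PiLp.single_apply, smul_eq_mul, PiLp.zero_apply]
    simp only [if_true, mul_one, sub_zero]
    refine lt_of_lt_of_le ?_ (le_abs_self _)
    linarith [neg_abs_le (x 1), le_abs_self R]
  have hz : ∀ x, x ∉ closedBox 0 R → φ x = 0 := fun x hx => by
    simp only [hφd]
    rw [lineInt_Ioi_eq_zero_of_notMem hΨ₁0 0 hlc hx, neg_zero]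
  exact ⟨φ, IsTestOn.of_compact hs (isCompact_closedBox 0 R) (subset_univ _) hz, hz, hp0, hp1⟩

theorem fderiv_eq_zero_of_pd {φ : Plane → ℝ} {x : Plane} (h0 : pd 0 φ x = 0) (h1 : pd 1 φ x = 0) :
    fderiv ℝ φ x = 0 := by
  refine ContinuousLinearMap.ext fun v => ?_
  have hv : v = v 0 • (EuclideanSpace.single 0 1 : Plane) +
      v 1 • (EuclideanSpace.single 1 1 : Plane) := by
    ext i; fin_cases i <;> simp
  rw [pd] at h0 h1
  rw [hv, map_add, map_smul, map_smul, h0, h1]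
  simp

/-- A function whose gradient has compact support in `Ω` is constant on the connected subsets of the
complement of `Ω`. -/
theorem eq_of_isPreconnected {Ω K : Set Plane} {φ : Plane → ℝ} (hφ : Differentiable ℝ φ)
    (h0 : IsTestOn Ω (pd 0 φ)) (h1 : IsTestOn Ω (pd 1 φ)) (hK : IsPreconnected K)
    (hKΩ : K ⊆ Ωᶜ) {x y : Plane} (hx : x ∈ K) (hy : y ∈ K) : φ x = φ y := by
  set U : Set Plane := (tsupport (pd 0 φ) ∪ tsupport (pd 1 φ))ᶜ with hU
  have hUo : IsOpen U := ((isClosed_tsupport _).union (isClosed_tsupport _)).isOpen_compl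
  have hKU : K ⊆ U := hKΩ.trans (compl_subset_compl.2 (union_subset h0.subset h1.subset))
  have hd : EqOn (fderiv ℝ φ) 0 (connectedComponentIn U x) := fun z hz => by
    have hzU := connectedComponentIn_subset U x hz
    simp only [hU, mem_compl_iff, mem_union, not_or] at hzU
    exact fderiv_eq_zero_of_pd (image_eq_zero_of_notMem_tsupport hzU.1)
      (image_eq_zero_of_notMem_tsupport hzU.2)
  exact (hUo.connectedComponentIn).is_const_of_fderiv_eq_zero
    isPreconnected_connectedComponentIn hφ.differentiableOn hd
    (mem_connectedComponentIn (hKU hx)) (hK.subset_connectedComponentIn hx hKU hy)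

/-- Both orders of the two coordinates identify `ℝ × ℝ` with the plane and preserve the measure. -/
theorem measurePreserving_planeMk {i j : Fin 2} (hij : j ≠ i) :
    MeasurePreserving (fun z : ℝ × ℝ => z.1 • (EuclideanSpace.single i 1 : Plane) +
      z.2 • (EuclideanSpace.single j 1 : Plane)) := by
  have h1 : MeasurePreserving (fun z : ℝ × ℝ => (!₂[z.1, z.2] : Plane)) :=
    (PiLp.volume_preserving_toLp (Fin 2)).comp (volume_preserving_finTwoArrow ℝ).symm
  have hcases : (i = 0 ∧ j = 1) ∨ (i = 1 ∧ j = 0) := by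
    revert i j; decide
  rcases hcases with ⟨rfl, rfl⟩ | ⟨rfl, rfl⟩
  · convert h1 using 1
    ext z k; fin_cases k <;> simp
  · convert! h1.comp (Measure.measurePreserving_swap (μ := (volume : Measure ℝ))
      (ν := (volume : Measure ℝ))) using 1
    ext z k; fin_cases k <;> simp

/-- The value of a test function is controlled by the integral of its derivative along a line. -/
theorem abs_le_integral_line {ψ : Plane → ℝ} (hψ : IsTestOn univ ψ) (i : Fin 2) (x : Plane) :
    |ψ x| ≤ ∫ s : ℝ, |pd i ψ (x - s • EuclideanSpace.single i 1)| := by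
  rw [← lineInt_Ioi_pd hψ i x, lineInt]
  exact abs_integral_le_integral_abs.trans (setIntegral_le_integral
    (integrable_line (hψ.pd i) i x).abs (Eventually.of_forall fun s => abs_nonneg _))

/-- Functions whose gradients tend to zero in `L¹` tend to zero on almost all the lines parallel to
a coordinate axis, after extraction of a subsequence. -/
theorem exists_subseq_tendsto_lines {ψ : ℕ → Plane → ℝ} (hψ : ∀ n, IsTestOn univ (ψ n))
    {i j : Fin 2} (hij : j ≠ i) (hL : Tendsto (fun n => ∫ x, |pd i (ψ n) x|) atTop (𝓝 0)) :
    ∃ ns : ℕ → ℕ, StrictMono ns ∧ ∀ᵐ t : ℝ, ∀ x : Plane, x j = t →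
      Tendsto (fun k => ψ (ns k) x) atTop (𝓝 0) := by
  let T : ℝ × ℝ → Plane := fun z => z.1 • (EuclideanSpace.single i 1 : Plane) +
      z.2 • (EuclideanSpace.single j 1 : Plane)
  have hT : MeasurePreserving T volume volume := measurePreserving_planeMk hij
  let d : ℕ → ℝ → ℝ := fun n t => ∫ s : ℝ, |pd i (ψ n) (T (s, t))|
  have hpi : ∀ n, Integrable (fun z => |pd i (ψ n) (T z)|) ((volume : Measure ℝ).prod volume) :=
    fun n => hT.integrable_comp_of_integrable (((hψ n).pd i).integrable volume).abs
  have hdi : ∀ n, Integrable (d n) := fun n => (hpi n).integral_prod_right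
  have hd0 : ∀ n t, 0 ≤ d n t := fun n t => integral_nonneg fun s => abs_nonneg _
  have hdL : ∀ n, ∫ t, d n t = ∫ x, |pd i (ψ n) x| := fun n => by
    rw [← integral_prod_symm _ (hpi n), ← hT.map_eq, integral_map hT.measurable.aemeasurable
      ((((hψ n).pd i).continuous.abs).aestronglyMeasurable)]
    rfl
  have hm : TendstoInMeasure volume d atTop 0 := by
    refine tendstoInMeasure_of_tendsto_eLpNorm (p := 1) one_ne_zero (fun n => (hdi n).1)
      aestronglyMeasurable_zero ?_
    simp only [sub_zero, eLpNorm_one_eq_lintegral_enorm]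
    have e : ∀ n, ∫⁻ t, ‖d n t‖ₑ = ENNReal.ofReal (∫ x, |pd i (ψ n) x|) := fun n => by
      rw [← hdL, ofReal_integral_eq_lintegral_ofReal (hdi n) (Eventually.of_forall (hd0 n))]
      congr 1; ext t
      exact Real.enorm_eq_ofReal (hd0 n t)
    simp only [e]
    simpa using ENNReal.tendsto_ofReal hL
  obtain ⟨ns, hns, hae⟩ := hm.exists_seq_tendsto_ae
  refine ⟨ns, hns, ?_⟩
  filter_upwards [hae] with t ht x hx
  refine squeeze_zero_norm (fun k => ?_) ht
  rw [Real.norm_eq_abs]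
  refine (abs_le_integral_line (hψ (ns k)) i x).trans_eq ?_
  rw [← integral_sub_left_eq_self _ volume (x i)]
  simp only [d]
  congr 1; ext s
  congr 2
  ext k
  obtain rfl | rfl : k = i ∨ k = j := by omega
  · simp [T, hij.symm]
  · simp [T, hij, hx]

/-- A function vanishing outside a square is the integral of its derivative along segments. -/
theorem exists_measure_integral_pd (R : ℝ) : ∃ ν : Measure Plane, IsFiniteMeasure ν ∧
    ∀ φ, IsTestOn univ φ → (∀ x, x ∉ closedBox 0 R → φ x = 0) → ∀ x ∈ closedBox 0 R,
      φ x = ∫ t, pd 0 φ (x + t) ∂ν := by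
  have hfin : lineMeasure (Ioc 0 (2 * R)) 0 univ < ⊤ := by
    rw [lineMeasure, Measure.map_apply (continuous_smul_single 0).measurable MeasurableSet.univ]
    simpa using ENNReal.mul_lt_top (by simp) ENNReal.ofReal_lt_top
  have : IsFiniteMeasure (lineMeasure (Ioc 0 (2 * R)) 0) := ⟨hfin⟩
  refine ⟨(lineMeasure (Ioc 0 (2 * R)) 0).map (MeasurableEquiv.neg Plane), inferInstance,
    fun φ hφ h0 x hx => ?_⟩
  rw [integral_map_equiv, ← lineInt_Ioi_pd hφ 0 x,
    lineInt_Ioi_eq (c := 0) (fun y hy => pd_eq_zero_of_notMem h0 0 hy) 0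
      (by simpa using (abs_le.1 (hx 0)).2), lineInt_eq_conv _ _ (hφ.pd 0).continuous]
  simp [conv, sub_eq_add_neg]

/-- Test functions that vanish outside a fixed square and whose gradients converge in `L¹`
converge in `L¹`, and the limit has the limit of the gradients as its weak gradient. -/
theorem exists_L1_limit {R : ℝ} {φ : ℕ → Plane → ℝ} {G : Plane → Plane}
    (hφ : ∀ n, IsTestOn univ (φ n)) (hφ0 : ∀ n x, x ∉ closedBox 0 R → φ n x = 0)
    (hG : ∀ i, Integrable fun x => G x i)
    (hL : ∀ i, Tendsto (fun n => ∫ x, |pd i (φ n) x - G x i|) atTop (𝓝 0)) :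
    ∃ v : Plane → ℝ, Integrable v ∧ (∀ x, x ∉ closedBox 0 R → v x = 0) ∧
      IsWeakGradient univ v G := by
  obtain ⟨ν, hν, hrep⟩ := exists_measure_integral_pd R
  have hBm : MeasurableSet (closedBox 0 R) := (isClosed_closedBox 0 R).measurableSet
  set w : Plane → ℝ := fun x => ∫ t, G (x + t) 0 ∂ν with hw
  have iw : Integrable w := integrable_integral_translate (hG 0)
  have iv : Integrable ((closedBox 0 R).indicator w) := iw.indicator hBm
  have hconv : Tendsto (fun n => ∫ x, |φ n x - (closedBox 0 R).indicator w x|) atTop (𝓝 0) := by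
    refine squeeze_zero (fun n => integral_nonneg fun x => abs_nonneg _) (fun n => ?_)
      (by simpa using (hL 0).const_mul (ν.real univ))
    have ip : Integrable (pd 0 (φ n)) := ((hφ n).pd 0).integrable volume
    refine le_trans ?_ (integral_abs_integral_translate_le (ν := ν) (ip.sub (hG 0)))
    refine integral_mono_ae (((hφ n).integrable volume).sub iv).abs
      (integrable_integral_translate (ip.sub (hG 0))).abs ?_
    filter_upwards [(integrable_translate_prod (ν := ν) (hG 0)).swap.prod_right_ae]
      with x hx
    by_cases hxB : x ∈ closedBox 0 R
    · rw [indicator_of_mem hxB, hrep (φ n) (hφ n) (hφ0 n) x hxB, hw]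
      simp only
      rw [integral_sub]
      · obtain ⟨C, hC⟩ := ((hφ n).pd 0).exists_bound
        have := ((hφ n).pd 0).continuous
        exact Integrable.of_bound (C := C) (by fun_prop) (Eventually.of_forall fun t => hC _)
      · exact hx
    · rw [indicator_of_notMem hxB, hφ0 n x hxB]
      simp
  refine ⟨_, iv, fun x hx => indicator_of_notMem hx _, ?_⟩
  rw [isWeakGradient_iff]
  intro χ hχ i
  have hlim : ∀ {a : ℕ → Plane → ℝ} {b χ : Plane → ℝ}, (∀ n, Integrable (a n)) → Integrable b →
      IsTestOn univ χ → Tendsto (fun n => ∫ x, |a n x - b x|) atTop (𝓝 0) →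
      Tendsto (fun n => ∫ x, a n x * χ x) atTop (𝓝 (∫ x, b x * χ x)) := by
    intro a b χ ha hb hχ hab
    obtain ⟨C, hC⟩ := hχ.exists_bound
    have := tendsto_integral_mul_of_tendsto_L1 (μ := volume) (F := fun _ => χ) (F' := χ)
      (C := C) (fun _ => hC) (fun _ => hχ.continuous.aestronglyMeasurable)
      (Eventually.of_forall fun x => tendsto_const_nhds) ha hb hab
    simpa only [mul_comm] using this
  have t1 := hlim (fun n => (hφ n).integrable volume) iv (hχ.pd i) hconv
  have t2 := hlim (fun n => ((hφ n).pd i).integrable volume) (hG i) hχ (hL i)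
  have e : ∀ n, ∫ x, φ n x * pd i χ x = -∫ x, pd i (φ n) x * χ x := fun n =>
    integral_mul_pd ((hφ n).smooth.of_le (by exact_mod_cast le_top)) hχ i
  simp only [e] at t1
  simpa using tendsto_nhds_unique t1 t2.neg

/-! ### Morrey's inequality -/

/-- The quantity `|∂_0 h| + |∂_1 h|`, which controls the length of the gradient of `h`. -/
def gradSum (h : Plane → ℝ) (x : Plane) : ℝ := |pd 0 h x| + |pd 1 h x|

theorem gradSum_nonneg (h : Plane → ℝ) (x : Plane) : 0 ≤ gradSum h x :=
  add_nonneg (abs_nonneg _) (abs_nonneg _)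

theorem abs_fderiv_apply_le (h : Plane → ℝ) (x v : Plane) :
    |fderiv ℝ h x v| ≤ gradSum h x * ‖v‖ := by
  have hv : v = v 0 • (EuclideanSpace.single 0 1 : Plane) +
      v 1 • (EuclideanSpace.single 1 1 : Plane) := by
    ext i; fin_cases i <;> simp
  have h0 : |v 0| ≤ ‖v‖ := PiLp.norm_apply_le v 0
  have h1 : |v 1| ≤ ‖v‖ := PiLp.norm_apply_le v 1
  have e : fderiv ℝ h x v = v 0 * pd 0 h x + v 1 * pd 1 h x := by
    conv_lhs => rw [hv]
    rw [map_add, map_smul, map_smul]; rfl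
  rw [e, gradSum, add_mul]
  refine (abs_add_le _ _).trans (add_le_add ?_ ?_)
  · rw [abs_mul, mul_comm]
    exact mul_le_mul_of_nonneg_left h0 (abs_nonneg _)
  · rw [abs_mul, mul_comm]
    exact mul_le_mul_of_nonneg_left h1 (abs_nonneg _)

theorem continuous_pd {h : Plane → ℝ} (hh : ContDiff ℝ 1 h) (i : Fin 2) : Continuous (pd i h) :=
  (hh.continuous_fderiv (by simp)).clm_apply continuous_const

theorem continuous_gradSum {h : Plane → ℝ} (hh : ContDiff ℝ 1 h) : Continuous (gradSum h) :=
  (continuous_pd hh 0).abs.add (continuous_pd hh 1).abs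

/-- The change of variables for the homothety of ratio `t` with centre `x`. -/
theorem lintegral_homothety (x : Plane) {t : ℝ} (ht : 0 < t) {F : Plane → ℝ≥0∞}
    (hF : Measurable F) :
    ∫⁻ w, F (x + t • (w - x)) = ENNReal.ofReal ((t ^ 2)⁻¹) * ∫⁻ w, F w := by
  have e : ∀ w : Plane, x + t • (w - x) = t • w + (x - t • x) := fun w => by
    rw [smul_sub]; abel
  have h1 : ∫⁻ w, F (t • w + (x - t • x)) =
      ∫⁻ w, F (w + (x - t • x)) ∂(Measure.map (t • ·) volume) :=
    (lintegral_map (f := fun w : Plane => F (w + (x - t • x)))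
      (hF.comp (measurable_id.add_const _)) (measurable_const_smul t)).symm
  simp only [e]
  rw [h1, Measure.map_addHaar_smul _ ht.ne', lintegral_smul_measure,
    lintegral_add_right_eq_self (fun w => F w)]
  simp [abs_of_pos ht]

/-- The mean value form of the fundamental theorem of calculus along a segment. -/
theorem enorm_sub_le_lintegral_segment {h : Plane → ℝ} (hh : ContDiff ℝ 1 h) {x w : Plane}
    {d : ℝ} (hd : ‖w - x‖ ≤ d) :
    ‖h w - h x‖ₑ ≤ ENNReal.ofReal d *
      ∫⁻ t in Ioc (0 : ℝ) 1, ENNReal.ofReal (gradSum h (x + t • (w - x))) := by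
  have hder : ∀ t : ℝ, HasDerivAt (fun t : ℝ => h (x + t • (w - x)))
      (fderiv ℝ h (x + t • (w - x)) (w - x)) t := fun t => by
    have h1 : HasDerivAt (fun t : ℝ => x + t • (w - x)) (w - x) t := by
      simpa using ((hasDerivAt_id t).smul_const (w - x)).const_add x
    exact ((hh.differentiable (by simp)) _).hasFDerivAt.comp_hasDerivAt t h1
  have hcont : Continuous fun t : ℝ => fderiv ℝ h (x + t • (w - x)) (w - x) := by
    have := hh.continuous_fderiv (by simp)
    fun_prop
  have ftc := intervalIntegral.integral_eq_sub_of_hasDerivAt (a := 0) (b := 1)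
    (fun t _ => hder t) (hcont.intervalIntegrable 0 1)
  simp only [one_smul, add_sub_cancel, zero_smul, add_zero] at ftc
  rw [← ftc, intervalIntegral.integral_of_le zero_le_one]
  refine (enorm_integral_le_lintegral_enorm _).trans ?_
  have hg : Continuous fun t : ℝ => gradSum h (x + t • (w - x)) :=
    (continuous_gradSum hh).comp (by fun_prop)
  rw [← lintegral_const_mul _ hg.measurable.ennreal_ofReal]
  refine lintegral_mono fun t => ?_
  rw [← ENNReal.ofReal_mul ((norm_nonneg _).trans hd), Real.enorm_eq_ofReal_abs]
  refine ENNReal.ofReal_le_ofReal ((abs_fderiv_apply_le _ _ _).trans ?_)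
  rw [mul_comm]
  exact mul_le_mul_of_nonneg_right hd (gradSum_nonneg h _)

theorem lintegral_rpow_neg_lt_top {q : ℝ} (hq : 2 < q) :
    ∫⁻ t in Ioc (0 : ℝ) 1, ENNReal.ofReal ((t ^ 2)⁻¹) ^ (1 / q) < ⊤ := by
  have hlt : -1 < -(2 / q) := by
    have : 2 / q < 1 := by rw [div_lt_one (by linarith)]; exact hq
    linarith
  have hi : IntegrableOn (fun t : ℝ => t ^ (-(2 / q))) (Ioc 0 1) :=
    (intervalIntegrable_iff_integrableOn_Ioc_of_le zero_le_one).1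
      (intervalIntegral.intervalIntegrable_rpow' hlt)
  refine lt_of_le_of_lt (le_of_eq ?_) hi.2
  refine setLIntegral_congr_fun measurableSet_Ioc fun t ht => ?_
  have ht0 : 0 < t := ht.1
  rw [ENNReal.ofReal_rpow_of_nonneg (by positivity) (by positivity),
    Real.enorm_eq_ofReal (by positivity)]
  congr 1
  rw [← Real.rpow_natCast, ← Real.rpow_neg ht0.le, ← Real.rpow_mul ht0.le]
  congr 1
  push_cast; ring

/-- Morrey's inequality on a ball: for `q > 2` the oscillation of `h` is controlled by the `L^q`
norm of its gradient on the same ball. That the norm is taken on the ball itself is essential for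
summing over disjoint balls. The increments `h w - h x` are averaged over `w` in the ball;
shrinking the ball towards `x` by the factor `t` costs `t ^ (-2 / q)`, which is integrable on `(0,
1]`. -/
theorem exists_morrey {q : ℝ} (hq : 2 < q) : ∃ C : ℝ≥0∞, C ≠ ⊤ ∧ ∀ (h : Plane → ℝ),
    ContDiff ℝ 1 h → ∀ (z : Plane) (r : ℝ), 0 < r → ∀ x ∈ Metric.ball z r, ∀ y ∈ Metric.ball z r,
      ‖h x - h y‖ₑ ≤ C * ENNReal.ofReal r ^ (1 - 2 / q) *
        eLpNorm (gradSum h) (ENNReal.ofReal q) (volume.restrict (Metric.ball z r)) := by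
  have hq0 : 0 < q := by linarith
  set L := ∫⁻ t in Ioc (0 : ℝ) 1, ENNReal.ofReal ((t ^ 2)⁻¹) ^ (1 / q) with hL
  have hLt : L < ⊤ := lintegral_rpow_neg_lt_top hq
  set κ := volume (Metric.ball (0 : Plane) 1) with hκ
  have hκ0 : κ ≠ 0 := (Metric.measure_ball_pos _ _ one_pos).ne'
  have hκt : κ ≠ ⊤ := measure_ball_lt_top.ne
  refine ⟨2 * (2 * L) * κ ^ (-(1 / q)), ?_, fun h hh z r hr x hx y hy => ?_⟩
  · exact ENNReal.mul_ne_top (ENNReal.mul_ne_top (by simp) (ENNReal.mul_ne_top (by simp) hLt.ne))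
      (ENNReal.rpow_ne_top_of_ne_zero hκ0 hκt)
  set B := Metric.ball z r with hB
  set β := volume B with hβ
  set ρ := ENNReal.ofReal r with hρ
  have hρ0 : ρ ≠ 0 := by simpa [hρ] using hr
  have hρt : ρ ≠ ⊤ := ENNReal.ofReal_ne_top
  have hβe : β = ρ ^ (2 : ℝ) * κ := by
    rw [hβ, hB, Measure.addHaar_ball _ _ hr.le, hρ, ENNReal.ofReal_rpow_of_pos hr]
    simp [hκ]
  have hβ0 : β ≠ 0 := (Metric.measure_ball_pos _ _ hr).ne'
  have hβt : β ≠ ⊤ := measure_ball_lt_top.ne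
  let D : Plane → ℝ≥0∞ := fun x => ENNReal.ofReal (gradSum h x)
  have hDm : Measurable D := (continuous_gradSum hh).measurable.ennreal_ofReal
  set N := eLpNorm (gradSum h) (ENNReal.ofReal q) (volume.restrict B) with hN
  have hNe : N = (∫⁻ w in B, D w ^ q) ^ (1 / q) := by
    rw [hN, eLpNorm_eq_lintegral_rpow_enorm_toReal (by simpa using hq0) (by simp),
      ENNReal.toReal_ofReal hq0.le]
    congr 1
    refine lintegral_congr fun w => ?_
    rw [Real.enorm_eq_ofReal (gradSum_nonneg h w)]
  -- the average of the increments from a point of the ball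
  have key : ∀ x ∈ B, ∫⁻ w in B, ‖h w - h x‖ₑ ≤ 2 * ρ * (L * (N * β ^ (1 - 1 / q))) := by
    intro x hx
    have hinner : ∀ t ∈ Ioc (0 : ℝ) 1, ∫⁻ w in B, D (x + t • (w - x)) ≤
        ENNReal.ofReal ((t ^ 2)⁻¹) ^ (1 / q) * (N * β ^ (1 - 1 / q)) := by
      intro t ht
      have hm : Measurable fun w => D (x + t • (w - x)) := hDm.comp (by fun_prop)
      have h1 : ∫⁻ w in B, D (x + t • (w - x)) ≤
          (∫⁻ w in B, D (x + t • (w - x)) ^ q) ^ (1 / q) * β ^ (1 - 1 / q) := by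
        have := eLpNorm'_le_eLpNorm'_mul_rpow_measure_univ (f := fun w => D (x + t • (w - x)))
          one_pos (by linarith : (1 : ℝ) ≤ q) (μ := volume.restrict B) hm.aestronglyMeasurable
        simpa [eLpNorm', hβ] using this
      have h2 : ∫⁻ w in B, D (x + t • (w - x)) ^ q ≤
          ENNReal.ofReal ((t ^ 2)⁻¹) * ∫⁻ w in B, D w ^ q := by
        have hBm : MeasurableSet B := measurableSet_ball
        rw [← lintegral_indicator hBm, ← lintegral_indicator hBm, ← lintegral_homothety x ht.1
          ((hDm.pow_const q).indicator hBm)]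
        refine lintegral_mono fun w => ?_
        by_cases hw : w ∈ B
        · have hw' : x + t • (w - x) ∈ B :=
            (convex_ball z r).add_smul_sub_mem hx hw ⟨ht.1.le, ht.2⟩
          rw [indicator_of_mem hw, indicator_of_mem hw']
        · rw [indicator_of_notMem hw]; exact zero_le
      refine h1.trans ?_
      rw [hNe, ← mul_assoc, ← ENNReal.mul_rpow_of_nonneg _ _ (by positivity)]
      gcongr
    calc ∫⁻ w in B, ‖h w - h x‖ₑ
        ≤ ∫⁻ w in B, 2 * ρ * (∫⁻ t in Ioc (0 : ℝ) 1, D (x + t • (w - x))) := by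
          refine setLIntegral_mono' measurableSet_ball fun w hw => ?_
          have hd : ‖w - x‖ ≤ 2 * r := by
            rw [← dist_eq_norm]
            have := dist_triangle_right w x z
            rw [hB, Metric.mem_ball] at hw hx
            linarith
          refine (enorm_sub_le_lintegral_segment hh hd).trans_eq ?_
          rw [ENNReal.ofReal_mul (by norm_num)]
          simp [hρ, D]
      _ = 2 * ρ * ∫⁻ w in B, (∫⁻ t in Ioc (0 : ℝ) 1, D (x + t • (w - x))) := by
          rw [lintegral_const_mul' _ _ (ENNReal.mul_ne_top (by simp) hρt)]
      _ = 2 * ρ * ∫⁻ t in Ioc (0 : ℝ) 1, (∫⁻ w in B, D (x + t • (w - x))) := by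
          rw [lintegral_lintegral_swap]
          exact (hDm.comp (by fun_prop)).aemeasurable
      _ ≤ 2 * ρ * ∫⁻ t in Ioc (0 : ℝ) 1,
            ENNReal.ofReal ((t ^ 2)⁻¹) ^ (1 / q) * (N * β ^ (1 - 1 / q)) := by
          gcongr 2 * ρ * ?_
          exact setLIntegral_mono' measurableSet_Ioc hinner
      _ = _ := by
          rw [lintegral_mul_const]
          exact ((((measurable_id.pow_const 2).inv).ennreal_ofReal).pow_const _)
  have hsum : β * ‖h x - h y‖ₑ ≤ 2 * (2 * ρ * (L * (N * β ^ (1 - 1 / q)))) := by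
    calc β * ‖h x - h y‖ₑ = ∫⁻ _ in B, ‖h x - h y‖ₑ := by
          rw [setLIntegral_const, mul_comm]
      _ ≤ ∫⁻ w in B, (‖h w - h x‖ₑ + ‖h w - h y‖ₑ) := by
          refine lintegral_mono fun w => ?_
          have : h x - h y = (h w - h y) - (h w - h x) := by ring
          rw [this, add_comm]
          exact enorm_sub_le
      _ = (∫⁻ w in B, ‖h w - h x‖ₑ) + ∫⁻ w in B, ‖h w - h y‖ₑ :=
          lintegral_add_left (by have := hh.continuous; fun_prop) _
      _ ≤ _ := by
          rw [two_mul]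
          exact add_le_add (key x hx) (key y hy)
  have hfin : ‖h x - h y‖ₑ ≤ β⁻¹ * (2 * (2 * ρ * (L * (N * β ^ (1 - 1 / q))))) := by
    rw [mul_comm, ← div_eq_mul_inv, ENNReal.le_div_iff_mul_le (Or.inl hβ0) (Or.inl hβt), mul_comm]
    exact hsum
  refine hfin.trans_eq ?_
  have e1 : β⁻¹ * β ^ (1 - 1 / q) = β ^ (-(1 / q)) := by
    rw [← ENNReal.rpow_neg_one, ← ENNReal.rpow_add _ _ hβ0 hβt]; congr 1; ring
  have e2 : ρ * (ρ ^ (2 : ℝ)) ^ (-(1 / q)) = ρ ^ (1 - 2 / q) := by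
    rw [← ENNReal.rpow_mul]
    nth_rewrite 1 [← ENNReal.rpow_one ρ]
    rw [← ENNReal.rpow_add _ _ hρ0 hρt]; congr 1; ring
  calc β⁻¹ * (2 * (2 * ρ * (L * (N * β ^ (1 - 1 / q)))))
      = 2 * (2 * L) * ρ * (β⁻¹ * β ^ (1 - 1 / q)) * N := by ring
    _ = 2 * (2 * L) * κ ^ (-(1 / q)) * (ρ * (ρ ^ (2 : ℝ)) ^ (-(1 / q))) * N := by
        rw [e1, hβe, ENNReal.mul_rpow_of_ne_top (by simp [hρt]) hκt]; ring
    _ = _ := by rw [e2]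

/-! ### Images of sets of zero Hausdorff measure -/

/-- Hölder's inequality for infinite sums in `[0, ∞]`. -/
theorem ENNReal.tsum_mul_le_Lp_mul_Lq {ι : Type*} {p q : ℝ} (hpq : p.HolderConjugate q)
    (f g : ι → ℝ≥0∞) :
    ∑' i, f i * g i ≤ (∑' i, f i ^ p) ^ (1 / p) * (∑' i, g i ^ q) ^ (1 / q) := by
  rw [ENNReal.tsum_eq_iSup_sum]
  refine iSup_le fun s => (ENNReal.inner_le_Lp_mul_Lq s f g hpq).trans ?_
  have hp := hpq.pos
  have hq := hpq.symm.pos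
  gcongr <;> exact ENNReal.sum_le_tsum s

open Measure in
/-- A set of zero `s`-dimensional Hausdorff measure is covered by sets whose diameters are at most
the members of a sequence of positive numbers with small sum of `s`-th powers. -/
theorem exists_cover_of_hausdorffMeasure_zero {s : ℝ} (hs : 0 < s) {E : Set Plane}
    (hE : μH[s] E = 0) {δ : ℝ≥0∞} (hδ : δ ≠ 0) :
    ∃ (t : ℕ → Set Plane) (ρ : ℕ → ℝ), E ⊆ ⋃ n, t n ∧ (∀ n, 0 < ρ n) ∧
      (∀ n, ∀ x ∈ t n, ∀ y ∈ t n, dist x y ≤ ρ n) ∧ ∑' n, ENNReal.ofReal (ρ n) ^ s ≤ δ := by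
  obtain ⟨ε, hε, hεδ⟩ := ENNReal.exists_pos_sum_of_countable (ENNReal.half_pos hδ).ne' ℕ
  rw [hausdorffMeasure_apply] at hE
  have h1 : (⨅ (t : ℕ → Set Plane) (_ : E ⊆ ⋃ n, t n)
      (_ : ∀ n, Metric.ediam (t n) ≤ 1),
        ∑' n, ⨆ _ : (t n).Nonempty, Metric.ediam (t n) ^ s) = 0 :=
    le_antisymm ((le_iSup₂_of_le (1 : ℝ≥0∞) one_pos le_rfl).trans hE.le) zero_le
  have h2 := h1.trans_lt (ENNReal.half_pos hδ)
  simp only [iInf_lt_iff] at h2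
  obtain ⟨t, ht, hd, hsum⟩ := h2
  have hsup : ∀ n, (⨆ _ : (t n).Nonempty, Metric.ediam (t n) ^ s) = Metric.ediam (t n) ^ s := by
    intro n
    rcases (t n).eq_empty_or_nonempty with h | h
    · simp [h, hs]
    · simp [h]
  simp only [hsup] at hsum
  let σ : ℕ → ℝ≥0∞ := fun n => (Metric.ediam (t n) ^ s + ε n) ^ (1 / s)
  have hdt : ∀ n, Metric.ediam (t n) ^ s ≠ ⊤ := fun n =>
    ENNReal.rpow_ne_top_of_nonneg hs.le ((hd n).trans_lt ENNReal.one_lt_top).ne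
  have hσt : ∀ n, σ n ≠ ⊤ := fun n =>
    ENNReal.rpow_ne_top_of_nonneg (by positivity) (ENNReal.add_ne_top.2 ⟨hdt n, by simp⟩)
  have hσ0 : ∀ n, σ n ≠ 0 := fun n => by
    have : Metric.ediam (t n) ^ s + ε n ≠ 0 := by simp [(hε n).ne']
    exact (ENNReal.rpow_pos (pos_iff_ne_zero.2 this) (ENNReal.add_ne_top.2 ⟨hdt n, by simp⟩)).ne'
  have hσs : ∀ n, σ n ^ s = Metric.ediam (t n) ^ s + ε n := fun n => by
    simp only [σ]
    rw [← ENNReal.rpow_mul, one_div_mul_cancel hs.ne', ENNReal.rpow_one]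
  refine ⟨t, fun n => (σ n).toReal, ht, fun n => ENNReal.toReal_pos (hσ0 n) (hσt n),
    fun n x hx y hy => ?_, ?_⟩
  · have : edist x y ≤ σ n := by
      refine (Metric.edist_le_ediam_of_mem hx hy).trans ?_
      rw [← ENNReal.rpow_le_rpow_iff hs, hσs]
      exact le_self_add
    rw [edist_dist] at this
    exact (ENNReal.ofReal_le_iff_le_toReal (hσt n)).1 this
  · simp only [ENNReal.ofReal_toReal (hσt _), hσs]
    rw [ENNReal.tsum_add]
    exact (add_le_add hsum.le hεδ.le).trans (ENNReal.add_halves δ).le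

/-- A function whose oscillation on balls is controlled, in the manner of Morrey's inequality, by
the `L^q` norm of a gradient maps the sets of zero `(2-p)`-dimensional Hausdorff measure, where
`p` is the exponent conjugate to `q`, to null sets. Besicovitch's theorem turns a cover into
boundedly many families of disjoint balls, on each of which Hölder's inequality applies. -/
theorem volume_image_eq_zero_of_morrey {p q : ℝ} (hpq : p.HolderConjugate q) (hp2 : p < 2)
    {V : Plane → ℝ} {F : Plane → ℝ≥0∞} {C : ℝ≥0∞} (hC : C ≠ ⊤)
    (hF : ∫⁻ x, F x ^ q ≠ ⊤)
    (hV : ∀ (z : Plane) (r : ℝ), 0 < r → ∀ x ∈ Metric.ball z r, ∀ y ∈ Metric.ball z r,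
      ‖V x - V y‖ₑ ≤ C * ENNReal.ofReal r ^ (1 - 2 / q) *
        (∫⁻ x in Metric.ball z r, F x ^ q) ^ (1 / q))
    {E : Set Plane} (hE : Measure.hausdorffMeasure (2 - p) E = 0) : volume (V '' E) = 0 := by
  have hp := hpq.pos
  have hq := hpq.symm.pos
  have hs : 0 < 2 - p := by linarith
  obtain ⟨N, τ, hτ, hN⟩ := HasBesicovitchCovering.no_satelliteConfig (α := Plane)
  set A := (∫⁻ x, F x ^ q) ^ (1 / q) with hA
  have hAt : A ≠ ⊤ := ENNReal.rpow_ne_top_of_nonneg (by positivity) hF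
  -- the bound obtained from a cover with sum of powers at most `δ`
  have main : ∀ δ : ℝ≥0∞, δ ≠ 0 → δ ≤ 1 →
      volume (V '' E) ≤ N * (2 * C * A) * δ ^ (1 / p) := by
    intro δ hδ hδ1
    obtain ⟨t, ρ, hEt, hρ, hdiam, hsum⟩ := exists_cover_of_hausdorffMeasure_zero hs hE hδ
    have hmem : ∀ x : E, ∃ n, (x : Plane) ∈ t n := fun x => mem_iUnion.1 (hEt x.2)
    choose n hn using hmem
    let Q : Besicovitch.BallPackage E Plane :=
      { c := fun x => x
        r := fun x => ρ (n x)
        rpos := fun x => hρ _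
        r_bound := 1
        r_le := fun x => by
          have h1 : ENNReal.ofReal (ρ (n x)) ^ (2 - p) ≤ 1 :=
            (ENNReal.le_tsum (n x)).trans (hsum.trans hδ1)
          rw [← ENNReal.one_rpow (2 - p), ENNReal.rpow_le_rpow_iff hs, ENNReal.ofReal_le_one] at h1
          exact h1 }
    obtain ⟨S, hdisj, hcov⟩ := Besicovitch.exist_disjoint_covering_families hτ hN Q
    have hQr : ∀ x, 0 < Q.r x := Q.rpos
    -- Two disjoint balls of the package come from different members of the cover: a set `t m` lies
    -- in the closed ball of radius `ρ m` about each of its points.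
    have hinj : ∀ i, InjOn n (S i) := by
      intro i x hx y hy hxy
      by_contra hne
      have h1 : Disjoint (Metric.closedBall (Q.c x) (Q.r x)) (Metric.closedBall (Q.c y) (Q.r y)) :=
        hdisj i hx hy hne
      refine Set.disjoint_left.1 h1 (?_ : Q.c y ∈ _) ?_
      · rw [Metric.mem_closedBall]
        exact hdiam (n x) _ (by rw [hxy]; exact hn y) _ (hn x)
      · exact Metric.mem_closedBall_self (hQr y).le
    have hcount : ∀ i, (S i).Countable := fun i =>
      Set.MapsTo.countable_of_injOn (mapsTo_univ n (S i)) (hinj i) (to_countable _)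
    have hfam : ∀ i, ∑' j : S i, volume (V '' Metric.ball (Q.c j) (Q.r j)) ≤
        2 * C * A * δ ^ (1 / p) := by
      intro i
      have hball : ∀ j : S i, volume (V '' Metric.ball (Q.c j) (Q.r j)) ≤
          2 * C * (ENNReal.ofReal (Q.r j) ^ (1 - 2 / q) *
            (∫⁻ x in Metric.ball (Q.c j) (Q.r j), F x ^ q) ^ (1 / q)) := by
        intro j
        set d := C * ENNReal.ofReal (Q.r j) ^ (1 - 2 / q) *
            (∫⁻ x in Metric.ball (Q.c j) (Q.r j), F x ^ q) ^ (1 / q) with hd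
        calc volume (V '' Metric.ball (Q.c j) (Q.r j))
            ≤ volume (Metric.closedEBall (V (Q.c j)) d) := by
              refine measure_mono ?_
              rintro _ ⟨x, hx, rfl⟩
              rw [Metric.mem_closedEBall, edist_eq_enorm_sub]
              exact hV _ _ (hQr j) x hx _ (Metric.mem_ball_self (hQr j))
          _ = 2 * d := Real.volume_closedEBall _ _
          _ = _ := by rw [hd]; ring
      have : Countable (S i) := (hcount i).to_subtype
      -- the exponents match: `(1 - 2 / q) * p = 2 - p`
      have e1 : ∀ j : S i, (ENNReal.ofReal (Q.r j) ^ (1 - 2 / q)) ^ p =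
          ENNReal.ofReal (ρ (n j)) ^ (2 - p) := fun j => by
        rw [← ENNReal.rpow_mul]
        congr 1
        have h3 := hpq.inv_add_inv_eq_one
        have h4 : q⁻¹ = 1 - p⁻¹ := by linarith
        rw [div_eq_mul_inv, h4]
        field_simp
        ring
      have e2 : ∀ j : S i, ((∫⁻ x in Metric.ball (Q.c j) (Q.r j), F x ^ q) ^ (1 / q)) ^ q =
          ∫⁻ x in Metric.ball (Q.c j) (Q.r j), F x ^ q := fun j => by
        rw [← ENNReal.rpow_mul, one_div_mul_cancel hq.ne', ENNReal.rpow_one]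
      calc ∑' j : S i, volume (V '' Metric.ball (Q.c j) (Q.r j))
          ≤ ∑' j : S i, 2 * C * (ENNReal.ofReal (Q.r j) ^ (1 - 2 / q) *
            (∫⁻ x in Metric.ball (Q.c j) (Q.r j), F x ^ q) ^ (1 / q)) :=
            ENNReal.tsum_le_tsum hball
        _ = 2 * C * ∑' j : S i, (ENNReal.ofReal (Q.r j) ^ (1 - 2 / q) *
            (∫⁻ x in Metric.ball (Q.c j) (Q.r j), F x ^ q) ^ (1 / q)) := ENNReal.tsum_mul_left
        _ ≤ 2 * C * (δ ^ (1 / p) * A) := by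
            gcongr 2 * C * ?_
            refine (ENNReal.tsum_mul_le_Lp_mul_Lq hpq _ _).trans ?_
            simp only [e1, e2]
            have b1 : ∑' j : S i, ENNReal.ofReal (ρ (n j)) ^ (2 - p) ≤ δ :=
              (ENNReal.tsum_comp_le_tsum_of_injective
                (f := fun j : S i => n j) (fun x y h => Subtype.ext (hinj i x.2 y.2 h))
                (fun k => ENNReal.ofReal (ρ k) ^ (2 - p))).trans hsum
            have b2 : ∑' j : S i, ∫⁻ x in Metric.ball (Q.c j) (Q.r j), F x ^ q ≤
                ∫⁻ x, F x ^ q := by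
              rw [← lintegral_iUnion (fun j => measurableSet_ball) fun x y hxy => ?_]
              · exact setLIntegral_le_lintegral _ _
              · refine (hdisj i x.2 y.2 fun h => hxy (Subtype.ext h)).mono
                  Metric.ball_subset_closedBall Metric.ball_subset_closedBall
            rw [hA]
            gcongr
        _ = _ := by ring
    calc volume (V '' E) ≤ volume (⋃ i : Fin N, ⋃ j : S i, V '' Metric.ball (Q.c j) (Q.r j)) := by
          refine measure_mono ?_
          rintro _ ⟨x, hx, rfl⟩
          have := hcov ⟨⟨x, hx⟩, rfl⟩
          simp only [mem_iUnion] at this ⊢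
          obtain ⟨i, j, hj, hxj⟩ := this
          exact ⟨i, ⟨j, hj⟩, x, hxj, rfl⟩
      _ ≤ ∑ i : Fin N, volume (⋃ j : S i, V '' Metric.ball (Q.c j) (Q.r j)) := by
          refine (measure_iUnion_le _).trans_eq (tsum_fintype _)
      _ ≤ ∑ _i : Fin N, 2 * C * A * δ ^ (1 / p) := by
          refine Finset.sum_le_sum fun i _ => ?_
          have : Countable (S i) := (hcount i).to_subtype
          exact (measure_iUnion_le _).trans (hfam i)
      _ = _ := by
          simp only [Finset.sum_const, Finset.card_univ, Fintype.card_fin, nsmul_eq_mul]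
          ring
  have hK : (N : ℝ≥0∞) * (2 * C * A) ≠ ⊤ := ENNReal.mul_ne_top (by simp)
    (ENNReal.mul_ne_top (ENNReal.mul_ne_top (by simp) hC) hAt)
  have hlim : Tendsto (fun k : ℕ => (N : ℝ≥0∞) * (2 * C * A) * (((k : ℝ≥0∞) + 1)⁻¹) ^ (1 / p))
      atTop (𝓝 0) := by
    have h1 : Tendsto (fun k : ℕ => ((k : ℝ≥0∞) + 1)⁻¹) atTop (𝓝 0) := by
      have := (tendsto_add_atTop_iff_nat 1).2 ENNReal.tendsto_inv_nat_nhds_zero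
      simpa using this
    have h2 := ENNReal.Tendsto.const_mul ((ENNReal.continuous_rpow_const (y := 1 / p)).tendsto 0
      |>.comp h1) (Or.inr hK)
    rw [ENNReal.zero_rpow_of_pos (by positivity), mul_zero] at h2
    exact h2
  refine le_antisymm (ge_of_tendsto' hlim fun k => main _ ?_ ?_) zero_le
  · exact ENNReal.inv_ne_zero.2 (by simp)
  · exact ENNReal.inv_le_one.2 le_add_self

/-! ### Continuous representatives -/

/-- An asymptotically equicontinuous sequence that converges almost everywhere converges everywhere,
to a continuous function. -/
theorem exists_continuous_limit {W : ℕ → Plane → ℝ} {v : Plane → ℝ}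
    (hW : ∀ ε > 0, ∃ η > 0, ∀ᶠ n in atTop, ∀ x y, dist x y < η → dist (W n x) (W n y) ≤ ε)
    (hv : ∀ᵐ x, Tendsto (fun n => W n x) atTop (𝓝 (v x))) :
    ∃ V : Plane → ℝ, Continuous V ∧ (∀ x, Tendsto (fun n => W n x) atTop (𝓝 (V x))) ∧
      V =ᵐ[volume] v := by
  have hlim : ∀ x, ∃ a, Tendsto (fun n => W n x) atTop (𝓝 a) := by
    intro x
    refine cauchySeq_tendsto_of_complete (Metric.cauchySeq_iff'.2 fun ε hε => ?_)
    obtain ⟨η, hη, hn⟩ := hW (ε / 4) (by positivity)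
    obtain ⟨y, hy, hxy⟩ := (Measure.dense_of_ae hv).exists_dist_lt x hη
    have hC := Metric.tendsto_nhds.1 hy (ε / 8) (by positivity)
    obtain ⟨N, hN⟩ := eventually_atTop.1 (hn.and hC)
    refine ⟨N, fun n hnN => ?_⟩
    have a1 := (hN n hnN).1 x y hxy
    have a2 := (hN N le_rfl).1 x y hxy
    have a3 := (hN n hnN).2
    have a4 := (hN N le_rfl).2
    rw [dist_comm] at a2 a4
    have := dist_triangle4 (W n x) (W n y) (W N y) (W N x)
    have := dist_triangle (W n y) (v y) (W N y)
    linarith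
  choose V hV using hlim
  refine ⟨V, Metric.continuous_iff.2 fun x ε hε => ?_, hV, ?_⟩
  · obtain ⟨η, hη, hn⟩ := hW (ε / 2) (by positivity)
    refine ⟨η, hη, fun y hy => ?_⟩
    have := le_of_tendsto ((hV y).dist (hV x)) (hn.mono fun n h => h y x hy)
    linarith
  · filter_upwards [hv] with x hx using tendsto_nhds_unique (hV x) hx

theorem abs_moll_le {n : ℕ} {f : Plane → ℝ} {M : ℝ}
    (hM : ∀ᵐ x, |f x| ≤ M) (x : Plane) : |moll n f x| ≤ M := by
  rw [moll_eq_integral_kernel]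
  have h1 : ∀ᵐ t, |f (x - t)| ≤ M :=
    (quasiMeasurePreserving_sub_left_of_right_invariant volume x).ae hM
  calc |∫ t, molKernel n t * f (x - t)| ≤ ∫ t, molKernel n t * M := by
        rw [← Real.norm_eq_abs]
        refine norm_integral_le_of_norm_le ((integrable_molKernel n).mul_const M) ?_
        filter_upwards [h1] with t ht
        rw [norm_mul, Real.norm_of_nonneg (molKernel_nonneg n t)]
        exact mul_le_mul_of_nonneg_left ht (molKernel_nonneg n t)
    _ = M := by rw [integral_mul_const, integral_molKernel, one_mul]

theorem norm_fderiv_le_gradSum (h : Plane → ℝ) (x : Plane) : ‖fderiv ℝ h x‖ ≤ gradSum h x :=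
  ContinuousLinearMap.opNorm_le_bound _ (gradSum_nonneg h x) fun v => abs_fderiv_apply_le h x v

section ContinuousRep

variable {v : Plane → ℝ} {G : Plane → Plane}

theorem pd_moll_univ (hw : IsWeakGradient univ v G) (hv : LocallyIntegrable v) (n : ℕ) (i : Fin 2)
    (x : Plane) : pd i (moll n v) x = moll n (fun x => G x i) x :=
  pd_moll hw hv (subset_univ _) (fun _ _ => rfl) fun _ _ => rfl

/-- An integrable function with bounded weak gradient is Lipschitz up to a null set, and its
mollifications converge to the Lipschitz representative at every point. -/
theorem exists_lipschitz_rep (hv : Integrable v)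
    (hw : IsWeakGradient univ v G) {M : ℝ≥0} (hM : ∀ i, ∀ᵐ x, |G x i| ≤ M) :
    ∃ V : Plane → ℝ, LipschitzWith (2 * M) V ∧
      (∀ x, Tendsto (fun n => moll n v x) atTop (𝓝 (V x))) ∧ V =ᵐ[volume] v := by
  have hL : ∀ n, LipschitzWith (2 * M) (moll n v) := fun n => by
    refine lipschitzWith_of_nnnorm_fderiv_le
      ((contDiff_moll n hv.locallyIntegrable).differentiable (by simp)) fun x => ?_
    rw [← NNReal.coe_le_coe, coe_nnnorm]
    refine (norm_fderiv_le_gradSum _ x).trans ?_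
    rw [gradSum, pd_moll_univ hw hv.locallyIntegrable, pd_moll_univ hw hv.locallyIntegrable]
    have a0 := abs_moll_le (n := n) (hM 0) x
    have a1 := abs_moll_le (n := n) (hM 1) x
    push_cast
    linarith
  obtain ⟨V, hVc, hV, hVv⟩ := exists_continuous_limit (W := fun n => moll n v) (fun ε hε => by
    refine ⟨ε / (2 * M + 1), by positivity, Eventually.of_forall fun n x y hxy => ?_⟩
    have h1 := (hL n).dist_le_mul x y
    push_cast at h1
    have h2 : dist x y * (2 * M + 1) ≤ ε := by
      rw [lt_div_iff₀ (by positivity)] at hxy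
      exact hxy.le
    have := dist_nonneg (x := x) (y := y)
    nlinarith) (ae_tendsto_moll hv.locallyIntegrable)
  refine ⟨V, LipschitzWith.of_dist_le_mul fun x y => ?_, hV, hVv⟩
  exact le_of_tendsto ((hV x).dist (hV y)) (Eventually.of_forall fun n => (hL n).dist_le_mul x y)

/-- Morrey's inequality for an integrable function whose weak gradient is in `L^q`, `q > 2`. -/
theorem exists_morrey_rep {q : ℝ} (hq : 2 < q) (hv : Integrable v)
    (hGq : ∀ i, MemLp (fun x => G x i) (ENNReal.ofReal q)) (hw : IsWeakGradient univ v G) :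
    ∃ (V : Plane → ℝ) (C : ℝ≥0∞), C ≠ ⊤ ∧ Continuous V ∧
      (∀ x, Tendsto (fun n => moll n v x) atTop (𝓝 (V x))) ∧ V =ᵐ[volume] v ∧
      ∀ (z : Plane) (r : ℝ), 0 < r → ∀ x ∈ Metric.ball z r, ∀ y ∈ Metric.ball z r,
        ‖V x - V y‖ₑ ≤ C * ENNReal.ofReal r ^ (1 - 2 / q) *
          eLpNorm (fun x => |G x 0| + |G x 1|) (ENNReal.ofReal q)
            (volume.restrict (Metric.ball z r)) := by
  obtain ⟨C, hC, hM⟩ := exists_morrey hq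
  have hα : 0 < 1 - 2 / q := by
    rw [sub_pos, div_lt_one (by linarith)]
    exact hq
  have hq1 : (1 : ℝ≥0∞) ≤ ENNReal.ofReal q := by
    rw [← ENNReal.ofReal_one]
    exact ENNReal.ofReal_le_ofReal (by linarith)
  set F : Plane → ℝ := fun x => |G x 0| + |G x 1| with hF
  have hFq : MemLp F (ENNReal.ofReal q) := (hGq 0).norm.add (hGq 1).norm
  let δ : ℕ → ℝ≥0∞ := fun n =>
    eLpNorm (moll n (fun x => G x 0) - fun x => G x 0) (ENNReal.ofReal q) +
      eLpNorm (moll n (fun x => G x 1) - fun x => G x 1) (ENNReal.ofReal q)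
  have hδ : Tendsto δ atTop (𝓝 0) := by
    have := (tendsto_eLpNorm_moll_sub hq1 (by simp) (hGq 0)).add
      (tendsto_eLpNorm_moll_sub hq1 (by simp) (hGq 1))
    simpa using this
  have hsm : ∀ n, ContDiff ℝ 1 (moll n v) := fun n =>
    (contDiff_moll n hv.locallyIntegrable).of_le (by simp)
  have hbd : ∀ n z r, eLpNorm (gradSum (moll n v)) (ENNReal.ofReal q)
      (volume.restrict (Metric.ball z r)) ≤
      eLpNorm F (ENNReal.ofReal q) (volume.restrict (Metric.ball z r)) + δ n := by
    intro n z r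
    have hm : ∀ i, AEStronglyMeasurable (moll n (fun x => G x i) - fun x => G x i) := fun i =>
      (contDiff_moll n ((hGq i).locallyIntegrable hq1)).continuous.aestronglyMeasurable.sub
        (hGq i).1
    let D : Plane → ℝ := fun x => |(moll n (fun x => G x 0) - fun x => G x 0) x| +
        |(moll n (fun x => G x 1) - fun x => G x 1) x|
    have hD : eLpNorm D (ENNReal.ofReal q) ≤ δ n := by
      refine (eLpNorm_add_le (hm 0).norm (hm 1).norm hq1).trans (le_of_eq ?_)
      rw [eLpNorm_norm, eLpNorm_norm]
    calc eLpNorm (gradSum (moll n v)) (ENNReal.ofReal q) (volume.restrict (Metric.ball z r))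
        ≤ eLpNorm (F + D) (ENNReal.ofReal q) (volume.restrict (Metric.ball z r)) := by
          refine eLpNorm_mono_real fun x => ?_
          rw [Real.norm_of_nonneg (gradSum_nonneg _ x), gradSum,
            pd_moll_univ hw hv.locallyIntegrable, pd_moll_univ hw hv.locallyIntegrable]
          simp only [Pi.add_apply, hF, D, Pi.sub_apply]
          have := abs_sub_abs_le_abs_sub (moll n (fun x => G x 0) x) (G x 0)
          have := abs_sub_abs_le_abs_sub (moll n (fun x => G x 1) x) (G x 1)
          linarith
      _ ≤ _ := by
          refine (eLpNorm_add_le hFq.1.restrict (((hm 0).norm.add (hm 1).norm).restrict)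
            hq1).trans ?_
          gcongr
          exact (eLpNorm_mono_measure _ Measure.restrict_le_self).trans hD
  have hosc : ∀ n (z : Plane) (r : ℝ), 0 < r → ∀ x ∈ Metric.ball z r, ∀ y ∈ Metric.ball z r,
      ‖moll n v x - moll n v y‖ₑ ≤ C * ENNReal.ofReal r ^ (1 - 2 / q) *
        (eLpNorm F (ENNReal.ofReal q) (volume.restrict (Metric.ball z r)) + δ n) :=
    fun n z r hr x hx y hy => (hM _ (hsm n) z r hr x hx y hy).trans (by gcongr; exact hbd n z r)
  have hKt : C * (eLpNorm F (ENNReal.ofReal q) + 1) ≠ ⊤ :=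
    ENNReal.mul_ne_top hC (ENNReal.add_ne_top.2 ⟨hFq.2.ne, by simp⟩)
  obtain ⟨V, hVc, hV, hVv⟩ := exists_continuous_limit (W := fun n => moll n v) (fun ε hε => by
    have h1 : Tendsto (fun k : ℕ => C * (eLpNorm F (ENNReal.ofReal q) + 1) *
        ENNReal.ofReal (molRadius k) ^ (1 - 2 / q)) atTop (𝓝 0) := by
      have h2 := (ENNReal.continuous_rpow_const (y := 1 - 2 / q)).tendsto 0
        |>.comp (by simpa using ENNReal.tendsto_ofReal tendsto_molRadius)
      have h3 := ENNReal.Tendsto.const_mul h2 (Or.inr hKt)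
      rw [ENNReal.zero_rpow_of_pos hα, mul_zero] at h3
      exact h3
    obtain ⟨k, hk⟩ := (h1.eventually (gt_mem_nhds (ENNReal.ofReal_pos.2 hε))).exists
    refine ⟨molRadius k, molRadius_pos k, ?_⟩
    filter_upwards [hδ.eventually (gt_mem_nhds one_pos)] with n hn x y hxy
    have h4 := hosc n x _ (molRadius_pos k) x (Metric.mem_ball_self (molRadius_pos k)) y
      (by rwa [Metric.mem_ball, dist_comm])
    rw [← edist_eq_enorm_sub, edist_dist] at h4
    refine (ENNReal.ofReal_le_ofReal_iff hε.le).1 (h4.trans (le_trans ?_ hk.le))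
    rw [mul_right_comm]
    gcongr
    exact Measure.restrict_le_self) (ae_tendsto_moll hv.locallyIntegrable)
  refine ⟨V, C, hC, hVc, hV, hVv, fun z r hr x hx y hy => ?_⟩
  have hBt : C * ENNReal.ofReal r ^ (1 - 2 / q) ≠ ⊤ :=
    ENNReal.mul_ne_top hC (ENNReal.rpow_ne_top_of_nonneg hα.le (by simp))
  have l1 : Tendsto (fun n => C * ENNReal.ofReal r ^ (1 - 2 / q) *
      (eLpNorm F (ENNReal.ofReal q) (volume.restrict (Metric.ball z r)) + δ n)) atTop
      (𝓝 (C * ENNReal.ofReal r ^ (1 - 2 / q) *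
        (eLpNorm F (ENNReal.ofReal q) (volume.restrict (Metric.ball z r)) + 0))) :=
    ENNReal.Tendsto.const_mul (tendsto_const_nhds.add hδ) (Or.inr hBt)
  rw [add_zero] at l1
  exact le_of_tendsto_of_tendsto' ((hV x).sub (hV y)).enorm l1
    fun n => hosc n z r hr x hx y hy

/-- Let `1 ≤ p < 2` and let `q` be the conjugate exponent. An integrable function with weak gradient
in `L^q` is continuous up to a null set, and maps the sets of zero `(2-p)`-dimensional Hausdorff
measure to null sets. For `p = 1` the representative is Lipschitz, otherwise it satisfies Morrey's
inequality. -/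
theorem exists_continuous_rep {p q : ℝ≥0∞} [hpq : p.HolderConjugate q] (hp : p < 2)
    (hv : Integrable v)
    (hGq : ∀ i, MemLp (fun x => G x i) q) (hw : IsWeakGradient univ v G) :
    ∃ V : Plane → ℝ, Continuous V ∧ (∀ x, Tendsto (fun n => moll n v x) atTop (𝓝 (V x))) ∧
      V =ᵐ[volume] v ∧
      ∀ E, Measure.hausdorffMeasure (2 - p.toReal) E = 0 → volume (V '' E) = 0 := by
  rcases eq_or_ne q ⊤ with rfl | hq
  · have hp1 : p = 1 := by
      simpa using ENNReal.HolderConjugate.inv_add_inv_eq_one p ⊤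
    subst hp1
    have hb : ∀ i, ∃ M : ℝ≥0, ∀ᵐ x, |G x i| ≤ M := fun i => by
      refine ⟨(eLpNormEssSup (fun x => G x i) volume).toNNReal, ?_⟩
      have h2 := (hGq i).2
      rw [eLpNorm_exponent_top] at h2
      filter_upwards [enorm_ae_le_eLpNormEssSup (fun x => G x i) volume] with x hx
      rw [← ENNReal.coe_toNNReal h2.ne] at hx
      rw [← Real.norm_eq_abs, ← coe_nnnorm]
      exact_mod_cast hx
    choose M hM using hb
    obtain ⟨V, hL, hV, hVv⟩ := exists_lipschitz_rep hv hw (M := M 0 + M 1) (fun i => by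
      filter_upwards [hM i] with x hx
      refine hx.trans (NNReal.coe_le_coe.2 ?_)
      fin_cases i <;> simp)
    refine ⟨V, hL.continuous, hV, hVv, fun E hE => ?_⟩
    norm_num at hE
    have h1 := hL.hausdorffMeasure_image_le zero_le_one E
    rw [hE, mul_zero, hausdorffMeasure_real] at h1
    exact le_antisymm h1 zero_le
  · have hp0 : p ≠ ⊤ := (hp.trans_le le_top).ne
    have hpqr : p.toReal.HolderConjugate q.toReal :=
      ENNReal.HolderConjugate.toReal_of_ne_top hp0 hq
    have hp2 : p.toReal < 2 := by
      have := (ENNReal.toReal_lt_toReal hp0 (by simp)).2 hp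
      simpa using this
    have hq2 : 2 < q.toReal := by
      have h1 := hpqr.inv_add_inv_eq_one
      have h2 : (2 : ℝ)⁻¹ < p.toReal⁻¹ := inv_strictAnti₀ hpqr.pos hp2
      exact (inv_lt_inv₀ hpqr.symm.pos two_pos).1 (by linarith)
    have hGq' : ∀ i, MemLp (fun x => G x i) (ENNReal.ofReal q.toReal) := fun i => by
      rw [ENNReal.ofReal_toReal hq]
      exact hGq i
    obtain ⟨V, C, hC, hVc, hV, hVv, hb⟩ := exists_morrey_rep hq2 hv hGq' hw
    refine ⟨V, hVc, hV, hVv, fun E hE => ?_⟩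
    have hq0 : ENNReal.ofReal q.toReal ≠ 0 := by simp [hpqr.symm.pos]
    have e1 : (ENNReal.ofReal q.toReal).toReal = q.toReal :=
      ENNReal.toReal_ofReal hpqr.symm.nonneg
    refine volume_image_eq_zero_of_morrey hpqr hp2 hC
      (F := fun x => ‖|G x 0| + |G x 1|‖ₑ) ?_ (fun z r hr x hx y hy => ?_) hE
    · have h1 := lintegral_rpow_enorm_lt_top_of_eLpNorm_lt_top hq0 (by simp)
        ((hGq' 0).norm.add (hGq' 1).norm).2
      rw [e1] at h1
      exact h1.ne
    · have h1 := hb z r hr x hx y hy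
      rw [eLpNorm_eq_lintegral_rpow_enorm_toReal hq0 (by simp), e1] at h1
      exact h1

end ContinuousRep

/-! ### Constancy on the components of the complement -/

theorem isTestOn_moll {n : ℕ} {v : Plane → ℝ} (hv : LocallyIntegrable v) {K Ω : Set Plane}
    (hK : IsCompact K) (hKΩ : Metric.cthickening (molRadius n) K ⊆ Ω)
    (h0 : ∀ x, x ∉ K → v x = 0) : IsTestOn Ω (moll n v) :=
  IsTestOn.of_compact (contDiff_moll n hv) hK.cthickening hKΩ fun x hx =>
    moll_eq_zero fun y hy => h0 y fun hyK => hx <|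
      Metric.mem_cthickening_of_dist_le x y _ K hyK (by rw [dist_comm]; exact hy)

/-- A preconnected set with at least two points meets, in every neighbourhood of each of its points,
almost all of the horizontal or of the vertical lines of an interval. -/
theorem exists_mem_line_of_isPreconnected {K : Set Plane} (hK : IsPreconnected K) {a b : Plane}
    (ha : a ∈ K) (hb : b ∈ K) (hab : a ≠ b) {T : Set ℝ} (hT : ∀ᵐ t, t ∈ T) {U : Set Plane}
    (hU : IsOpen U) (haU : a ∈ U) : ∃ x ∈ K, x ∈ U ∧ ∃ j, x j ∈ T := by
  -- `K` meets the boundary of every small square with centre `a`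
  let m : Plane → ℝ := fun x => max |x 0 - a 0| |x 1 - a 1|
  have hm : Continuous m := by fun_prop
  have hma : m a = 0 := by simp [m]
  have hmb : 0 < m b := by
    by_contra h
    apply hab
    have h0 : |b 0 - a 0| ≤ 0 := (le_max_left _ _).trans (not_lt.1 h)
    have h1 : |b 1 - a 1| ≤ 0 := (le_max_right _ _).trans (not_lt.1 h)
    ext i
    fin_cases i
    · exact (sub_eq_zero.1 (abs_nonpos_iff.1 h0)).symm
    · exact (sub_eq_zero.1 (abs_nonpos_iff.1 h1)).symm
  obtain ⟨r, hr, hrU⟩ := exists_box_subset hU haU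
  have hadd : ∀ c : ℝ, ∀ᵐ ρ, c + ρ ∈ T := fun c =>
    (measurePreserving_add_left volume c).quasiMeasurePreserving.ae hT
  have hsub : ∀ c : ℝ, ∀ᵐ ρ, c - ρ ∈ T := fun c =>
    (quasiMeasurePreserving_sub_left_of_right_invariant volume c).ae hT
  have hall : ∀ᵐ ρ : ℝ, ∀ i, a i + ρ ∈ T ∧ a i - ρ ∈ T :=
    ae_all_iff.2 fun i => (hadd (a i)).and (hsub (a i))
  obtain ⟨ρ, hρ, hρ0⟩ := (Measure.dense_of_ae hall).inter_open_nonempty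
    (Ioo 0 (min r (m b))) isOpen_Ioo (nonempty_Ioo.2 (lt_min hr hmb))
  obtain ⟨x, hx, hxρ⟩ := hK.intermediate_value ha hb hm.continuousOn
    ⟨hma.trans_le hρ.1.le, (hρ.2.trans_le (min_le_right _ _)).le⟩
  have hρr : ρ < r := hρ.2.trans_le (min_le_left _ _)
  refine ⟨x, hx, hrU fun i => ?_, ?_⟩
  · refine lt_of_le_of_lt ?_ (hxρ.trans_lt hρr)
    fin_cases i
    · exact le_max_left _ _
    · exact le_max_right _ _
  · have key : ∀ i, |x i - a i| = ρ → x i ∈ T := fun i hi => by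
      rcases (abs_eq hρ.1.le).1 hi with h | h
      · rw [show x i = a i + ρ by linarith]
        exact (hρ0 i).1
      · rw [show x i = a i - ρ by linarith]
        exact (hρ0 i).2
    rcases max_choice |x 0 - a 0| |x 1 - a 1| with h | h
    · exact ⟨0, key 0 (h.symm.trans hxρ)⟩
    · exact ⟨1, key 1 (h.symm.trans hxρ)⟩

/-- If the gradients of smooth functions that are locally constant off `Ω` converge in `L¹` to the
gradient of `v`, then the continuous representative of `v` is constant on the preconnected subsets
of the complement of `Ω`: a subsequence converges to it everywhere on almost all of the horizontal
and of the vertical lines. -/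
theorem continuous_rep_eq_of_isPreconnected {Ω K : Set Plane} {R : ℝ} {φ : ℕ → Plane → ℝ}
    {v V : Plane → ℝ} {G : Plane → Plane} (hφ : ∀ n, IsTestOn univ (φ n))
    (hφΩ : ∀ n i, IsTestOn Ω (pd i (φ n))) (hG : ∀ i, Integrable fun x => G x i)
    (hL : ∀ i, Tendsto (fun n => ∫ x, |pd i (φ n) x - G x i|) atTop (𝓝 0)) (hv : Integrable v)
    (hv0 : ∀ x, x ∉ closedBox 0 R → v x = 0) (hw : IsWeakGradient univ v G) (hVc : Continuous V)
    (hV : ∀ x, Tendsto (fun n => moll n v x) atTop (𝓝 (V x))) (hK : IsPreconnected K)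
    (hKΩ : K ⊆ Ωᶜ) {a b : Plane} (ha : a ∈ K) (hb : b ∈ K) : V a = V b := by
  have hmoll : ∀ n, IsTestOn univ (moll n v) := fun n =>
    isTestOn_moll hv.locallyIntegrable (isCompact_closedBox 0 R) (subset_univ _) hv0
  -- `moll n v` converges to `V` everywhere, so it suffices that the gradients of the differences
  -- tend to zero in `L¹`.
  let ψ : ℕ → Plane → ℝ := fun n x => φ n x - moll n v x
  have hψ : ∀ n, IsTestOn univ (ψ n) := fun n => (hφ n).sub (hmoll n)
  have hψL : ∀ i, Tendsto (fun n => ∫ x, |pd i (ψ n) x|) atTop (𝓝 0) := by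
    intro i
    have h1 := (hL i).add (tendsto_integral_abs_moll_sub (hG i))
    rw [add_zero] at h1
    refine squeeze_zero (fun n => integral_nonneg fun x => abs_nonneg _) (fun n => ?_) h1
    have i1 : Integrable fun x => |pd i (φ n) x - G x i| :=
      ((((hφ n).pd i).integrable volume).sub (hG i)).abs
    have i2 : Integrable fun x => |moll n (fun x => G x i) x - G x i| :=
      ((integrable_moll n (hG i)).sub (hG i)).abs
    rw [← integral_add i1 i2]
    refine integral_mono (((hψ n).pd i).integrable volume).abs (i1.add i2) fun x => ?_
    have e : pd i (ψ n) x = pd i (φ n) x - moll n (fun x => G x i) x := by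
      rw [← pd_moll_univ hw hv.locallyIntegrable]
      exact pd_sub (hφ n).differentiable (hmoll n).differentiable i x
    simp only [e]
    have := abs_sub_le (pd i (φ n) x) (G x i) (moll n (fun x => G x i) x)
    rwa [abs_sub_comm (G x i)] at this
  obtain ⟨n₁, hn₁, h₁⟩ := exists_subseq_tendsto_lines hψ (i := 0) (j := 1) (by decide) (hψL 0)
  obtain ⟨n₂, hn₂, h₂⟩ := exists_subseq_tendsto_lines (fun k => hψ (n₁ k)) (i := 1) (j := 0)
    (by decide) ((hψL 1).comp hn₁.tendsto_atTop)
  let T : Set ℝ := {t | ∀ j : Fin 2, ∀ x : Plane, x j = t →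
    Tendsto (fun k => φ (n₁ (n₂ k)) x) atTop (𝓝 (V x))}
  have hT : ∀ᵐ t, t ∈ T := by
    filter_upwards [h₁, h₂] with t ht₁ ht₂ j x hx
    have h3 : Tendsto (fun k => ψ (n₁ (n₂ k)) x) atTop (𝓝 0) := by
      fin_cases j
      · exact ht₂ x hx
      · exact (ht₁ x hx).comp hn₂.tendsto_atTop
    have h4 := h3.add ((hV x).comp (hn₁.comp hn₂).tendsto_atTop)
    simpa [ψ] using h4
  -- If `V a ≠ V b`, there are points of `K` on the good lines, close to `a` and to `b`, at which
  -- `V` has different values; but each `φ n` is constant on `K`.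
  by_contra hne
  have hab : a ≠ b := fun h => hne (by rw [h])
  obtain ⟨A, B, hA, hB, haA, hbB, hAB⟩ := t2_separation hne
  obtain ⟨x, hx, hxA, j, hj⟩ := exists_mem_line_of_isPreconnected hK ha hb hab hT
    (hA.preimage hVc) haA
  obtain ⟨y, hy, hyB, l, hl⟩ := exists_mem_line_of_isPreconnected hK hb ha hab.symm hT
    (hB.preimage hVc) hbB
  have h5 : V x = V y := by
    refine tendsto_nhds_unique (hj j x rfl) ?_
    have h6 := hl l y rfl
    refine h6.congr fun k => ?_
    exact eq_of_isPreconnected (hφ _).differentiable (hφΩ _ 0) (hφΩ _ 1) hK hKΩ hy hx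
  exact Set.disjoint_left.1 hAB hxA (h5 ▸ hyB)

/-! ### Cutting off near a null set of values -/

/-- Convergence in `L^q` implies weak convergence, by Hölder's inequality. -/
theorem tendsto_integral_mul_of_tendsto_eLpNorm {μ : Measure Plane} {p q : ℝ≥0∞}
    [q.HolderConjugate p] {F : ℕ → Plane → ℝ} {F' g : Plane → ℝ}
    (hF : ∀ n, AEStronglyMeasurable (F n) μ) (hF' : MemLp F' q μ) (hg : MemLp g p μ)
    (h : Tendsto (fun n => eLpNorm (F n - F') q μ) atTop (𝓝 0)) :
    Tendsto (fun n => ∫ x, F n x * g x ∂μ) atTop (𝓝 (∫ x, F' x * g x ∂μ)) := by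
  refine tendsto_integral_of_L1' _ (hF'.integrable_mul hg).1 ?_ ?_
  · filter_upwards [h.eventually (gt_mem_nhds ENNReal.zero_lt_top)] with n hn
    have h1 : MemLp (F n - F') q μ := ⟨(hF n).sub hF'.1, hn⟩
    have h2 : MemLp (F n) q μ := by simpa using h1.add hF'
    exact h2.integrable_mul hg
  · have h1 : Tendsto (fun n => eLpNorm (F n - F') q μ * eLpNorm g p μ) atTop (𝓝 0) := by
      have := ENNReal.Tendsto.mul_const h (Or.inr hg.2.ne)
      rwa [zero_mul] at this
    refine tendsto_of_tendsto_of_tendsto_of_le_of_le tendsto_const_nhds h1 (fun _ => zero_le)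
      fun n => ?_
    have h2 := eLpNorm_smul_le_mul_eLpNorm (p := q) (q := p) (r := 1) hg.1 ((hF n).sub hF'.1)
    refine le_trans (le_of_eq ?_) h2
    congr 1
    ext x
    simp [sub_mul]

/-- Mollification converges weakly in `L^q`, weakly-* when `q = ∞`. -/
theorem tendsto_integral_moll_mul {Ω : Set Plane} {p q : ℝ≥0∞} [hpq : q.HolderConjugate p]
    {f g : Plane → ℝ} (hf : MemLp f q) (hg : MemLp g p (volume.restrict Ω)) :
    Tendsto (fun n => ∫ x in Ω, moll n f x * g x) atTop (𝓝 (∫ x in Ω, f x * g x)) := by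
  have hq : 1 ≤ q := ENNReal.HolderConjugate.one_le q p
  have hloc := hf.locallyIntegrable hq
  have hm : ∀ n, AEStronglyMeasurable (moll n f) (volume.restrict Ω) := fun n =>
    (contDiff_moll n hloc).continuous.aestronglyMeasurable
  rcases eq_or_ne q ⊤ with rfl | hqt
  · have hp1 : p = 1 := by
      simpa using ENNReal.HolderConjugate.inv_add_inv_eq_one ⊤ p
    subst hp1
    have h2 := hf.2
    rw [eLpNorm_exponent_top] at h2
    have hM : ∀ᵐ x, |f x| ≤ (eLpNormEssSup f volume).toReal := by
      filter_upwards [enorm_ae_le_eLpNormEssSup f volume] with x hx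
      rw [← Real.norm_eq_abs, ← toReal_enorm]
      exact ENNReal.toReal_mono h2.ne hx
    have hgi := memLp_one_iff_integrable.1 hg
    exact tendsto_integral_mul_of_tendsto_L1 (fun n x => abs_moll_le hM x) hm
      (ae_restrict_of_ae (ae_tendsto_moll hloc)) (fun _ => hgi) hgi (by simp)
  · refine tendsto_integral_mul_of_tendsto_eLpNorm hm (hf.restrict Ω) hg ?_
    exact tendsto_of_tendsto_of_tendsto_of_le_of_le tendsto_const_nhds
      (tendsto_eLpNorm_moll_sub hq hqt hf) (fun _ => zero_le)
      fun n => eLpNorm_mono_measure _ Measure.restrict_le_self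

/-- A gradient that vanishes off a compact subset of `Ω`, rotated by a right angle, is a limit of
divergence free test fields on `Ω`, so that it is orthogonal to the fields that these annihilate. -/
theorem OrthSolenoidal.integral_eq_zero {Ω K : Set Plane} {p q : ℝ≥0∞} [hpq : q.HolderConjugate p]
    (hΩ : IsOpen Ω) (hK : IsCompact K) (hKΩ : K ⊆ Ω) {w : Plane → ℝ} {H g : Plane → Plane}
    (hw : IsWeakGradient univ w H) (hwl : LocallyIntegrable w) (hHq : ∀ i, MemLp (fun x => H x i) q)
    (hH0 : ∀ x, x ∉ K → H x = 0) (hg : OrthSolenoidal Ω g)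
    (hgp : ∀ i, MemLp (fun x => g x i) p (volume.restrict Ω)) :
    ∫ x in Ω, (H x 1 * g x 0 - H x 0 * g x 1) = 0 := by
  have hq : 1 ≤ q := ENNReal.HolderConjugate.one_le q p
  have hHl : ∀ i, LocallyIntegrable fun x => H x i := fun i => (hHq i).locallyIntegrable hq
  obtain ⟨δ, hδ, hδΩ⟩ := hK.exists_cthickening_subset_open hΩ hKΩ
  have hlim := (tendsto_integral_moll_mul (hHq 1) (hgp 0)).sub
    (tendsto_integral_moll_mul (hHq 0) (hgp 1))
  have hi : ∀ i j, IntegrableOn (fun x => H x i * g x j) Ω := fun i j =>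
    ((hHq i).restrict Ω).integrable_mul (hgp j)
  rw [integral_sub (hi 1 0) (hi 0 1)]
  refine tendsto_nhds_unique hlim (tendsto_const_nhds.congr' ?_)
  filter_upwards [tendsto_molRadius.eventually (gt_mem_nhds hδ)] with n hn
  have ht : ∀ i, IsTestOn Ω (moll n fun x => H x i) := fun i =>
    isTestOn_moll (hHl i) hK ((Metric.cthickening_mono hn.le K).trans hδΩ)
      fun x hx => by rw [hH0 x hx]; rfl
  have hpd : ∀ i, pd i (moll n w) = moll n fun x => H x i := fun i =>
    funext fun x => pd_moll_univ hw hwl n i x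
  have h1 := hg _ _ (ht 1) (ht 0).neg fun x => by
    have := pd_comm (contDiff_moll n hwl) 0 1 x
    rw [hpd, hpd] at this
    rw [pd_neg, this]
    ring
  simp only [mul_neg, integral_neg] at h1
  simp only [mul_comm] at h1 ⊢
  linarith

/-- Primitives `f n` of cut-off functions `h n` that vanish near `N` and increase to the indicator
function of the complement of `N`. As `N` is null, the `f n` converge to the identity. -/
theorem exists_cutoff {N : Set ℝ} (hN : IsClosed N) (hne : N.Nonempty) (hvol : volume N = 0) :
    ∃ h f : ℕ → ℝ → ℝ, (∀ n, Continuous (h n)) ∧ (∀ n t, |h n t| ≤ 1) ∧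
      (∀ n t, HasDerivAt (f n) (h n t) t) ∧
      (∀ n t, Metric.infDist t N ≤ molRadius n → h n t = 0) ∧
      (∀ t ∉ N, Tendsto (fun n => h n t) atTop (𝓝 1)) ∧
      (∀ t, Tendsto (fun n => f n t) atTop (𝓝 t)) ∧ ∀ n t, |f n t| ≤ |t| := by
  let h : ℕ → ℝ → ℝ := fun n t => min 1 (max 0 (((n : ℝ) + 1) * Metric.infDist t N - 1))
  have hc : ∀ n, Continuous (h n) := fun n =>
    continuous_const.min (continuous_const.max
      ((continuous_const.mul (Metric.continuous_infDist_pt N)).sub continuous_const))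
  have hb : ∀ n t, |h n t| ≤ 1 := fun n t => by
    rw [abs_of_nonneg (le_min zero_le_one (le_max_left _ _))]
    exact min_le_left _ _
  have hlim : ∀ t ∉ N, Tendsto (fun n => h n t) atTop (𝓝 1) := fun t ht => by
    have hd : 0 < Metric.infDist t N := (hN.notMem_iff_infDist_pos hne).1 ht
    refine tendsto_const_nhds.congr' ?_
    obtain ⟨k, hk⟩ := exists_nat_gt (2 / Metric.infDist t N)
    filter_upwards [eventually_ge_atTop k] with n hn
    rw [div_lt_iff₀ hd] at hk
    have h1 : (k : ℝ) ≤ n := by exact_mod_cast hn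
    have h2 : 1 ≤ ((n : ℝ) + 1) * Metric.infDist t N - 1 := by nlinarith
    exact (min_eq_left (h2.trans (le_max_right _ _))).symm
  refine ⟨h, fun n t => ∫ s in (0 : ℝ)..t, h n s, hc, hb, fun n t => ?_, fun n t ht => ?_, hlim,
    fun t => ?_, fun n t => ?_⟩
  · exact intervalIntegral.integral_hasDerivAt_right ((hc n).intervalIntegrable _ _)
      ((hc n).stronglyMeasurableAtFilter _ _) (hc n).continuousAt
  · have h1 : ((n : ℝ) + 1) * Metric.infDist t N ≤ 1 := by
      rw [molRadius, le_div_iff₀ (by positivity)] at ht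
      linarith
    simp only [h]
    rw [max_eq_left (by linarith)]
    simp
  · have h1 : Tendsto (fun n => ∫ s in (0 : ℝ)..t, h n s) atTop (𝓝 (∫ _s in (0 : ℝ)..t, 1)) := by
      refine intervalIntegral.tendsto_integral_filter_of_dominated_convergence (fun _ => (1 : ℝ))
        (Eventually.of_forall fun n => (hc n).aestronglyMeasurable)
        (Eventually.of_forall fun n => ae_of_all _ fun s _ => hb n s) (by simp) ?_
      filter_upwards [measure_eq_zero_iff_ae_notMem.1 hvol] with s hs _ using hlim s hs
    simpa using h1
  · have := intervalIntegral.norm_integral_le_of_norm_le_const (a := 0) (b := t) (C := 1)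
      (f := h n) fun s _ => hb n s
    simpa using this

section Truncation

variable {v : Plane → ℝ} {G : Plane → Plane} {N : Set ℝ}

/-- The weak gradient of a continuous function vanishes almost everywhere on the preimages of closed
null sets. -/
theorem ae_eq_zero_of_mem_null (hv : Continuous v) (hG : ∀ i, LocallyIntegrable fun x => G x i)
    (hw : IsWeakGradient univ v G) (hN : IsClosed N) (hne : N.Nonempty) (hvol : volume N = 0) :
    ∀ᵐ x, v x ∈ N → ∀ i, G x i = 0 := by
  obtain ⟨h, f, hc, hb, hf, hf0, hlim, hflim, hfb⟩ := exists_cutoff hN hne hvol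
  have hNm : MeasurableSet (v ⁻¹' N) := (hN.preimage hv).measurableSet
  have hh0 : ∀ n, ∀ t ∈ N, h n t = 0 := fun n t ht =>
    hf0 n t (by rw [Metric.infDist_zero_of_mem ht]; exact (molRadius_pos n).le)
  have key : ∀ i, ∀ᵐ x, x ∈ univ → G x i = (v ⁻¹' N)ᶜ.indicator (fun x => G x i) x := fun i => by
    have hGi : LocallyIntegrable ((v ⁻¹' N)ᶜ.indicator fun x => G x i) :=
      (hG i).indicator hNm.compl
    refine ae_eq_of_forall_test isOpen_univ ((hG i).locallyIntegrableOn _)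
      (hGi.locallyIntegrableOn _) fun ψ hψ => ?_
    simp only [setIntegral_univ]
    have hGψ : Integrable fun x => G x i * ψ x :=
      integrable_mul_of_locallyIntegrable (hG i) hψ.continuous hψ.compact
    have hn : ∀ n, ∫ x, f n (v x) * pd i ψ x = -∫ x, h n (v x) * (G x i * ψ x) := fun n => by
      have := isWeakGradient_iff.1 (hw.comp_deriv isOpen_univ
        (hv.locallyIntegrable.locallyIntegrableOn _) (fun i => (hG i).locallyIntegrableOn _)
        (hf n) (hc n) (hb n)) ψ hψ i
      simp only [setIntegral_univ, PiLp.smul_apply, smul_eq_mul, mul_assoc] at this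
      exact this
    have l1 : Tendsto (fun n => ∫ x, f n (v x) * pd i ψ x) atTop (𝓝 (∫ x, v x * pd i ψ x)) := by
      refine tendsto_integral_of_dominated_convergence (fun x => |v x * pd i ψ x|) (fun n => ?_) ?_
        (fun n => ae_of_all _ fun x => ?_) (ae_of_all _ fun x => ?_)
      · have hfc : Continuous (f n) :=
          continuous_iff_continuousAt.2 fun t => (hf n t).continuousAt
        exact ((hfc.comp hv).mul (hψ.pd i).continuous).aestronglyMeasurable
      · exact ((hv.mul (hψ.pd i).continuous).integrable_of_hasCompactSupport
          (hψ.pd i).compact.mul_left).abs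
      · rw [Real.norm_eq_abs, abs_mul, abs_mul]
        exact mul_le_mul_of_nonneg_right (hfb n _) (abs_nonneg _)
      · exact (hflim (v x)).mul_const _
    have l2 : Tendsto (fun n => ∫ x, h n (v x) * (G x i * ψ x)) atTop
        (𝓝 (∫ x, (v ⁻¹' N)ᶜ.indicator (fun x => G x i) x * ψ x)) := by
      refine tendsto_integral_of_dominated_convergence (fun x => |G x i * ψ x|) (fun n => ?_)
        hGψ.abs (fun n => ae_of_all _ fun x => ?_) (ae_of_all _ fun x => ?_)
      · exact ((hc n).comp hv).aestronglyMeasurable.mul hGψ.1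
      · rw [norm_mul, Real.norm_eq_abs, Real.norm_eq_abs]
        exact mul_le_of_le_one_left (abs_nonneg _) (hb n _)
      · by_cases hx : v x ∈ N
        · have : x ∉ (v ⁻¹' N)ᶜ := fun h => h hx
          simp [indicator_of_notMem this, hh0 _ _ hx]
        · have : x ∈ (v ⁻¹' N)ᶜ := hx
          rw [indicator_of_mem this]
          simpa using (hlim _ hx).mul_const (G x i * ψ x)
    have e1 := isWeakGradient_iff.1 hw ψ hψ i
    simp only [setIntegral_univ] at e1
    simp only [hn] at l1
    have := tendsto_nhds_unique l1 l2.neg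
    linarith
  filter_upwards [ae_all_iff.2 key] with x hx hxN i
  have : x ∉ (v ⁻¹' N)ᶜ := fun h => h hxN
  rw [hx i trivial, indicator_of_notMem this]

/-- If a compactly supported continuous function maps the complement of `Ω` to a null set, then its
weak gradient, rotated by a right angle, is orthogonal to the fields on `Ω` that annihilate the
divergence free test fields: it is a limit of gradients that vanish near the complement of `Ω`. -/
theorem OrthSolenoidal.integral_eq_zero_of_null {Ω : Set Plane} {R : ℝ} {p q : ℝ≥0∞}
    [hpq : q.HolderConjugate p] (hΩ : IsOpen Ω) (hv : Continuous v)
    (hv0 : ∀ x, x ∉ closedBox 0 R → v x = 0) (hGq : ∀ i, MemLp (fun x => G x i) q)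
    (hw : IsWeakGradient univ v G) (hnull : volume (v '' Ωᶜ) = 0) {g : Plane → Plane}
    (hg : OrthSolenoidal Ω g) (hgp : ∀ i, MemLp (fun x => g x i) p (volume.restrict Ω)) :
    ∫ x in Ω, (G x 1 * g x 0 - G x 0 * g x 1) = 0 := by
  have hq : 1 ≤ q := ENNReal.HolderConjugate.one_le q p
  have hGl : ∀ i, LocallyIntegrable fun x => G x i := fun i => (hGq i).locallyIntegrable hq
  -- the values of `v` off `Ω`, in a form that is clearly closed; `0` is the value near infinity
  let N : Set ℝ := v '' (Ωᶜ ∩ closedBox 0 R) ∪ {0}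
  have hNc : IsClosed N := (((isCompact_closedBox 0 R).inter_left hΩ.isClosed_compl).image
    hv).isClosed.union isClosed_singleton
  have hNe : N.Nonempty := ⟨0, Or.inr rfl⟩
  have hN0 : volume N = 0 := measure_union_null
    (measure_mono_null (image_mono inter_subset_left) hnull) (by simp)
  have hbox : ∀ x, x ∉ closedBox 0 R → v x ∈ N := fun x hx => Or.inr (hv0 x hx)
  have hcompl : ∀ x, x ∉ Ω → v x ∈ N := fun x hx => by
    by_cases hxR : x ∈ closedBox 0 R
    · exact Or.inl ⟨x, ⟨hx, hxR⟩, rfl⟩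
    · exact hbox x hxR
  obtain ⟨h, f, hc, hb, hf, hf0, hlim, hflim, hfb⟩ := exists_cutoff hNc hNe hN0
  have hh0 : ∀ n, ∀ t ∈ N, h n t = 0 := fun n t ht =>
    hf0 n t (by rw [Metric.infDist_zero_of_mem ht]; exact (molRadius_pos n).le)
  have hn : ∀ n, ∫ x in Ω, h n (v x) * (G x 1 * g x 0 - G x 0 * g x 1) = 0 := fun n => by
    -- `h n ∘ v` vanishes off a compact subset of `Ω`, and `(h n ∘ v) • G` is the gradient of `f n
    -- ∘ v`
    let K : Set Plane := {x | molRadius n ≤ Metric.infDist (v x) N}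
    have hKN : ∀ x ∈ K, v x ∉ N := fun x hx hxN => by
      have h1 : molRadius n ≤ Metric.infDist (v x) N := hx
      rw [Metric.infDist_zero_of_mem hxN] at h1
      exact (molRadius_pos n).not_ge h1
    have hK : IsCompact K := (isCompact_closedBox 0 R).of_isClosed_subset
      (isClosed_le continuous_const ((Metric.continuous_infDist_pt N).comp hv))
      fun x hx => by_contra fun hxR => hKN x hx (hbox x hxR)
    have hKΩ : K ⊆ Ω := fun x hx => by_contra fun hxR => hKN x hx (hcompl x hxR)
    have hfc : Continuous (f n) := continuous_iff_continuousAt.2 fun t => (hf n t).continuousAt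
    have h1 := OrthSolenoidal.integral_eq_zero (q := q) hΩ hK hKΩ
      (hw.comp_deriv isOpen_univ (hv.locallyIntegrable.locallyIntegrableOn _)
        (fun i => (hGl i).locallyIntegrableOn _) (hf n) (hc n) (hb n))
      (hfc.comp hv).locallyIntegrable (fun i => ?_) (fun x hx => ?_) hg hgp
    · rw [← h1]
      congr 1
      ext x
      simp only [PiLp.smul_apply, smul_eq_mul]
      ring
    · refine (hGq i).of_le ?_ (ae_of_all _ fun x => ?_)
      · exact ((hc n).comp hv).aestronglyMeasurable.mul (hGq i).1
      · simp only [PiLp.smul_apply, smul_eq_mul, norm_mul]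
        exact mul_le_of_le_one_left (norm_nonneg _) (hb n _)
    · have : Metric.infDist (v x) N ≤ molRadius n := (not_le.1 hx).le
      simp only [hf0 n _ this, zero_smul]
  have hi : IntegrableOn (fun x => G x 1 * g x 0 - G x 0 * g x 1) Ω :=
    (((hGq 1).restrict Ω).integrable_mul (hgp 0)).sub (((hGq 0).restrict Ω).integrable_mul (hgp 1))
  have hl : Tendsto (fun n => ∫ x in Ω, h n (v x) * (G x 1 * g x 0 - G x 0 * g x 1)) atTop
      (𝓝 (∫ x in Ω, (G x 1 * g x 0 - G x 0 * g x 1))) := by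
    refine tendsto_integral_of_dominated_convergence
      (fun x => |G x 1 * g x 0 - G x 0 * g x 1|) (fun n => ?_) hi.abs
      (fun n => ae_of_all _ fun x => ?_) ?_
    · exact ((hc n).comp hv).aestronglyMeasurable.mul hi.1
    · rw [norm_mul, Real.norm_eq_abs, Real.norm_eq_abs]
      exact mul_le_of_le_one_left (abs_nonneg _) (hb n _)
    · filter_upwards [ae_restrict_of_ae (ae_eq_zero_of_mem_null hv hGl hw hNc hNe hN0)] with x hx
      by_cases hxN : v x ∈ N
      · simp [hx hxN]
      · simpa using (hlim _ hxN).mul_const (G x 1 * g x 0 - G x 0 * g x 1)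
  simp only [hn] at hl
  exact (tendsto_nhds_unique hl tendsto_const_nhds)

end Truncation

/-! ### Orthogonality on admissible domains -/

theorem Bornology.IsBounded.exists_subset_closedBox {Ω : Set Plane} (h : Bornology.IsBounded Ω) :
    ∃ R, Ω ⊆ closedBox 0 R := by
  obtain ⟨R, hR⟩ := h.subset_closedBall 0
  refine ⟨R, fun x hx i => ?_⟩
  have h1 : ‖x‖ ≤ R := by simpa using hR hx
  have h2 : ‖x i‖ ≤ ‖x‖ := PiLp.norm_apply_le x i
  simpa using h2.trans h1

/-- Let `Ω` be admissible and let `q` be the exponent conjugate to `p`. A field in `L^q` that is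
the `L¹` limit of divergence free test fields is orthogonal to the fields in `L^p` that are
orthogonal to the divergence free test fields. The rotation of the field is the gradient of a
function `V` that maps the complement of `Ω` to a null set. -/
theorem OrthSolenoidal.integral_eq_zero_of_tendsto {p q : ℝ≥0∞} [hpq : q.HolderConjugate p]
    (hp : p < 2) {Ω : Set Plane} (hΩ : IsAdmissibleDomain p.toReal Ω) {Φ g : Plane → Plane}
    (hΦ : ∀ i, MemLp (fun x => Φ x i) q (volume.restrict Ω)) {Ψ : Fin 2 → ℕ → Plane → ℝ}
    (hΨ : ∀ i n, IsTestOn Ω (Ψ i n)) (hdiv : ∀ n x, pd 0 (Ψ 0 n) x + pd 1 (Ψ 1 n) x = 0)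
    (hlim : ∀ i, Tendsto (fun n => ∫ x in Ω, |Ψ i n x - Φ x i|) atTop (𝓝 0))
    (hg : OrthSolenoidal Ω g) (hgp : ∀ i, MemLp (fun x => g x i) p (volume.restrict Ω)) :
    ∫ x in Ω, (Φ x 0 * g x 0 + Φ x 1 * g x 1) = 0 := by
  have hq : 1 ≤ q := ENNReal.HolderConjugate.one_le q p
  have : p.HolderConjugate q := hpq.symm
  have hΩm := hΩ.isOpen.measurableSet
  have hfin : IsFiniteMeasure (volume.restrict Ω) :=
    ⟨by simpa using hΩ.isBounded.measure_lt_top⟩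
  obtain ⟨R, hR⟩ := hΩ.isBounded.exists_subset_closedBox
  choose φ hφ hφ0 hφ1 hφ2 using fun n => exists_stream_function hR (hΨ 0 n) (hΨ 1 n) (hdiv n)
  -- the gradients of the stream functions converge to the rotation of `Φ`, extended by zero
  let G : Plane → Plane := Ω.indicator fun x => !₂[-Φ x 1, Φ x 0]
  have hG0 : (fun x => G x 0) = Ω.indicator fun x => -Φ x 1 := by
    ext x
    by_cases hx : x ∈ Ω <;> simp [G, hx]
  have hG1 : (fun x => G x 1) = Ω.indicator fun x => Φ x 0 := by
    ext x
    by_cases hx : x ∈ Ω <;> simp [G, hx]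
  have hGq : ∀ i, MemLp (fun x => G x i) q := fun i => by
    fin_cases i
    · change MemLp (fun x => G x 0) q
      rw [hG0, memLp_indicator_iff_restrict hΩm]
      exact (hΦ 1).neg
    · change MemLp (fun x => G x 1) q
      rw [hG1, memLp_indicator_iff_restrict hΩm]
      exact hΦ 0
  have hGi : ∀ i, Integrable fun x => G x i := fun i => by
    fin_cases i
    · change Integrable (fun x => G x 0)
      rw [hG0, integrable_indicator_iff hΩm]
      exact ((hΦ 1).integrable hq).neg
    · change Integrable (fun x => G x 1)
      rw [hG1, integrable_indicator_iff hΩm]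
      exact (hΦ 0).integrable hq
  have hφΩ : ∀ n i, IsTestOn Ω (pd i (φ n)) := fun n i => by
    fin_cases i
    · exact (funext (hφ1 n) : pd 0 (φ n) = _) ▸ (hΨ 1 n).neg
    · exact (funext (hφ2 n) : pd 1 (φ n) = _) ▸ hΨ 0 n
  have hL : ∀ i, Tendsto (fun n => ∫ x, |pd i (φ n) x - G x i|) atTop (𝓝 0) := fun i => by
    have e : ∀ n, ∫ x, |pd i (φ n) x - G x i| = ∫ x in Ω, |pd i (φ n) x - G x i| := fun n => by
      refine (setIntegral_eq_integral_of_forall_compl_eq_zero fun x hx => ?_).symm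
      rw [(hφΩ n i).eq_zero hx]
      simp [G, hx]
    simp only [e]
    fin_cases i
    · refine (hlim 1).congr fun n => setIntegral_congr_fun hΩm fun x hx => ?_
      have : G x 0 = -Φ x 1 := by simp [G, hx]
      change |Ψ 1 n x - Φ x 1| = |pd 0 (φ n) x - G x 0|
      rw [this, hφ1, ← abs_neg]
      congr 1
      ring
    · refine (hlim 0).congr fun n => setIntegral_congr_fun hΩm fun x hx => ?_
      have : G x 1 = Φ x 0 := by simp [G, hx]
      change |Ψ 0 n x - Φ x 0| = |pd 1 (φ n) x - G x 1|
      rw [this, hφ2]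
  obtain ⟨v, hv, hv0, hw⟩ := exists_L1_limit hφ hφ0 hGi hL
  obtain ⟨V, hVc, hV, hVv, hVE⟩ := exists_continuous_rep hp hv hGq hw
  have hV0 : ∀ x, x ∉ closedBox 0 R → V x = 0 := fun x hx => by
    obtain ⟨ε, hε, hεx⟩ := Metric.isOpen_iff.1 (isClosed_closedBox 0 R).isOpen_compl x hx
    refine tendsto_nhds_unique (hV x) (tendsto_const_nhds.congr' ?_)
    filter_upwards [tendsto_molRadius.eventually (gt_mem_nhds hε)] with n hn
    exact (moll_eq_zero fun y hy =>
      hv0 y (hεx (Metric.closedBall_subset_ball hn hy))).symm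
  have hwV : IsWeakGradient univ V G := by
    rw [isWeakGradient_iff] at hw ⊢
    intro ψ hψ i
    rw [← hw ψ hψ i, setIntegral_univ, setIntegral_univ]
    refine integral_congr_ae ?_
    filter_upwards [hVv] with x hx
    rw [hx]
  obtain ⟨x, hxK, hxE⟩ := hΩ.exists_selection
  -- `V` is constant on each component of `Ωᶜ`, so its values there are those at the selected points
  have hnull : volume (V '' Ωᶜ) = 0 := by
    refine measure_mono_null ?_ (hVE _ hxE)
    rintro _ ⟨y, hy, rfl⟩
    let K : complComponents Ω := ⟨connectedComponentIn Ωᶜ y, y, hy, rfl⟩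
    refine ⟨x K, mem_range_self K, ?_⟩
    exact continuous_rep_eq_of_isPreconnected hφ hφΩ hGi hL hv hv0 hw hVc hV
      isPreconnected_connectedComponentIn (connectedComponentIn_subset Ωᶜ y) (hxK K)
      (mem_connectedComponentIn hy)
  have h1 := hg.integral_eq_zero_of_null hΩ.isOpen hVc hV0 hGq hwV hnull hgp
  rw [← h1]
  refine setIntegral_congr_fun hΩm fun y hy => ?_
  simp [G, hy]

/-! ### The converse of Hölder's inequality -/

/-- A function whose pairing with the bounded functions is bounded with respect to their `L^p` norm
belongs to `L^q`, where `q` is the conjugate exponent. -/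
theorem memLp_of_integral_mul_le {α : Type*} [MeasurableSpace α] {μ : Measure α}
    [IsFiniteMeasure μ] {p q : ℝ≥0∞} [hpq : q.HolderConjugate p] (hp : p ≠ ⊤) {φ : α → ℝ}
    (hφ : Integrable φ μ) {c : ℝ≥0}
    (h : ∀ f : α → ℝ, Measurable f → (∃ M, ∀ x, |f x| ≤ M) →
      ENNReal.ofReal (∫ x, φ x * f x ∂μ) ≤ c * eLpNorm f p μ) : MemLp φ q μ := by
  wlog hm : Measurable φ generalizing φ
  · obtain ⟨φ', hφ', hae⟩ := hφ.aestronglyMeasurable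
    refine (this (hφ.congr hae) (fun f hf hb => ?_) hφ'.measurable).ae_eq hae.symm
    have e : ∫ x, φ' x * f x ∂μ = ∫ x, φ x * f x ∂μ := integral_congr_ae (by
      filter_upwards [hae] with x hx
      rw [hx])
    rw [e]
    exact h f hf hb
  let σ : α → ℝ := fun x => if 0 ≤ φ x then 1 else -1
  have hσm : Measurable σ :=
    Measurable.ite (measurableSet_le measurable_const hm) measurable_const measurable_const
  have hσ : ∀ x, φ x * σ x = |φ x| := fun x => by
    by_cases hx : 0 ≤ φ x
    · simp [σ, hx, abs_of_nonneg]
    · simp [σ, hx, abs_of_neg (not_le.1 hx)]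
  have hσ1 : ∀ x, |σ x| = 1 := fun x => by
    by_cases hx : 0 ≤ φ x <;> simp [σ, hx]
  rcases eq_or_ne q ⊤ with rfl | hq
  · have hp1 : p = 1 := by
      simpa using ENNReal.HolderConjugate.inv_add_inv_eq_one ⊤ p
    subst hp1
    let s : Set α := {x | (c : ℝ) < |φ x|}
    have hs : MeasurableSet s := measurableSet_lt measurable_const hm.abs
    have h1 := h (s.indicator σ) (hσm.indicator hs) ⟨1, fun x => by
      by_cases hx : x ∈ s <;> simp [hx, hσ1]⟩
    have e1 : ∫ x, φ x * s.indicator σ x ∂μ = ∫ x in s, |φ x| ∂μ := by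
      rw [← integral_indicator hs]
      congr 1
      ext x
      by_cases hx : x ∈ s <;> simp [hx, hσ]
    have e2 : eLpNorm (s.indicator σ) 1 μ = μ s := by
      rw [eLpNorm_one_eq_lintegral_enorm, ← lintegral_indicator_one hs]
      congr 1
      ext x
      by_cases hx : x ∈ s
      · simp [hx, Real.enorm_eq_ofReal_abs, hσ1]
      · simp [hx]
    rw [e1, e2, ofReal_integral_eq_lintegral_ofReal hφ.abs.integrableOn
      (ae_of_all _ fun x => abs_nonneg _)] at h1
    have hs0 : μ s = 0 := by
      by_contra hne
      have h2 : ∫⁻ _x in s, (c : ℝ≥0∞) ∂μ < ∫⁻ x in s, ENNReal.ofReal |φ x| ∂μ := by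
        refine setLIntegral_strict_mono hs hne hm.abs.ennreal_ofReal ?_ (ae_of_all _ fun x hx => ?_)
        · rw [setLIntegral_const]
          exact ENNReal.mul_ne_top (by simp) (measure_ne_top μ s)
        · rw [← ENNReal.ofReal_coe_nnreal]
          exact ENNReal.ofReal_lt_ofReal_iff_of_nonneg c.2 |>.2 hx
      rw [setLIntegral_const] at h2
      exact h2.not_ge h1
    refine memLp_top_of_bound hφ.1 c ?_
    filter_upwards [measure_eq_zero_iff_ae_notMem.1 hs0] with x hx
    exact not_lt.1 hx
  · have hr : q.toReal.HolderConjugate p.toReal :=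
      ENNReal.HolderConjugate.toReal_of_ne_top hq hp
    have hq0 : q ≠ 0 := ENNReal.HolderConjugate.ne_zero q p
    have hp0 : p ≠ 0 := ENNReal.HolderConjugate.ne_zero p q
    have hqp := hr.pos
    have hpp := hr.symm.pos
    let s : ℕ → Set α := fun n => {x | |φ x| ≤ n}
    have hs : ∀ n, MeasurableSet (s n) := fun n => measurableSet_le hm.abs measurable_const
    let A : ℕ → ℝ≥0∞ := fun n => ∫⁻ x in s n, ‖φ x‖ₑ ^ q.toReal ∂μ
    have hAt : ∀ n, A n ≠ ⊤ := fun n => by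
      refine ne_top_of_le_ne_top (ENNReal.mul_ne_top
        (ENNReal.rpow_ne_top_of_nonneg hqp.le (ENNReal.natCast_ne_top n)) (measure_ne_top μ (s n)))
        (setLIntegral_const (μ := μ) (s n) ((n : ℝ≥0∞) ^ q.toReal) ▸
          setLIntegral_mono measurable_const fun x hx => ?_)
      refine ENNReal.rpow_le_rpow ?_ hqp.le
      rw [Real.enorm_eq_ofReal_abs, ← ENNReal.ofReal_natCast]
      exact ENNReal.ofReal_le_ofReal hx
    have hA : ∀ n, A n ≤ (c : ℝ≥0∞) ^ q.toReal := fun n => by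
      let f : α → ℝ := (s n).indicator fun x => σ x * |φ x| ^ (q.toReal - 1)
      have hf : Measurable f := (hσm.mul (hm.abs.pow_const _)).indicator (hs n)
      have hfb : ∀ x, |f x| ≤ (n : ℝ) ^ (q.toReal - 1) := fun x => by
        by_cases hx : x ∈ s n
        · have : f x = σ x * |φ x| ^ (q.toReal - 1) := indicator_of_mem hx _
          rw [this, abs_mul, hσ1, one_mul, abs_of_nonneg (by positivity)]
          exact Real.rpow_le_rpow (abs_nonneg _) hx hr.sub_one_pos.le
        · have : f x = 0 := indicator_of_notMem hx _
          rw [this, abs_zero]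
          positivity
      have h1 := h f hf ⟨_, hfb⟩
      have hmul : ∀ x, φ x * f x = (s n).indicator (fun x => |φ x| ^ q.toReal) x := fun x => by
        by_cases hx : x ∈ s n
        · simp only [f, indicator_of_mem hx, ← mul_assoc, hσ]
          rcases eq_or_ne (φ x) 0 with h0 | h0
          · simp [h0, hqp.ne']
          · rw [Real.rpow_sub_one (abs_ne_zero.2 h0), mul_div_cancel₀ _ (abs_ne_zero.2 h0)]
        · simp [f, hx]
      have e1 : ENNReal.ofReal (∫ x, φ x * f x ∂μ) = A n := by
        have hi : Integrable (fun x => φ x * f x) μ :=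
          hφ.mul_bdd (c := (n : ℝ) ^ (q.toReal - 1)) hf.aestronglyMeasurable
            (ae_of_all _ hfb)
        rw [ofReal_integral_eq_lintegral_ofReal hi (ae_of_all _ fun x => ?_)]
        · simp only [hmul, A]
          rw [← lintegral_indicator (hs n)]
          congr 1
          ext x
          by_cases hx : x ∈ s n
          · simp only [indicator_of_mem hx]
            rw [Real.enorm_eq_ofReal_abs, ENNReal.ofReal_rpow_of_nonneg (abs_nonneg _) hqp.le]
          · simp [hx]
        · simp only [hmul, Pi.zero_apply]
          exact indicator_nonneg (fun x _ => by positivity) x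
      have e2 : eLpNorm f p μ = A n ^ (1 / p.toReal) := by
        rw [eLpNorm_eq_lintegral_rpow_enorm_toReal hp0 hp]
        congr 1
        simp only [A]
        rw [← lintegral_indicator (hs n)]
        congr 1
        ext x
        by_cases hx : x ∈ s n
        · have : f x = σ x * |φ x| ^ (q.toReal - 1) := indicator_of_mem hx _
          rw [this, indicator_of_mem hx, Real.enorm_eq_ofReal_abs, Real.enorm_eq_ofReal_abs,
            abs_mul, hσ1, one_mul, abs_of_nonneg (by positivity : 0 ≤ |φ x| ^ (q.toReal - 1)),
            ENNReal.ofReal_rpow_of_nonneg (by positivity) hpp.le,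
            ENNReal.ofReal_rpow_of_nonneg (abs_nonneg _) hqp.le, ← Real.rpow_mul (abs_nonneg _),
            hr.sub_one_mul_conj]
        · have : f x = 0 := indicator_of_notMem hx _
          rw [this, indicator_of_notMem hx, enorm_zero, ENNReal.zero_rpow_of_pos hpp]
      rw [e1, e2] at h1
      rcases eq_or_ne (A n) 0 with h0 | h0
      · rw [h0]; exact zero_le
      · have h2 : A n = A n ^ (1 / q.toReal) * A n ^ (1 / p.toReal) := by
          rw [← ENNReal.rpow_add _ _ h0 (hAt n), one_div, one_div, hr.inv_add_inv_eq_one,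
            ENNReal.rpow_one]
        have h3 : A n ^ (1 / p.toReal) ≠ 0 := (ENNReal.rpow_pos (pos_iff_ne_zero.2 h0) (hAt n)).ne'
        have h4 : A n ^ (1 / p.toReal) ≠ ⊤ := ENNReal.rpow_ne_top_of_nonneg (by positivity) (hAt n)
        rw [h2] at h1
        nth_rw 2 [← h2] at h1
        have h5 : A n ^ (1 / q.toReal) ≤ c := (ENNReal.mul_le_mul_iff_left h3 h4).1 h1
        have h6 := ENNReal.rpow_le_rpow h5 hqp.le
        rwa [← ENNReal.rpow_mul, one_div_mul_cancel hqp.ne', ENNReal.rpow_one] at h6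
    refine ⟨hφ.1, (eLpNorm_lt_top_iff_lintegral_rpow_enorm_lt_top hq0 hq).2 ?_⟩
    have hU : ⋃ n, s n = univ := eq_univ_of_forall fun x => mem_iUnion.2 (exists_nat_ge |φ x|)
    have hmono : Monotone s := fun m n hmn x hx =>
      le_trans (show |φ x| ≤ m from hx) (by exact_mod_cast hmn)
    have e3 := setLIntegral_iUnion_of_directed (μ := μ) (fun x => ‖φ x‖ₑ ^ q.toReal)
      hmono.directed_le
    rw [hU, setLIntegral_univ] at e3
    rw [e3]
    exact (iSup_le hA).trans_lt
      (ENNReal.rpow_lt_top_of_nonneg hqp.le ENNReal.coe_ne_top)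

/-! ### Density of the square integrable fields -/

section Duality

variable {μ : Measure Plane} [IsFiniteMeasure μ]

/-- The inclusion of `L²(μ, ℝ²)` in `L^p(μ, ℝ²)`, for a finite measure `μ` and `p ≤ 2`. -/
def l2Inclusion (μ : Measure Plane) [IsFiniteMeasure μ] {p : ℝ≥0∞} [Fact (1 ≤ p)] (hp : p ≤ 2) :
    Lp Plane 2 μ →L[ℝ] Lp Plane p μ :=
  LinearMap.mkContinuous
    { toFun := fun f => ((Lp.memLp f).mono_exponent hp).toLp f
      map_add' := fun f g => by
        rw [← MemLp.toLp_add]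
        exact MemLp.toLp_congr _ _ (Lp.coeFn_add f g)
      map_smul' := fun c f => by
        rw [RingHom.id_apply, ← MemLp.toLp_const_smul]
        exact MemLp.toLp_congr _ _ (Lp.coeFn_smul c f) }
    (μ univ ^ (1 / p.toReal - 1 / (2 : ℝ≥0∞).toReal)).toReal fun f => by
      have hp0 : 0 < p.toReal := ENNReal.toReal_pos
        (zero_lt_one.trans_le (Fact.out : 1 ≤ p)).ne' (hp.trans_lt ENNReal.ofNat_lt_top).ne
      have hp2 : p.toReal ≤ (2 : ℝ≥0∞).toReal := ENNReal.toReal_mono (by simp) hp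
      have ht : μ univ ^ (1 / p.toReal - 1 / (2 : ℝ≥0∞).toReal) ≠ ⊤ :=
        ENNReal.rpow_ne_top_of_nonneg (sub_nonneg.2 (one_div_le_one_div_of_le hp0 hp2))
          (measure_ne_top μ univ)
      have h1 := eLpNorm_le_eLpNorm_mul_rpow_measure_univ hp (Lp.aestronglyMeasurable f)
      have h2 := ENNReal.toReal_mono (ENNReal.mul_ne_top (Lp.memLp f).2.ne ht) h1
      rw [ENNReal.toReal_mul, mul_comm] at h2
      change ‖((Lp.memLp f).mono_exponent hp).toLp f‖ ≤ _
      rwa [Lp.norm_toLp, Lp.norm_def]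

theorem coeFn_l2Inclusion {p : ℝ≥0∞} [Fact (1 ≤ p)] (hp : p ≤ 2) (f : Lp Plane 2 μ) :
    l2Inclusion μ hp f =ᵐ[μ] f := MemLp.coeFn_toLp ((Lp.memLp f).mono_exponent hp)

theorem l2Inclusion_toLp {p : ℝ≥0∞} [Fact (1 ≤ p)] (hp : p ≤ 2) {f : Plane → Plane}
    (hf : MemLp f 2 μ) : l2Inclusion μ hp (hf.toLp f) = (hf.mono_exponent hp).toLp f := by
  refine Lp.ext ?_
  filter_upwards [coeFn_l2Inclusion hp (hf.toLp f), hf.coeFn_toLp,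
    (hf.mono_exponent hp).coeFn_toLp] with x h1 h2 h3
  rw [h1, h2, h3]

theorem inner_plane (a b : Plane) : inner ℝ a b = a 0 * b 0 + a 1 * b 1 := by
  simp [PiLp.inner_apply, Fin.sum_univ_two, mul_comm]

end Duality

theorem MeasureTheory.MemLp.coord {μ : Measure Plane} {p : ℝ≥0∞} {g : Plane → Plane}
    (hg : MemLp g p μ) (i : Fin 2) : MemLp (fun x => g x i) p μ :=
  (EuclideanSpace.proj (𝕜 := ℝ) i).comp_memLp' hg

theorem IsTestOn.memLp_field {Ω : Set Plane} {Ψ₀ Ψ₁ : Plane → ℝ} (h₀ : IsTestOn Ω Ψ₀)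
    (h₁ : IsTestOn Ω Ψ₁) (μ : Measure Plane) [IsFiniteMeasure μ] (p : ℝ≥0∞) :
    MemLp (fun x => (!₂[Ψ₀ x, Ψ₁ x] : Plane)) p μ := by
  obtain ⟨C₀, hC₀⟩ := h₀.exists_bound
  obtain ⟨C₁, hC₁⟩ := h₁.exists_bound
  have e : (fun x => (!₂[Ψ₀ x, Ψ₁ x] : Plane)) = fun x =>
      Ψ₀ x • (EuclideanSpace.single 0 1 : Plane) + Ψ₁ x • (EuclideanSpace.single 1 1 : Plane) := by
    ext x i
    fin_cases i <;> simp
  rw [e]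
  refine MemLp.of_bound ((h₀.continuous.smul continuous_const).add
    (h₁.continuous.smul continuous_const)).aestronglyMeasurable (C₀ + C₁) (ae_of_all _ fun x => ?_)
  refine (norm_add_le _ _).trans (add_le_add ?_ ?_)
  · simpa [norm_smul] using hC₀ x
  · simpa [norm_smul] using hC₁ x

/-- The classes in `L²(Ω, ℝ²)` of the divergence free test fields. -/
def solenoidalTests (Ω : Set Plane) : Submodule ℝ (Lp Plane 2 (volume.restrict Ω)) where
  carrier := {f | ∃ Ψ₀ Ψ₁ : Plane → ℝ, IsTestOn Ω Ψ₀ ∧ IsTestOn Ω Ψ₁ ∧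
    (∀ x, pd 0 Ψ₀ x + pd 1 Ψ₁ x = 0) ∧ ∀ᵐ x ∂volume.restrict Ω, f x = !₂[Ψ₀ x, Ψ₁ x]}
  zero_mem' := by
    refine ⟨_, _, IsTestOn.zero, IsTestOn.zero, fun x => by simp [pd], ?_⟩
    filter_upwards [Lp.coeFn_zero Plane 2 (volume.restrict Ω)] with x hx
    rw [hx]
    ext i
    fin_cases i <;> rfl
  add_mem' := by
    rintro f f' ⟨Ψ₀, Ψ₁, h₀, h₁, hd, hf⟩ ⟨Ψ₀', Ψ₁', h₀', h₁', hd', hf'⟩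
    refine ⟨_, _, h₀.add h₀', h₁.add h₁', fun x => ?_, ?_⟩
    · rw [pd_add h₀.differentiable h₀'.differentiable, pd_add h₁.differentiable h₁'.differentiable]
      linarith [hd x, hd' x]
    · filter_upwards [hf, hf', Lp.coeFn_add f f'] with x h1 h2 h3
      rw [h3, Pi.add_apply, h1, h2]
      ext i
      fin_cases i <;> simp
  smul_mem' := by
    rintro c f ⟨Ψ₀, Ψ₁, h₀, h₁, hd, hf⟩
    refine ⟨_, _, h₀.const_mul c, h₁.const_mul c, fun x => ?_, ?_⟩
    · rw [pd_const_mul h₀.differentiable, pd_const_mul h₁.differentiable, ← mul_add, hd, mul_zero]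
    · filter_upwards [hf, Lp.coeFn_smul c f] with x h1 h2
      rw [h2, Pi.smul_apply, h1]
      ext i
      fin_cases i <;> simp

/-- In `L²`, orthogonality to `solenoidalTests Ω` in the sense of Hilbert spaces gives
`OrthSolenoidal`. -/
theorem orthSolenoidal_of_mem_orthogonal {Ω : Set Plane} [IsFiniteMeasure (volume.restrict Ω)]
    {f : Lp Plane 2 (volume.restrict Ω)} (hf : f ∈ (solenoidalTests Ω)ᗮ) :
    OrthSolenoidal Ω f := by
  intro Ψ₀ Ψ₁ h₀ h₁ hd
  have hm := h₀.memLp_field h₁ (volume.restrict Ω) 2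
  have h := (Submodule.mem_orthogonal _ _).1 hf (hm.toLp _)
    ⟨Ψ₀, Ψ₁, h₀, h₁, hd, hm.coeFn_toLp⟩
  have hfi : IntegrableOn f Ω := (Lp.memLp f).integrable (by norm_num)
  rw [← integral_add
    (integrableOn_mul_of_isTestOn (IntegrableOn.coord hfi 0).locallyIntegrableOn h₀)
    (integrableOn_mul_of_isTestOn (IntegrableOn.coord hfi 1).locallyIntegrableOn h₁), ← h,
    L2.inner_def]
  refine integral_congr_ae ?_
  filter_upwards [hm.coeFn_toLp] with x hx
  rw [hx, inner_plane]
  simp [mul_comm]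

/-- A continuous linear functional on `L^p(Ω, ℝ²)`, `p ≤ 2`, that vanishes on the square integrable
fields orthogonal to the divergence free test fields is represented by a field in `L^q`, with `q`
conjugate to `p`, that is the `L¹` limit of divergence free test fields. -/
theorem exists_representation {p q : ℝ≥0∞} [Fact (1 ≤ p)] [hpq : q.HolderConjugate p] (hp : p ≤ 2)
    {Ω : Set Plane} [IsFiniteMeasure (volume.restrict Ω)]
    (ℓ : Lp Plane p (volume.restrict Ω) →L[ℝ] ℝ)
    (hℓ : ∀ f ∈ (solenoidalTests Ω)ᗮ, ℓ (l2Inclusion _ hp f) = 0) :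
    ∃ (Φ : Plane → Plane) (Ψ : Fin 2 → ℕ → Plane → ℝ),
      (∀ i, MemLp (fun x => Φ x i) q (volume.restrict Ω)) ∧ (∀ i n, IsTestOn Ω (Ψ i n)) ∧
      (∀ n x, pd 0 (Ψ 0 n) x + pd 1 (Ψ 1 n) x = 0) ∧
      (∀ i, Tendsto (fun n => ∫ x in Ω, |Ψ i n x - Φ x i|) atTop (𝓝 0)) ∧
      ∀ g : Lp Plane p (volume.restrict Ω), ℓ g = ∫ x in Ω, (Φ x 0 * g x 0 + Φ x 1 * g x 1) := by
  have hpt : p ≠ ⊤ := (hp.trans_lt ENNReal.ofNat_lt_top).ne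
  -- The Riesz representative of the restriction of `ℓ` to `L²`. Its pairing with square integrable
  -- fields is bounded by the `L^p` norm, which puts it in `L^q`.
  let Φ : Lp Plane 2 (volume.restrict Ω) :=
    (InnerProductSpace.toDual ℝ _).symm (ℓ.comp (l2Inclusion (volume.restrict Ω) hp))
  have hΦ : ∀ f, inner ℝ Φ f = ℓ (l2Inclusion (volume.restrict Ω) hp f) := fun f => by
    simp [Φ]
  have hΦi : Integrable Φ (volume.restrict Ω) := (Lp.memLp Φ).integrable (by norm_num)
  have hΦq : ∀ i, MemLp (fun x => Φ x i) q (volume.restrict Ω) := fun i => by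
    refine memLp_of_integral_mul_le (p := p) (c := ‖ℓ‖₊) hpt (IntegrableOn.coord hΦi i)
      fun f hf ⟨M, hM⟩ => ?_
    let F : Plane → Plane := fun x => f x • EuclideanSpace.single i 1
    have hF : MemLp F 2 (volume.restrict Ω) :=
      MemLp.of_bound (hf.aestronglyMeasurable.smul_const _) M
        (ae_of_all _ fun x => by simpa [F, norm_smul] using hM x)
    have e1 : ∫ x, Φ x i * f x ∂(volume.restrict Ω) =
        ℓ (l2Inclusion (volume.restrict Ω) hp (hF.toLp F)) := by
      rw [← hΦ, L2.inner_def]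
      refine integral_congr_ae ?_
      filter_upwards [hF.coeFn_toLp] with x hx
      rw [hx, inner_plane]
      fin_cases i <;> simp [F]
    have e2 : ‖l2Inclusion (volume.restrict Ω) hp (hF.toLp F)‖ =
        (eLpNorm f p (volume.restrict Ω)).toReal := by
      rw [l2Inclusion_toLp, Lp.norm_toLp]
      congr 1
      refine eLpNorm_congr_norm_ae (ae_of_all _ fun x => ?_)
      simp [F, norm_smul]
    have hft : eLpNorm f p (volume.restrict Ω) ≠ ⊤ :=
      (MemLp.of_bound hf.aestronglyMeasurable M (ae_of_all _ hM)).2.ne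
    have h1 := (le_abs_self _).trans (ℓ.le_opNorm (l2Inclusion (volume.restrict Ω) hp (hF.toLp F)))
    rw [← e1, e2] at h1
    refine (ENNReal.ofReal_le_ofReal h1).trans (le_of_eq ?_)
    rw [ENNReal.ofReal_mul (norm_nonneg _), ENNReal.ofReal_toReal hft, ofReal_norm]
    rfl
  -- `Φ` is orthogonal to the orthogonal complement of the divergence free test fields
  have hcl : Φ ∈ closure (solenoidalTests Ω : Set (Lp Plane 2 (volume.restrict Ω))) := by
    rw [← Submodule.topologicalClosure_coe, SetLike.mem_coe,
      ← Submodule.orthogonal_orthogonal_eq_closure, Submodule.mem_orthogonal]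
    intro f hf
    rw [real_inner_comm, hΦ]
    exact hℓ f hf
  obtain ⟨D, hD, hDΦ⟩ := mem_closure_iff_seq_limit.1 hcl
  choose Ψ₀ Ψ₁ h₀ h₁ hd hDe using hD
  refine ⟨Φ, ![Ψ₀, Ψ₁], hΦq, fun i n => ?_, hd, fun i => ?_, fun g => ?_⟩
  · fin_cases i
    · exact h₀ n
    · exact h₁ n
  · have : Fact ((1 : ℝ≥0∞) ≤ 1) := ⟨le_rfl⟩
    have h1 := ((l2Inclusion (volume.restrict Ω) (p := 1)
      (by norm_num)).continuous.tendsto Φ).comp hDΦ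
    rw [tendsto_iff_dist_tendsto_zero] at h1
    refine squeeze_zero (fun n => integral_nonneg fun x => abs_nonneg _) (fun n => ?_) h1
    simp only [Function.comp_apply]
    rw [L1.dist_eq_integral_dist]
    refine integral_mono_of_nonneg (ae_of_all _ fun x => abs_nonneg _) ?_ ?_
    · simp only [dist_eq_norm]
      exact ((L1.integrable_coeFn _).sub (L1.integrable_coeFn _)).norm
    · filter_upwards [hDe n, coeFn_l2Inclusion (p := 1) (by norm_num) (D n),
        coeFn_l2Inclusion (p := 1) (by norm_num) Φ] with x a1 a2 a3
      rw [a2, a3, a1, dist_eq_norm]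
      refine le_trans (le_of_eq ?_) (PiLp.norm_apply_le _ i)
      fin_cases i <;> simp
  -- `ℓ` and the integral agree on `L²`, hence on `L^p`, by approximation with simple functions
  · choose s hs hsp using fun n : ℕ => (Lp.memLp g).exists_simpleFunc_eLpNorm_sub_lt hpt
      (ENNReal.ofReal_pos.2 (molRadius_pos n)).ne'
    have hs2 : ∀ n, MemLp (s n) 2 (volume.restrict Ω) := fun n =>
      (s n).memLp_of_isFiniteMeasure 2 (volume.restrict Ω)
    have hsg : Tendsto (fun n => eLpNorm (⇑(s n) - ⇑g) p (volume.restrict Ω)) atTop (𝓝 0) := by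
      refine tendsto_of_tendsto_of_tendsto_of_le_of_le tendsto_const_nhds
        (by simpa using ENNReal.tendsto_ofReal tendsto_molRadius) (fun _ => zero_le) fun n => ?_
      rw [eLpNorm_sub_comm]
      exact (hs n).le
    have l1 : Tendsto (fun n => l2Inclusion (volume.restrict Ω) hp ((hs2 n).toLp _)) atTop
        (𝓝 g) := by
      rw [Lp.tendsto_Lp_iff_tendsto_eLpNorm']
      refine hsg.congr fun n => eLpNorm_congr_ae ?_
      filter_upwards [coeFn_l2Inclusion hp ((hs2 n).toLp _), (hs2 n).coeFn_toLp] with x a1 a2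
      simp only [Pi.sub_apply]
      rw [a1, a2]
    have l2 := (ℓ.continuous.tendsto g).comp l1
    have hpq' : p.HolderConjugate q := hpq.symm
    have hc : ∀ i, Tendsto (fun n => ∫ x, s n x i * Φ x i ∂(volume.restrict Ω)) atTop
        (𝓝 (∫ x, g x i * Φ x i ∂(volume.restrict Ω))) := by
      intro i
      refine tendsto_integral_mul_of_tendsto_eLpNorm (q := p) (p := q)
        (fun n => ((hsp n).coord i).1) ((Lp.memLp g).coord i) (hΦq i) ?_
      refine tendsto_of_tendsto_of_tendsto_of_le_of_le tendsto_const_nhds hsg (fun _ => zero_le)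
        fun n => eLpNorm_mono fun x => ?_
      exact PiLp.norm_apply_le (s n x - g x) i
    have l3 := (hc 0).add (hc 1)
    have hgi : ∀ i, Integrable (fun x => g x i * Φ x i) (volume.restrict Ω) := fun i =>
      ((Lp.memLp g).coord i).integrable_mul (hΦq i)
    rw [← integral_add (hgi 0) (hgi 1)] at l3
    have l4 := tendsto_nhds_unique l2 (l3.congr fun n => ?_)
    · rw [l4]
      refine integral_congr_ae (ae_of_all _ fun x => ?_)
      simp only [mul_comm]
    · have hsi : ∀ i, Integrable (fun x => s n x i * Φ x i) (volume.restrict Ω) := fun i =>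
        ((hsp n).coord i).integrable_mul (hΦq i)
      rw [Function.comp_apply, ← hΦ, L2.inner_def, ← integral_add (hsi 0) (hsi 1)]
      refine integral_congr_ae ?_
      filter_upwards [(hs2 n).coeFn_toLp] with x a1
      rw [a1, inner_plane]
      ring

/-- On an admissible domain the square integrable fields orthogonal to the divergence free test
fields are dense, in the `L^p` norm, among those in `L^p`. -/
theorem OrthSolenoidal.exists_tendsto {p : ℝ≥0∞} [Fact (1 ≤ p)] (hp : p < 2) {Ω : Set Plane}
    (hΩ : IsAdmissibleDomain p.toReal Ω) {g : Plane → Plane} (hg : OrthSolenoidal Ω g)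
    (hgp : MemLp g p (volume.restrict Ω)) :
    ∃ f : ℕ → Plane → Plane, (∀ n, MemLp (f n) 2 (volume.restrict Ω)) ∧
      (∀ n, OrthSolenoidal Ω (f n)) ∧
      Tendsto (fun n => eLpNorm (f n - g) p (volume.restrict Ω)) atTop (𝓝 0) := by
  have hfin : IsFiniteMeasure (volume.restrict Ω) :=
    ⟨by simpa using hΩ.isBounded.measure_lt_top⟩
  have hq : p.HolderConjugate p.conjExponent := ENNReal.HolderConjugate.conjExponent Fact.out
  have hq' : p.conjExponent.HolderConjugate p := hq.symm
  let S : Submodule ℝ (Lp Plane p (volume.restrict Ω)) :=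
    (solenoidalTests Ω)ᗮ.map (l2Inclusion (volume.restrict Ω) hp.le).toLinearMap
  have hmem : hgp.toLp g ∈ closure (S : Set (Lp Plane p (volume.restrict Ω))) := by
    by_contra hnot
    obtain ⟨ℓ, u, hℓS, hℓg⟩ := geometric_hahn_banach_closed_point
      S.topologicalClosure.convex isClosed_closure hnot
    have h0 : 0 < ℓ (hgp.toLp g) := by
      have := hℓS 0 (subset_closure S.zero_mem)
      rw [map_zero] at this
      exact this.trans hℓg
    have hzero : ∀ f ∈ (solenoidalTests Ω)ᗮ, ℓ (l2Inclusion _ hp.le f) = 0 := by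
      intro f hf
      by_contra hne
      have h1 : ∀ c : ℝ, c * ℓ (l2Inclusion _ hp.le f) < u := fun c => by
        have := hℓS _ (subset_closure (S.smul_mem c (Submodule.mem_map_of_mem hf)))
        simpa using this
      have h2 := h1 (u / ℓ (l2Inclusion _ hp.le f))
      rw [div_mul_cancel₀ _ hne] at h2
      exact lt_irrefl _ h2
    obtain ⟨Φ, Ψ, hΦq, hΨ, hd, hlim, hrep⟩ := exists_representation (q := p.conjExponent) hp.le ℓ
      hzero
    have h3 := hg.integral_eq_zero_of_tendsto hp hΩ hΦq hΨ hd hlim fun i => hgp.coord i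
    rw [hrep] at h0
    refine h0.ne' (Eq.trans (integral_congr_ae ?_) h3)
    filter_upwards [hgp.coeFn_toLp] with x hx
    rw [hx]
  obtain ⟨F, hF, hFg⟩ := mem_closure_iff_seq_limit.1 hmem
  choose f hf hfF using hF
  refine ⟨fun n => f n, fun n => Lp.memLp _, fun n => orthSolenoidal_of_mem_orthogonal (hf n), ?_⟩
  rw [Lp.tendsto_Lp_iff_tendsto_eLpNorm'] at hFg
  refine hFg.congr fun n => eLpNorm_congr_ae ?_
  filter_upwards [hgp.coeFn_toLp, coeFn_l2Inclusion hp.le (f n)] with x a1 a2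
  rw [Pi.sub_apply, Pi.sub_apply, a1, ← hfF]
  exact congrArg (· - g x) a2

/-! ### Truncations and the Sobolev space -/

/-- Smooth bounded truncations of the identity: `arctan (c t) / c` with `c → 0`. -/
theorem exists_truncation : ∃ f h : ℕ → ℝ → ℝ, (∀ n t, HasDerivAt (f n) (h n t) t) ∧
    (∀ n, Continuous (h n)) ∧ (∀ n t, |h n t| ≤ 1) ∧ (∀ n t, |f n t| ≤ |t|) ∧
    (∀ n, ∃ C, ∀ t, |f n t| ≤ C) ∧ (∀ t, Tendsto (fun n => f n t) atTop (𝓝 t)) ∧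
    ∀ t, Tendsto (fun n => h n t) atTop (𝓝 1) := by
  let f : ℕ → ℝ → ℝ := fun n t => Real.arctan (molRadius n * t) / molRadius n
  let h : ℕ → ℝ → ℝ := fun n t => 1 / (1 + (molRadius n * t) ^ 2)
  have hder : ∀ n t, HasDerivAt (f n) (h n t) t := fun n t => by
    have h1 := (((hasDerivAt_id t).const_mul (molRadius n)).arctan).div_const (molRadius n)
    refine h1.congr_deriv ?_
    have := (molRadius_pos n).ne'
    simp only [h, id_eq]
    field_simp
  have hb : ∀ n t, |h n t| ≤ 1 := fun n t => by
    rw [abs_of_nonneg (by positivity)]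
    exact div_le_one_of_le₀ (by nlinarith [sq_nonneg (molRadius n * t)]) (by positivity)
  refine ⟨f, h, hder, fun n => ?_, hb, fun n t => ?_, fun n => ⟨Real.pi / 2 / molRadius n,
    fun t => ?_⟩, fun t => ?_, fun t => ?_⟩
  · exact continuous_const.div (by fun_prop) fun t => by positivity
  · have h1 := convex_univ.norm_image_sub_le_of_norm_hasDerivWithin_le (f := f n) (C := 1)
      (fun s _ => (hder n s).hasDerivWithinAt) (fun s _ => hb n s) (mem_univ 0) (mem_univ t)
    simpa only [f, mul_zero, Real.arctan_zero, zero_div, sub_zero, one_mul, Real.norm_eq_abs]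
      using h1
  · simp only [f]
    rw [abs_div, abs_of_pos (molRadius_pos n)]
    have := (molRadius_pos n).le
    gcongr
    exact abs_le.2 ⟨(Real.neg_pi_div_two_lt_arctan _).le, (Real.arctan_lt_pi_div_two _).le⟩
  · have h1 : HasDerivAt (fun c : ℝ => Real.arctan (c * t)) t 0 := by
      have := ((hasDerivAt_id (0 : ℝ)).mul_const t).arctan
      simpa using this
    have h2 := (hasDerivAt_iff_tendsto_slope_zero.1 h1).comp
      (tendsto_nhdsWithin_iff.2 ⟨tendsto_molRadius,
        Eventually.of_forall fun n => (molRadius_pos n).ne'⟩)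
    refine h2.congr fun n => ?_
    simp [f, div_eq_inv_mul]
  · have h1 : Tendsto (fun n => 1 / (1 + (molRadius n * t) ^ 2)) atTop
        (𝓝 (1 / (1 + (0 * t) ^ 2))) :=
      tendsto_const_nhds.div (tendsto_const_nhds.add ((tendsto_molRadius.mul_const t).pow 2))
        (by simp)
    simpa [h] using h1

/-- Dominated convergence in `L^p`. -/
theorem tendsto_eLpNorm_sub_of_dominated {E : Type*} [NormedAddCommGroup E] {μ : Measure Plane}
    {p : ℝ≥0∞} (hp0 : p ≠ 0) (hp : p ≠ ⊤) {F : ℕ → Plane → E} {f : Plane → E} {B : Plane → ℝ}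
    (hF : ∀ n, AEStronglyMeasurable (F n) μ) (hf : AEStronglyMeasurable f μ) (hB : MemLp B p μ)
    (hFB : ∀ n x, ‖F n x - f x‖ ≤ B x)
    (hlim : ∀ᵐ x ∂μ, Tendsto (fun n => F n x) atTop (𝓝 (f x))) :
    Tendsto (fun n => eLpNorm (F n - f) p μ) atTop (𝓝 0) := by
  have hp' : 0 < p.toReal := ENNReal.toReal_pos hp0 hp
  simp only [eLpNorm_eq_lintegral_rpow_enorm_toReal hp0 hp, Pi.sub_apply]
  have h1 : Tendsto (fun n => ∫⁻ x, ‖F n x - f x‖ₑ ^ p.toReal ∂μ) atTop (𝓝 (∫⁻ _x, 0 ∂μ)) := by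
    refine tendsto_lintegral_of_dominated_convergence' (fun x => ‖B x‖ₑ ^ p.toReal)
      (fun n => (((hF n).sub hf).enorm).pow_const _) (fun n => ae_of_all _ fun x => ?_)
      (lintegral_rpow_enorm_lt_top_of_eLpNorm_lt_top hp0 hp hB.2).ne ?_
    · refine ENNReal.rpow_le_rpow ?_ hp'.le
      exact enorm_le_iff_norm_le.2 ((hFB n x).trans (le_abs_self _))
    · filter_upwards [hlim] with x hx
      have h2 := (hx.sub_const (f x)).enorm
      rw [sub_self, enorm_zero] at h2
      have h3 := (ENNReal.continuous_rpow_const (y := p.toReal)).tendsto 0 |>.comp h2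
      rwa [ENNReal.zero_rpow_of_pos hp'] at h3
  rw [lintegral_zero] at h1
  have h4 := (ENNReal.continuous_rpow_const (y := 1 / p.toReal)).tendsto 0 |>.comp h1
  rwa [ENNReal.zero_rpow_of_pos (by positivity)] at h4

/-- Functions whose `L¹` norms are summable converge to zero almost everywhere. -/
theorem ae_tendsto_zero_of_tsum_integral {μ : Measure Plane} {w : ℕ → Plane → ℝ}
    (hw : ∀ n, Integrable (w n) μ) {b : ℕ → ℝ} (hb : Summable b)
    (hwb : ∀ n, ∫ x, |w n x| ∂μ ≤ b n) :
    ∀ᵐ x ∂μ, Tendsto (fun n => w n x) atTop (𝓝 0) := by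
  have hm : ∀ n, AEMeasurable (fun x => ‖w n x‖ₑ) μ := fun n => (hw n).1.enorm
  have h1 : ∫⁻ x, ∑' n, ‖w n x‖ₑ ∂μ ≠ ⊤ := by
    rw [lintegral_tsum hm]
    refine ne_top_of_le_ne_top hb.tsum_ofReal_ne_top (ENNReal.tsum_le_tsum fun n => ?_)
    rw [← ofReal_integral_norm_eq_lintegral_enorm (hw n)]
    exact ENNReal.ofReal_le_ofReal (hwb n)
  filter_upwards [ae_lt_top' (AEMeasurable.tsum hm) h1] with x hx
  have h2 := ENNReal.tendsto_atTop_zero_of_tsum_ne_top hx.ne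
  rw [tendsto_zero_iff_norm_tendsto_zero]
  have h3 := (ENNReal.tendsto_toReal ENNReal.zero_ne_top).comp h2
  refine h3.congr fun n => ?_
  simp

section Sobolev

variable {Ω : Set Plane} {u u' : Plane → ℝ} {g g' : Plane → Plane}

theorem IsWeakGradient.congr_ae (h : IsWeakGradient Ω u g) (hu : u =ᵐ[volume.restrict Ω] u')
    (hg : g =ᵐ[volume.restrict Ω] g') : IsWeakGradient Ω u' g' := by
  rw [isWeakGradient_iff] at h ⊢
  intro φ hφ i
  have e1 : ∫ x in Ω, u' x * pd i φ x = ∫ x in Ω, u x * pd i φ x := integral_congr_ae (by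
    filter_upwards [hu] with x hx
    rw [hx])
  have e2 : ∫ x in Ω, g' x i * φ x = ∫ x in Ω, g x i * φ x := integral_congr_ae (by
    filter_upwards [hg] with x hx
    rw [hx])
  rw [e1, e2, h φ hφ i]

theorem IsWeakGradient.add (h : IsWeakGradient Ω u g) (h' : IsWeakGradient Ω u' g')
    (hu : LocallyIntegrableOn u Ω) (hu' : LocallyIntegrableOn u' Ω) (hg : IntegrableOn g Ω)
    (hg' : IntegrableOn g' Ω) : IsWeakGradient Ω (fun x => u x + u' x) (fun x => g x + g' x) := by
  rw [isWeakGradient_iff] at h h' ⊢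
  intro φ hφ i
  simp only [PiLp.add_apply, add_mul]
  rw [integral_add (integrableOn_mul_of_isTestOn hu (hφ.pd i))
    (integrableOn_mul_of_isTestOn hu' (hφ.pd i)),
    integral_add (integrableOn_mul_of_isTestOn (IntegrableOn.coord hg i).locallyIntegrableOn hφ)
    (integrableOn_mul_of_isTestOn (IntegrableOn.coord hg' i).locallyIntegrableOn hφ), h φ hφ i,
    h' φ hφ i]
  ring

theorem OrthSolenoidal.sub (h : OrthSolenoidal Ω g) (h' : OrthSolenoidal Ω g')
    (hg : IntegrableOn g Ω) (hg' : IntegrableOn g' Ω) :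
    OrthSolenoidal Ω (fun x => g x - g' x) := by
  intro Ψ₀ Ψ₁ h₀ h₁ hd
  have a := h Ψ₀ Ψ₁ h₀ h₁ hd
  have b := h' Ψ₀ Ψ₁ h₀ h₁ hd
  simp only [PiLp.sub_apply, sub_mul]
  rw [integral_sub (integrableOn_mul_of_isTestOn (IntegrableOn.coord hg 0).locallyIntegrableOn h₀)
    (integrableOn_mul_of_isTestOn (IntegrableOn.coord hg' 0).locallyIntegrableOn h₀),
    integral_sub (integrableOn_mul_of_isTestOn (IntegrableOn.coord hg 1).locallyIntegrableOn h₁)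
    (integrableOn_mul_of_isTestOn (IntegrableOn.coord hg' 1).locallyIntegrableOn h₁)]
  linarith

variable {p : ℝ≥0∞} [Fact (1 ≤ p)]

/-- The element of `W^{1,p}(Ω)` with underlying function `u` and weak gradient `g`. -/
def sobolevMk (hu : MemLp u p (volume.restrict Ω)) (hg : MemLp g p (volume.restrict Ω))
    (h : IsWeakGradient Ω u g) : SobolevSpace p Ω :=
  ⟨WithLp.toLp p (hu.toLp u, hg.toLp g), h.congr_ae hu.coeFn_toLp.symm hg.coeFn_toLp.symm⟩

theorem sobolevFun_sobolevMk (hu : MemLp u p (volume.restrict Ω))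
    (hg : MemLp g p (volume.restrict Ω)) (h : IsWeakGradient Ω u g) :
    sobolevFun (sobolevMk hu hg h) =ᵐ[volume.restrict Ω] u := hu.coeFn_toLp

/-- Convergence in `W^{1,p}(Ω)` is convergence of the functions and of their gradients in `L^p`. -/
theorem tendsto_sobolevMk {u' : ℕ → Plane → ℝ} {g' : ℕ → Plane → Plane}
    (hu' : ∀ n, MemLp (u' n) p (volume.restrict Ω)) (hg' : ∀ n, MemLp (g' n) p (volume.restrict Ω))
    (h' : ∀ n, IsWeakGradient Ω (u' n) (g' n)) (hu : MemLp u p (volume.restrict Ω))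
    (hg : MemLp g p (volume.restrict Ω)) (h : IsWeakGradient Ω u g)
    (hlu : Tendsto (fun n => eLpNorm (u' n - u) p (volume.restrict Ω)) atTop (𝓝 0))
    (hlg : Tendsto (fun n => eLpNorm (g' n - g) p (volume.restrict Ω)) atTop (𝓝 0)) :
    Tendsto (fun n => sobolevMk (hu' n) (hg' n) (h' n)) atTop (𝓝 (sobolevMk hu hg h)) := by
  rw [tendsto_subtype_rng]
  exact ((WithLp.prod_continuous_toLp p _ _).tendsto _).comp
    (((Lp.tendsto_Lp_iff_tendsto_eLpNorm'' _ hu' _ hu).2 hlu).prodMk_nhds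
      ((Lp.tendsto_Lp_iff_tendsto_eLpNorm'' _ hg' _ hg).2 hlg))

end Sobolev

/-! ### Density of `W^{1,2}` -/

/-- A bounded truncation of a function with weak gradient in `L^r` belongs to `W^{1,r}`, even if the
function is only locally integrable. -/
theorem exists_sobolev_truncation {Ω : Set Plane} [IsFiniteMeasure (volume.restrict Ω)]
    (hΩ : IsOpen Ω) {u : Plane → ℝ} {g : Plane → Plane} (hw : IsWeakGradient Ω u g)
    (hu : LocallyIntegrableOn u Ω) {r : ℝ≥0∞} (hr : 1 ≤ r) (hg : MemLp g r (volume.restrict Ω))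
    {f h : ℝ → ℝ} {C : ℝ} (hf : ∀ t, HasDerivAt f (h t) t) (hh : Continuous h)
    (hb : ∀ t, |h t| ≤ 1) (hfC : ∀ t, |f t| ≤ C) :
    MemLp (fun x => f (u x)) r (volume.restrict Ω) ∧
      MemLp (fun x => h (u x) • g x) r (volume.restrict Ω) ∧
      IsWeakGradient Ω (fun x => f (u x)) (fun x => h (u x) • g x) := by
  have hfc : Continuous f := continuous_iff_continuousAt.2 fun t => (hf t).continuousAt
  have hum := hu.aestronglyMeasurable
  refine ⟨MemLp.of_bound (hfc.comp_aestronglyMeasurable hum) C (ae_of_all _ fun x => hfC _),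
    hg.of_le ((hh.comp_aestronglyMeasurable hum).smul hg.1) (ae_of_all _ fun x => ?_),
    hw.comp_deriv hΩ hu (fun i => ?_) hf hh hb⟩
  · rw [norm_smul]
    exact mul_le_of_le_one_left (norm_nonneg _) (hb _)
  · exact (IntegrableOn.coord (hg.integrable hr) i).locallyIntegrableOn

/-- `W^{1,2}(Ω) ⊆ W^{1,p}(Ω)`, as `Ω` has finite measure. -/
theorem exists_sobolev_le {p : ℝ≥0∞} [Fact (1 ≤ p)] (hp : p ≤ 2) {Ω : Set Plane}
    [IsFiniteMeasure (volume.restrict Ω)] (v : SobolevSpace 2 Ω) :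
    ∃ w : SobolevSpace p Ω, sobolevFun w =ᵐ[volume.restrict Ω] sobolevFun v :=
  ⟨sobolevMk ((Lp.memLp v.1.fst).mono_exponent hp) ((Lp.memLp v.1.snd).mono_exponent hp) v.2,
    sobolevFun_sobolevMk _ _ _⟩

/-- Approximation of `u` by functions with square integrable weak gradient, which are only locally
integrable themselves, as the geometry of `Ω` gives no control near the boundary. The gradients
converge in `L^p`, the functions almost everywhere. -/
theorem exists_seq_gradient_tendsto {p : ℝ≥0∞} [Fact (1 ≤ p)] (hp : p < 2) {Ω : Set Plane}
    (hΩ : IsAdmissibleDomain p.toReal Ω) {u : Plane → ℝ} {g : Plane → Plane}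
    (hw : IsWeakGradient Ω u g) (hu : LocallyIntegrableOn u Ω)
    (hg : MemLp g p (volume.restrict Ω)) :
    ∃ (U : ℕ → Plane → ℝ) (G : ℕ → Plane → Plane), (∀ n, IsWeakGradient Ω (U n) (G n)) ∧
      (∀ n, LocallyIntegrableOn (U n) Ω) ∧ (∀ n, MemLp (G n) 2 (volume.restrict Ω)) ∧
      (∀ᵐ x ∂volume.restrict Ω, Tendsto (fun n => U n x) atTop (𝓝 (u x))) ∧
      Tendsto (fun n => eLpNorm (G n - g) p (volume.restrict Ω)) atTop (𝓝 0) := by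
  have hfin : IsFiniteMeasure (volume.restrict Ω) :=
    ⟨by simpa using hΩ.isBounded.measure_lt_top⟩
  have hp1 : 1 ≤ p := Fact.out
  have hgi : IntegrableOn g Ω := hg.integrable hp1
  have hgo := hw.orthSolenoidal hu
  obtain ⟨f, hf2, hfo, hfg⟩ := hgo.exists_tendsto hp hΩ hg
  have hfi : ∀ n, IntegrableOn (f n) Ω := fun n => (hf2 n).integrable (by norm_num)
  -- fast convergence in `L¹` along a subsequence makes the potentials of the differences converge
  have hL1 : Tendsto (fun n => ∫ x in Ω, ‖f n x - g x‖) atTop (𝓝 0) := by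
    have h1 : Tendsto (fun n => eLpNorm (f n - g) 1 (volume.restrict Ω)) atTop (𝓝 0) := by
      have hpt : p ≠ ⊤ := (hp.trans_le le_top).ne
      have hK : (volume.restrict Ω) univ ^ (1 / (1 : ℝ≥0∞).toReal - 1 / p.toReal) ≠ ⊤ := by
        refine ENNReal.rpow_ne_top_of_nonneg (sub_nonneg.2 ?_) (measure_ne_top _ _)
        exact one_div_le_one_div_of_le (by simp) (ENNReal.toReal_mono hpt hp1)
      have h2 := ENNReal.Tendsto.mul_const hfg (Or.inr hK)
      rw [zero_mul] at h2
      exact tendsto_of_tendsto_of_tendsto_of_le_of_le tendsto_const_nhds h2 (fun _ => zero_le)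
        fun n => eLpNorm_le_eLpNorm_mul_rpow_measure_univ hp1 ((hf2 n).1.sub hg.1)
    refine ((ENNReal.tendsto_toReal ENNReal.zero_ne_top).comp h1).congr fun n => ?_
    rw [Function.comp_apply, eLpNorm_one_eq_lintegral_enorm]
    exact (integral_norm_eq_lintegral_enorm ((hf2 n).1.sub hg.1)).symm
  have hsub : ∀ k : ℕ, ∃ N, ∀ n ≥ N, ∫ x in Ω, ‖f n x - g x‖ ≤ (1 / 2) ^ k := fun k =>
    eventually_atTop.1 (hL1.eventually (ge_mem_nhds (by positivity)))
  choose N hN using hsub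
  let ns : ℕ → ℕ := fun k => max (N k) k
  have hns : Tendsto ns atTop atTop := tendsto_atTop_mono (fun k => le_max_right _ _) tendsto_id
  obtain ⟨Q, C, hQ, hQΩ, hpot⟩ := exists_potential hΩ.isOpen
  choose w hww hwl hwQ using fun k => hpot (fun x => f (ns k) x - g x) ((hfi _).sub hgi)
    ((hfo (ns k)).sub hgo (hfi _) hgi)
  refine ⟨fun k x => u x + w k x, fun k => f (ns k), fun k => ?_, fun k => hu.add (hwl k),
    fun k => hf2 _, ?_, hfg.comp hns⟩
  · have := hw.add (hww k) hu (hwl k) hgi ((hfi _).sub hgi)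
    simpa using this
  · have hw0 : ∀ᵐ x ∂volume.restrict Ω, Tendsto (fun k => w k x) atTop (𝓝 0) := by
      rw [hQΩ, ae_restrict_iUnion_iff]
      intro m
      refine ae_tendsto_zero_of_tsum_integral (fun k => (hwQ k m).1)
        (b := fun k => |C m| * (1 / 2) ^ k) (summable_geometric_two.mul_left _) fun k => ?_
      refine ((hwQ k m).2).trans ?_
      have h3 := hN k (ns k) (le_max_left _ _)
      exact mul_le_mul (le_abs_self _) h3 (integral_nonneg fun x => norm_nonneg _) (abs_nonneg _)
    filter_upwards [hw0] with x hx
    simpa using hx.const_add (u x)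

/-- If `f` is bounded with bounded derivative, then `f ∘ u` is a limit of functions of `W^{1,2}`,
namely of the `f ∘ U n` with the functions `U n` of `exists_seq_gradient_tendsto`. -/
theorem mem_closure_of_truncation {p : ℝ≥0∞} [Fact (1 ≤ p)] (hp : p < 2) {Ω : Set Plane}
    (hΩ : IsAdmissibleDomain p.toReal Ω) {u : Plane → ℝ} {g : Plane → Plane}
    (hw : IsWeakGradient Ω u g) (hu : LocallyIntegrableOn u Ω)
    (hg : MemLp g p (volume.restrict Ω)) {f h : ℝ → ℝ} {C : ℝ}
    (hf : ∀ t, HasDerivAt f (h t) t) (hh : Continuous h) (hb : ∀ t, |h t| ≤ 1)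
    (hfC : ∀ t, |f t| ≤ C) (h1 : MemLp (fun x => f (u x)) p (volume.restrict Ω))
    (h2 : MemLp (fun x => h (u x) • g x) p (volume.restrict Ω))
    (h3 : IsWeakGradient Ω (fun x => f (u x)) (fun x => h (u x) • g x)) :
    sobolevMk h1 h2 h3 ∈ closure {w : SobolevSpace p Ω |
      ∃ v : SobolevSpace 2 Ω, sobolevFun w =ᵐ[volume.restrict Ω] sobolevFun v} := by
  have hfin : IsFiniteMeasure (volume.restrict Ω) :=
    ⟨by simpa using hΩ.isBounded.measure_lt_top⟩
  have hp1 : 1 ≤ p := Fact.out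
  have hp0 : p ≠ 0 := (zero_lt_one.trans_le hp1).ne'
  have hpt : p ≠ ⊤ := (hp.trans_le le_top).ne
  have hfc : Continuous f := continuous_iff_continuousAt.2 fun t => (hf t).continuousAt
  obtain ⟨U, G, hUG, hUl, hG2, hUu, hGg⟩ := exists_seq_gradient_tendsto hp hΩ hw hu hg
  choose a b c using fun n =>
    exists_sobolev_truncation hΩ.isOpen (hUG n) (hUl n) one_le_two (hG2 n) hf hh hb hfC
  have hUm := fun n => (hUl n).aestronglyMeasurable
  have a' := fun n => (a n).mono_exponent hp.le
  have b' := fun n => (b n).mono_exponent hp.le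
  refine mem_closure_of_tendsto (tendsto_sobolevMk a' b' c h1 h2 h3 ?_ ?_)
    (Eventually.of_forall fun n => ⟨sobolevMk (a n) (b n) (c n), ?_⟩)
  · refine tendsto_eLpNorm_sub_of_dominated hp0 hpt (fun n => (a' n).1) h1.1
      (memLp_const (C + C)) (fun n x => ?_) ?_
    · exact (norm_sub_le _ _).trans (add_le_add (hfC _) (hfC _))
    · filter_upwards [hUu] with x hx using (hfc.tendsto _).comp hx
  · have l1 : Tendsto (fun n => eLpNorm ((fun x => h (U n x) • g x) - fun x => h (u x) • g x) p
        (volume.restrict Ω)) atTop (𝓝 0) := by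
      refine tendsto_eLpNorm_sub_of_dominated hp0 hpt
        (fun n => (hh.comp_aestronglyMeasurable (hUm n)).smul hg.1) h2.1
        (hg.norm.const_mul 2) (fun n x => ?_) ?_
      · rw [← sub_smul, norm_smul]
        refine mul_le_mul_of_nonneg_right ?_ (norm_nonneg _)
        exact (norm_sub_le _ _).trans ((add_le_add (hb _) (hb _)).trans (by norm_num))
      · filter_upwards [hUu] with x hx using ((hh.tendsto _).comp hx).smul_const (g x)
    have l2 := hGg.add l1
    rw [add_zero] at l2
    refine tendsto_of_tendsto_of_tendsto_of_le_of_le tendsto_const_nhds l2 (fun _ => zero_le)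
      fun n => ?_
    have hD : AEStronglyMeasurable (fun x => h (U n x) • (G n - g) x) (volume.restrict Ω) :=
      (hh.comp_aestronglyMeasurable (hUm n)).smul ((hG2 n).1.sub hg.1)
    have hE : AEStronglyMeasurable ((fun x => h (U n x) • g x) - fun x => h (u x) • g x)
        (volume.restrict Ω) := ((hh.comp_aestronglyMeasurable (hUm n)).smul hg.1).sub h2.1
    have e : (fun x => h (U n x) • G n x) - (fun x => h (u x) • g x) =
        (fun x => h (U n x) • (G n - g) x) +
          ((fun x => h (U n x) • g x) - fun x => h (u x) • g x) := by
      ext1 x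
      simp [smul_sub]
    rw [e]
    refine (eLpNorm_add_le hD hE hp1).trans (add_le_add (eLpNorm_mono fun x => ?_) le_rfl)
    rw [norm_smul]
    exact mul_le_of_le_one_left (norm_nonneg _) (hb _)
  · exact (sobolevFun_sobolevMk _ _ _).trans (sobolevFun_sobolevMk _ _ _).symm

theorem sobolevMk_mem_closure {p : ℝ≥0∞} [Fact (1 ≤ p)] (hp : p < 2) {Ω : Set Plane}
    (hΩ : IsAdmissibleDomain p.toReal Ω) {u : Plane → ℝ} {g : Plane → Plane}
    (hu : MemLp u p (volume.restrict Ω)) (hg : MemLp g p (volume.restrict Ω))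
    (hw : IsWeakGradient Ω u g) :
    sobolevMk hu hg hw ∈ closure {w : SobolevSpace p Ω |
      ∃ v : SobolevSpace 2 Ω, sobolevFun w =ᵐ[volume.restrict Ω] sobolevFun v} := by
  have hfin : IsFiniteMeasure (volume.restrict Ω) :=
    ⟨by simpa using hΩ.isBounded.measure_lt_top⟩
  have hp1 : 1 ≤ p := Fact.out
  have hp0 : p ≠ 0 := (zero_lt_one.trans_le hp1).ne'
  have hpt : p ≠ ⊤ := (hp.trans_le le_top).ne
  have hul : LocallyIntegrableOn u Ω := IntegrableOn.locallyIntegrableOn (hu.integrable hp1)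
  obtain ⟨f, h, hf, hh, hb, hft, hfC, hflim, hhlim⟩ := exists_truncation
  choose C hC using hfC
  choose a b c using fun n =>
    exists_sobolev_truncation hΩ.isOpen hw hul hp1 hg (hf n) (hh n) (hb n) (hC n)
  rw [← closure_closure]
  refine mem_closure_of_tendsto (tendsto_sobolevMk a b c hu hg hw ?_ ?_)
    (Eventually.of_forall fun n => mem_closure_of_truncation hp hΩ hw hul hg (hf n) (hh n) (hb n)
      (hC n) _ _ _)
  · refine tendsto_eLpNorm_sub_of_dominated hp0 hpt (fun n => (a n).1) hu.1
      (hu.norm.const_mul 2) (fun n x => ?_) (ae_of_all _ fun x => hflim _)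
    refine (norm_sub_le _ _).trans ?_
    rw [two_mul]
    exact add_le_add (hft n _) le_rfl
  · refine tendsto_eLpNorm_sub_of_dominated hp0 hpt (fun n => (b n).1) hg.1
      (hg.norm.const_mul 2) (fun n x => ?_) (ae_of_all _ fun x => ?_)
    · refine (norm_sub_le _ _).trans ?_
      rw [two_mul, norm_smul]
      exact add_le_add (mul_le_of_le_one_left (norm_nonneg _) (hb n _)) le_rfl
    · simpa using (hhlim (u x)).smul_const (g x)

theorem theorem3p7 (p : ℝ≥0∞) [Fact (1 ≤ p)] (hp : p < 2) (Ω : Set Plane)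
    (hΩ : IsAdmissibleDomain p.toReal Ω) :
    (∀ v : SobolevSpace 2 Ω, ∃ w : SobolevSpace p Ω, sobolevFun w =ᵐ[volume.restrict Ω] sobolevFun v) ∧
      Dense {w : SobolevSpace p Ω |
        ∃ v : SobolevSpace 2 Ω, sobolevFun w =ᵐ[volume.restrict Ω] sobolevFun v} := by
  have hfin : IsFiniteMeasure (volume.restrict Ω) :=
    ⟨by simpa using hΩ.isBounded.measure_lt_top⟩
  refine ⟨exists_sobolev_le hp.le, fun w => ?_⟩
  have hw : w = sobolevMk (Lp.memLp w.1.fst) (Lp.memLp w.1.snd) w.2 := Subtype.ext <| by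
    change w.1 = WithLp.toLp p ((Lp.memLp w.1.fst).toLp _, (Lp.memLp w.1.snd).toLp _)
    rw [Lp.toLp_coeFn, Lp.toLp_coeFn]
    rfl
  rw [hw]
  exact sobolevMk_mem_closure hp hΩ _ _ _

end
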